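/- **Setting.** Let tasks $i\in\mathcal I$ be drawn from a probability distribution $p$; task $i$ has a data distribution, sample losses $l_i(w;\tau)$, $w\in\mathbb R^d$ (twice differentiable in $w$), and loss $l_i(w)=\mathbb E_\tau l_i(w;\tau)$, where the sample gradients and Hessians are unbiased: $\mathbb E_\tau\nabla l_i(w;\tau)=\nabla l_i(w)$, $\mathbb E_\tau\nabla^2 l_i(w;\tau)=\nabla^2 l_i(w)$. Let $l(w)=\mathbb E_{i\sim p}\,l_i(w)$. Fix $\alpha>0$ and $N\ge 1$; let $\widetilde w^i_0=w$, $\widetilde w^i_{j+1}=\widetilde w^i_j-\alpha\nabla l_i(\widetilde w^i_j)$ and $$\mathcal L(w)=\mathbb E_{i\sim p}\,l_i(\widetilde w^i_N(w)),\qquad \mathcal L^*=\inf_w\mathcal L(w),\qquad \Delta=\mathcal L(w_0)-\mathcal L^*.$$ **Assumptions.** There are $L,\rho,\sigma,\sigma_g,\sigma_H>0$ such that for all $i,w,u$ (Euclidean and spectral norms): $l_i$ is bounded below (and so is $\mathcal L$, which is automatic for finitely many tasks), $l_i$ is twice differentiable, $\|\nabla l_i(w)-\nabla l_i(u)\|\le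 L\|w-u\|$, $\|\nabla^2 l_i(w)-\nabla^2 l_i(u)\|\le\rho\|w-u\|$, $\mathbb E_{i\sim p}\|\nabla l_i(w)-\nabla l(w)\|^2\le\sigma^2$, $\mathbb E_\tau\|\nabla l_i(w;\tau)-\nabla l_i(w)\|^2\le\sigma_g^2$, $\mathbb E_\tau\|\nabla^2 l_i(w;\tau)-\nabla^2 l_i(w)\|^2\le\sigma_H^2$. **Algorithm (multi-step MAML, resampling case).** Write $\nabla l_i(w;\Omega)$, $\nabla^2 l_i(w;\Omega)$ for averages over a batch $\Omega$. At iteration $k=0,1,\dots,K-1$ draw $B$ i.i.d. tasks $B_k$ from $p$. For each, draw independent batches of i.i.d. data of that task $S^i_{k,j}$, $D^i_{k,j}$ ($0\le j<N$), $T^i_k$ of sizes $S,D,T$; put $w^i_{k,0}=w_k$, $w^i_{k,j+1}=w^i_{k,j}-\alpha\nabla l_i(w^i_{k,j};S^i_{k,j})$ and $$\widehat G_i(w_k)=\prod_{j=0}^{N-1}\big(I-\alpha\nabla^2l_i(w^i_{k,j};D^i_{k,j})\big)\nabla l_i(w^i_{k,N};T^i_k).$$ Independently draw i.i.d. tasks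 $B_k'$ and data batches $D^i_{L_k}$ of these tasks, and set $$\widehat L_{w_k}=(1+\alpha L)^{2N}L+\frac{C_{\mathcal L}}{|B_k'|}\sum_{i\in B_k'}\|\nabla l_i(w_k;D^i_{L_k})\|,\qquad \beta_k=\frac1{C_\beta\widehat L_{w_k}},\qquad w_{k+1}=w_k-\frac{\beta_k}{B}\sum_{i\in B_k}\widehat G_i(w_k),$$ $$C_{\mathcal L}=\Big((1+\alpha L)^{N-1}\alpha\rho+\tfrac{\rho}{L}(1+\alpha L)^N\big((1+\alpha L)^{N-1}-1\big)\Big)(1+\alpha L)^N.$$ All draws in all iterations are independent. The output is $w_\zeta$ with $\zeta$ uniform on $\{0,\dots,K-1\}$, independent of all else. All batch sizes and $K$ are at least $1$, and $$|B_k'|>\frac{4C_{\mathcal L}^2\sigma^2}{3(1+\alpha L)^{4N}L^2},\qquad |D^i_{L_k}|>\frac{64\sigma_g^2C_{\mathcal L}^2}{(1+\alpha L)^{4N}L^2}.\tag{1}$$ **Constants.** With $q=(1+\alpha L)^N$ let $$C_{e1}=q^2\sigma_g,\quad C_{e2}=\frac{q^4\rho\sigma_g}{(2-q^2)L^2},\quad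 C_{s1}=3\Big(\frac{\alpha^2\sigma_H^2}{D}+(1+\alpha L)^2\Big)^N\sigma_g^2,$$ $$C_{s2}=C_{s1}\big((1+2\alpha L+2\alpha^2L^2)^N-1\big)\frac{\alpha L}{1+\alpha L},\quad C_{s3}=\frac{2C_{s1}q^2}{(2-q^2)^2\sigma_g^2},\quad \chi=\frac{(2-q^2)q^2L}{C_{\mathcal L}}+\sigma,$$ $$\xi=\frac{6}{C_\beta L}\Big(\frac15+\frac2{C_\beta}\Big)(C_{e1}^2+C_{e2}^2\sigma^2),\qquad \phi=\frac{2}{C_\beta^2L}\Big(\frac{C_{s1}}T+\frac{C_{s2}}S+C_{s3}\sigma^2\Big),$$ $$\theta=\frac{2(2-q^2)}{C_\beta C_{\mathcal L}}\Big(\frac15-\Big(\frac35+\frac6{C_\beta}\Big)\frac{C_{e2}^2}{S}-\frac{C_{s3}}{C_\beta B}-\frac2{C_\beta}\Big).$$ **Theorem.** (a) If $0<\alpha<(2^{1/(2N)}-1)/L$, $C_\beta>0$, (1) holds and $\theta>0$, then $$\mathbb E\|\nabla\mathcal L(w_\zeta)\|\le R+\sqrt{\chi/2}\,\sqrt{R},\qquad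 R=\frac{\Delta}{\theta K}+\frac{\xi}{\theta S}+\frac{\phi}{\theta B}.$$ (b) Let $\alpha=\frac1{8NL}$, $C_\beta=100$, $S\ge 15\rho^2\sigma_g^2/L^4$, $D\ge\sigma_H^2/L^2$ and let (1) hold. There is a constant $C$ depending only on $L$, $\rho$ and (an upper bound on) $\Delta$ such that $$\mathbb E\|\nabla\mathcal L(w_\zeta)\|\le C\big(r+\sqrt{\sigma+1}\,\sqrt r\big),\qquad r=\frac1K+\frac{\sigma_g^2(\sigma^2+1)}{S}+\frac{\sigma_g^2+\sigma^2}{B}+\frac{\sigma_g^2}{TB}.$$ (c) There is a constant $C$ depending only on $L,\rho,\sigma,\sigma_g,\sigma_H$ and (an upper bound on) $\Delta$ such that for every $N\ge1$ and $0<\epsilon\le1$ there are $K$ and batch sizes as in (b) (with $\alpha=\frac{1}{8NL}$, $C_\beta=100$) for which $\mathbb E\|\nabla\mathcal L(w_\zeta)\|<\epsilon$, while $K\le C\epsilon^{-2}$, and each meta iteration uses at most $C(N\epsilon^{-4}+\epsilon^{-2})$ evaluations of sample gradients, namely $B(NS+T)+\sum_{i\in B_k'}|D^i_{L_k}|$,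 and at most $CN\epsilon^{-2}$ evaluations of sample Hessians, namely $BND$. In all parts $\mathcal L$ is differentiable and $\|\nabla\mathcal L(w_\zeta)\|$ is integrable. -/

import Mathlib

open MeasureTheory ProbabilityTheory
open scoped ENNReal

noncomputable section

namespace MAML

/-- The parameter space `ℝ^d` with its Euclidean norm. -/
abbrev Param (d : ℕ) : Type := EuclideanSpace ℝ (Fin d)

/-- The Hessian of `f` at `w`, as an operator on `ℝ^d`; its norm is the spectral norm. -/
def hessian {d : ℕ} (f : Param d → ℝ) (w : Param d) : Param d →L[ℝ] Param d :=
  fderiv ℝ (fun u => gradient f u) w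

/-- The Markov kernel that draws, for a given `i`, a family of i.i.d. samples of `κ i`. -/
def iidKernel {I 𝒟 : Type*} [MeasurableSpace I] [MeasurableSpace 𝒟]
    (κ : Kernel I 𝒟) [IsMarkovKernel κ] (ι : Type*) [Fintype ι] : Kernel I (ι → 𝒟) where
  toFun i := Measure.pi fun _ : ι => κ i
  measurable' := by
    refine Measurable.measure_of_isPiSystem_of_isProbabilityMeasure
      (generateFrom_pi (α := fun _ : ι => 𝒟)).symm isPiSystem_pi ?_
    rintro _ ⟨s, hs, rfl⟩
    simp only [Measure.pi_pi]
    exact Finset.measurable_prod _ fun a _ => κ.measurable_coe (hs a (Set.mem_univ a))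

/-- A family of tasks indexed by `I`: a probability distribution of tasks, for each task a
probability distribution of data samples, and the sample losses `l_i(w; τ) = loss i τ w`. -/
structure TaskFamily (d : ℕ) (I 𝒟 : Type*) [MeasurableSpace I] [MeasurableSpace 𝒟] where
  taskLaw : Measure I
  dataLaw : Kernel I 𝒟
  loss : I → 𝒟 → Param d → ℝ
  [isProb : IsProbabilityMeasure taskLaw]
  [isMarkov : IsMarkovKernel dataLaw]

attribute [instance] TaskFamily.isProb TaskFamily.isMarkov

section Objective

variable {d : ℕ} {I 𝒟 : Type*} [MeasurableSpace I] [MeasurableSpace 𝒟]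

/-- The task loss `l_i(w) = E_τ l_i(w; τ)`. -/
def taskLoss (P : TaskFamily d I 𝒟) (i : I) (w : Param d) : ℝ :=
  ∫ τ, P.loss i τ w ∂(P.dataLaw i)

/-- The expected loss `l(w) = E_i l_i(w)`. -/
def meanLoss (P : TaskFamily d I 𝒟) (w : Param d) : ℝ :=
  ∫ i, taskLoss P i w ∂P.taskLaw

/-- The parameter obtained from `w` by `N` exact inner gradient steps
`w ↦ w - α ∇l_i(w)`. -/
def innerGD (P : TaskFamily d I 𝒟) (α : ℝ) (N : ℕ) (i : I) (w : Param d) : Param d :=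
  (fun u => u - α • gradient (taskLoss P i) u)^[N] w

/-- The meta objective `𝓛(w) = E_i l_i(w̃_N^i(w))`. -/
def metaLoss (P : TaskFamily d I 𝒟) (α : ℝ) (N : ℕ) (w : Param d) : ℝ :=
  ∫ i, taskLoss P i (innerGD P α N i w) ∂P.taskLaw

/-- The assumptions on the losses: well-posedness of the sampling model (measurability,
integrability, twice differentiable sample losses, unbiased sample gradients and Hessians);
smoothness of the task losses, with `L` and `ρ` common Lipschitz constants; bounded variances. -/
structure Assumptions (P : TaskFamily d I 𝒟) (L ρ σ σg σH : ℝ) : Prop where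
  measurable_loss : Measurable fun x : I × 𝒟 × Param d => P.loss x.1 x.2.1 x.2.2
  integrable_loss : ∀ i w, Integrable (fun τ => P.loss i τ w) (P.dataLaw i)
  integrable_taskLoss : ∀ w, Integrable (fun i => taskLoss P i w) P.taskLaw
  differentiable_loss : ∀ i τ, Differentiable ℝ (P.loss i τ)
  differentiable_grad_loss : ∀ i τ, Differentiable ℝ fun w => gradient (P.loss i τ) w
  unbiased_grad : ∀ i w,
    ∫ τ, gradient (P.loss i τ) w ∂(P.dataLaw i) = gradient (taskLoss P i) w
  unbiased_hessian : ∀ i w,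
    ∫ τ, hessian (P.loss i τ) w ∂(P.dataLaw i) = hessian (taskLoss P i) w
  bddBelow : ∀ i, BddBelow (Set.range (taskLoss P i))
  differentiable : ∀ i, Differentiable ℝ (taskLoss P i)
  differentiable_grad : ∀ i, Differentiable ℝ fun w => gradient (taskLoss P i) w
  lipschitz_grad : ∀ i w u,
    ‖gradient (taskLoss P i) w - gradient (taskLoss P i) u‖ ≤ L * ‖w - u‖
  lipschitz_hessian : ∀ i w u,
    ‖hessian (taskLoss P i) w - hessian (taskLoss P i) u‖ ≤ ρ * ‖w - u‖
  variance_task : ∀ w,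
    ∫⁻ i, ‖gradient (taskLoss P i) w - gradient (meanLoss P) w‖ₑ ^ 2 ∂P.taskLaw
      ≤ ENNReal.ofReal (σ ^ 2)
  variance_grad : ∀ i w,
    ∫⁻ τ, ‖gradient (P.loss i τ) w - gradient (taskLoss P i) w‖ₑ ^ 2 ∂(P.dataLaw i)
      ≤ ENNReal.ofReal (σg ^ 2)
  variance_hessian : ∀ i w,
    ∫⁻ τ, ‖hessian (P.loss i τ) w - hessian (taskLoss P i) w‖ₑ ^ 2 ∂(P.dataLaw i)
      ≤ ENNReal.ofReal (σH ^ 2)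

end Objective

/-- The batch sizes: `S` for each inner gradient, `D` for each Hessian, `T` for the outer
gradient, `B` tasks per meta update; at meta iteration `k`, `B' k` tasks are drawn for the
smoothness estimate and the `b`-th of them uses `DL k b` samples. -/
structure BatchSizes where
  S : ℕ
  D : ℕ
  T : ℕ
  B : ℕ
  B' : ℕ → ℕ
  DL : ℕ → ℕ → ℕ

/-- `S, D, T, B ≥ 1`. -/
def BatchSizes.Pos (z : BatchSizes) : Prop := 1 ≤ z.S ∧ 1 ≤ z.D ∧ 1 ≤ z.T ∧ 1 ≤ z.B

/-- Number of evaluations of sample gradients in meta iteration `k`: each of the `B` tasks uses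
`N` inner batches of size `S` and one outer batch of size `T`, and the smoothness estimate uses
`DL k b` samples for its `b`-th task. -/
def BatchSizes.gradEvals (z : BatchSizes) (N k : ℕ) : ℕ :=
  z.B * (N * z.S + z.T) + ∑ b : Fin (z.B' k), z.DL k b

/-- Number of evaluations of sample Hessians in a meta iteration: each of the `B` tasks uses
`N` batches of size `D`. -/
def BatchSizes.hessEvals (z : BatchSizes) (N : ℕ) : ℕ := z.B * (N * z.D)

/-- The data samples used for one task in a meta iteration: the inner batches `S_j`,
the Hessian batches `D_j` (`j < N`), and the outer batch `T`. -/
abbrev Slot (N : ℕ) (z : BatchSizes) : Type :=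
  (Fin N × Fin z.S) ⊕ (Fin N × Fin z.D) ⊕ Fin z.T

/-- The randomness of meta iteration `k`: `B` tasks with their data, and the separately drawn
`B' k` tasks with their data for the smoothness estimate. -/
abbrev Seed (I 𝒟 : Type*) (N : ℕ) (z : BatchSizes) (k : ℕ) : Type _ :=
  (Fin z.B → I × (Slot N z → 𝒟)) × (∀ b : Fin (z.B' k), I × (Fin (z.DL k b) → 𝒟))

section Algorithm

variable {d : ℕ} {I 𝒟 : Type*} [MeasurableSpace I] [MeasurableSpace 𝒟]

/-- The law of a random task together with i.i.d. data of that task. -/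
def drawLaw (P : TaskFamily d I 𝒟) (ι : Type*) [Fintype ι] : Measure (I × (ι → 𝒟)) :=
  P.taskLaw ⊗ₘ iidKernel P.dataLaw ι

/-- All the draws of a meta iteration are independent. -/
def seedLaw (P : TaskFamily d I 𝒟) (N : ℕ) (z : BatchSizes) (k : ℕ) :
    Measure (Seed I 𝒟 N z k) :=
  (Measure.pi fun _ : Fin z.B => drawLaw P (Slot N z)).prod
    (Measure.pi fun b : Fin (z.B' k) => drawLaw P (Fin (z.DL k b)))

/-- The mini-batch gradient `∇l_i(w; Ω)`. -/
def batchGrad (P : TaskFamily d I 𝒟) (i : I) {n : ℕ} (x : Fin n → 𝒟) (w : Param d) : Param d :=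
  (n : ℝ)⁻¹ • ∑ a, gradient (P.loss i (x a)) w

/-- The mini-batch Hessian `∇²l_i(w; Ω)`. -/
def batchHess (P : TaskFamily d I 𝒟) (i : I) {n : ℕ} (x : Fin n → 𝒟) (w : Param d) :
    Param d →L[ℝ] Param d :=
  (n : ℝ)⁻¹ • ∑ a, hessian (P.loss i (x a)) w

/-- The stochastic inner iterates `w_0 = w`, `w_{j+1} = w_j - α ∇l_i(w_j; S_j)`, `j < N`. -/
def innerSGD (P : TaskFamily d I 𝒟) (α : ℝ) {N : ℕ} {z : BatchSizes} (i : I)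
    (x : Slot N z → 𝒟) (w : Param d) : Fin (N + 1) → Param d :=
  Fin.induction (motive := fun _ => Param d) w fun j wj =>
    wj - α • batchGrad P i (fun s : Fin z.S => x (Sum.inl (j, s))) wj

/-- The meta gradient estimator
`Ĝ_i(w) = (∏_{j<N} (I - α ∇²l_i(w_j; D_j))) ∇l_i(w_N; T)`, factors ordered from left to right. -/
def metaGradEst (P : TaskFamily d I 𝒟) (α : ℝ) {N : ℕ} {z : BatchSizes} (i : I)
    (x : Slot N z → 𝒟) (w : Param d) : Param d :=
  (List.ofFn fun j : Fin N =>
      (1 : Param d →L[ℝ] Param d) - α • batchHess P i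
        (fun r : Fin z.D => x (Sum.inr (Sum.inl (j, r)))) (innerSGD P α i x w j.castSucc)).prod
    (batchGrad P i (fun t : Fin z.T => x (Sum.inr (Sum.inr t))) (innerSGD P α i x w (Fin.last N)))

/-- The constant `C_𝓛`. -/
def CL (α L ρ : ℝ) (N : ℕ) : ℝ :=
  ((1 + α * L) ^ (N - 1) * α * ρ + ρ / L * (1 + α * L) ^ N * ((1 + α * L) ^ (N - 1) - 1))
    * (1 + α * L) ^ N

/-- The sampled smoothness estimate `L̂_w`. -/
def smoothEst (P : TaskFamily d I 𝒟) (α L ρ : ℝ) {N : ℕ} {z : BatchSizes} {k : ℕ}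
    (s : Seed I 𝒟 N z k) (w : Param d) : ℝ :=
  (1 + α * L) ^ (2 * N) * L
    + CL α L ρ N * (∑ b, ‖batchGrad P (s.2 b).1 (s.2 b).2 w‖) / (z.B' k : ℝ)

/-- One meta iteration, with stepsize `β_k = 1 / (C_β L̂_w)`. -/
def metaStep (P : TaskFamily d I 𝒟) (α L ρ Cβ : ℝ) {N : ℕ} {z : BatchSizes} {k : ℕ}
    (s : Seed I 𝒟 N z k) (w : Param d) : Param d :=
  w - (1 / (Cβ * smoothEst P α L ρ s w)) •
    ((z.B : ℝ)⁻¹ • ∑ b, metaGradEst P α (s.1 b).1 (s.1 b).2 w)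

/-- The meta parameters `w_0, w_1, …`. -/
def iterates (P : TaskFamily d I 𝒟) (α L ρ Cβ : ℝ) {N : ℕ} {z : BatchSizes}
    (s : ∀ k, Seed I 𝒟 N z k) (w₀ : Param d) : ℕ → Param d
  | 0 => w₀
  | k + 1 => metaStep P α L ρ Cβ (s k) (iterates P α L ρ Cβ s w₀ k)

/-- The randomness of a run: fresh independent samples in every meta iteration, and an output
index `ζ` that is uniform on `{0, …, K - 1}` and independent of them. -/
structure IsRun {Ω : Type*} [MeasurableSpace Ω] (P : TaskFamily d I 𝒟) {N : ℕ} {z : BatchSizes}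
    {K : ℕ} (μ : Measure Ω) (ξ : ∀ k, Ω → Seed I 𝒟 N z k) (ζ : Ω → Fin K) : Prop where
  seed_law : ∀ k, HasLaw (ξ k) (seedLaw P N z k) μ
  seed_indep : iIndepFun ξ μ
  zeta_law : HasLaw ζ (uniformOn Set.univ) μ
  zeta_indep : IndepFun ζ (fun ω k => ξ k ω) μ

/-- `‖∇𝓛(w_ζ)‖` as a random variable. -/
def outputGradNorm {Ω : Type*} (P : TaskFamily d I 𝒟) (α L ρ Cβ : ℝ) {N : ℕ} {z : BatchSizes}
    {K : ℕ} (ξ : ∀ k, Ω → Seed I 𝒟 N z k) (ζ : Ω → Fin K) (w₀ : Param d) (ω : Ω) : ℝ :=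
  ‖gradient (metaLoss P α N) (iterates P α L ρ Cβ (fun k => ξ k ω) w₀ (ζ ω))‖

/-- `Δ = 𝓛(w₀) - inf 𝓛`. -/
def initialGap (P : TaskFamily d I 𝒟) (α : ℝ) (N : ℕ) (w₀ : Param d) : ℝ :=
  metaLoss P α N w₀ - ⨅ w, metaLoss P α N w

end Algorithm

/-- The lower bounds on the sizes of the batches in the smoothness estimate. -/
def BatchSizes.SmoothOK (z : BatchSizes) (N : ℕ) (α L ρ σ σg : ℝ) : Prop :=
  ∀ k, 4 * CL α L ρ N ^ 2 * σ ^ 2 / (3 * (1 + α * L) ^ (4 * N) * L ^ 2) < (z.B' k : ℝ) ∧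
    ∀ b : Fin (z.B' k),
      64 * σg ^ 2 * CL α L ρ N ^ 2 / ((1 + α * L) ^ (4 * N) * L ^ 2) < (z.DL k b : ℝ)

section Constants

/-- `C_err1`. -/
def Cerr1 (α L σg : ℝ) (N : ℕ) : ℝ := (1 + α * L) ^ (2 * N) * σg

/-- `C_err2`. -/
def Cerr2 (α L ρ σg : ℝ) (N : ℕ) : ℝ :=
  (1 + α * L) ^ (4 * N) * ρ * σg / ((2 - (1 + α * L) ^ (2 * N)) * L ^ 2)

/-- `C_squ1`. -/
def Csqu1 (α L σg σH : ℝ) (N : ℕ) (z : BatchSizes) : ℝ :=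
  3 * (α ^ 2 * σH ^ 2 / z.D + (1 + α * L) ^ 2) ^ N * σg ^ 2

/-- `C_squ2`. -/
def Csqu2 (α L σg σH : ℝ) (N : ℕ) (z : BatchSizes) : ℝ :=
  Csqu1 α L σg σH N z * ((1 + 2 * α * L + 2 * α ^ 2 * L ^ 2) ^ N - 1) * (α * L)
    * (1 + α * L)⁻¹

/-- `C_squ3`. -/
def Csqu3 (α L σg σH : ℝ) (N : ℕ) (z : BatchSizes) : ℝ :=
  2 * Csqu1 α L σg σH N z * (1 + α * L) ^ (2 * N)
    / ((2 - (1 + α * L) ^ (2 * N)) ^ 2 * σg ^ 2)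

/-- `χ`. -/
def chi (α L ρ σ : ℝ) (N : ℕ) : ℝ :=
  (2 - (1 + α * L) ^ (2 * N)) * (1 + α * L) ^ (2 * N) * L / CL α L ρ N + σ

/-- `ξ`. -/
def xi (α L ρ σ σg Cβ : ℝ) (N : ℕ) : ℝ :=
  6 / (Cβ * L) * (1 / 5 + 2 / Cβ) * (Cerr1 α L σg N ^ 2 + Cerr2 α L ρ σg N ^ 2 * σ ^ 2)

/-- `φ`. -/
def phi (α L σ σg σH Cβ : ℝ) (N : ℕ) (z : BatchSizes) : ℝ :=
  2 / (Cβ ^ 2 * L) *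
    (Csqu1 α L σg σH N z / z.T + Csqu2 α L σg σH N z / z.S + Csqu3 α L σg σH N z * σ ^ 2)

/-- `θ`. -/
def theta (α L ρ σg σH Cβ : ℝ) (N : ℕ) (z : BatchSizes) : ℝ :=
  2 * (2 - (1 + α * L) ^ (2 * N)) / (Cβ * CL α L ρ N) *
    (1 / 5 - (3 / 5 + 6 / Cβ) * (Cerr2 α L ρ σg N ^ 2 / z.S)
      - Csqu3 α L σg σH N z / (Cβ * z.B) - 2 / Cβ)

/-- `Δ/(θK) + ξ/(θS) + φ/(θB)`. -/
def mainRate (Δ α L ρ σ σg σH Cβ : ℝ) (N : ℕ) (z : BatchSizes) (K : ℕ) : ℝ :=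
  Δ / theta α L ρ σg σH Cβ N z * (1 / K)
    + xi α L ρ σ σg Cβ N / theta α L ρ σg σH Cβ N z * (1 / z.S)
    + phi α L σ σg σH Cβ N z / theta α L ρ σg σH Cβ N z * (1 / z.B)

/-- `1/K + σ_g²(σ²+1)/S + (σ_g²+σ²)/B + σ_g²/(TB)`. -/
def simpleRate (σ σg : ℝ) (z : BatchSizes) (K : ℕ) : ℝ :=
  1 / K + σg ^ 2 * (σ ^ 2 + 1) / z.S + (σg ^ 2 + σ ^ 2) / z.B + σg ^ 2 / (z.T * z.B)

end Constants

end MAML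

end

/-! Write q = (1+αL)^N and x = ‖∇𝓛(w)‖. The proof is a descent argument for an objective whose
smoothness constant varies with the point. By the chain rule, ∇𝓛(w) is the task average of ∏(I −
α∇²l_i(w̃_j)) ∇l_i(w̃_N). Comparing two such products factor by factor gives ‖∇𝓛(u) − ∇𝓛(w)‖ ≤
ℓ(w)‖u − w‖ with ℓ(w) = q²L + C_𝓛 E_i‖∇l_i(w)‖ (`norm_gradient_metaLoss_sub_le`). No global constant
is needed: a bound anchored at w already yields the quadratic upper bound at w
(`le_quadratic_of_gradient_lipschitz_at`).

Two independent random quantities enter a step. The first is the meta gradient estimator. Its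
Hessian and outer batches are independent of the inner iterates, so averaging them out turns sampled
factors into exact ones (`integral_metaGradEst_eq`). What remains of the bias comes from the drift
of the stochastic inner iterates, of order σ_g/√S; peeling off factors in the same manner bounds the
second moment. The second quantity is 1/L̂_w. Condition (1) keeps L̂_w close to ℓ(w) in mean and in
mean square, and L̂_w ≥ q²L always, so that ℓ E[1/L̂] lies in [8/9, 5/2] and ℓ² E[1/L̂²] ≤ 4
(`inv_moments`). The condition q² < 2 gives E_i‖∇l_i(w)‖ ≤ (x+σ)/(2−q²), by which all these bounds
become functions of x alone.

The expected decrease of 𝓛 is therefore at least E·x²/(C_β ℓ(w)) − F/(C_β L) (`expected_descent`,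
`IsRun.output_bound_of_quadratic`). As ℓ(w) ≤ U(x+χ), the gain is at least a multiple of x²/(x+χ).
Telescoping over the run and averaging over ζ bounds the mean of x²/(x+χ) by some r. By convexity y
= E x satisfies y² ≤ r(y+χ), whence y ≤ r + √(χr).

The simplified rate repeats this with numerical constants that are uniform in N because
(1+1/(8N))^{2N} ≤ e^{1/4}. The complexity follows by taking K = B = n with n of order ε⁻² and S = n
plus a constant. -/

noncomputable section

namespace MAML

/-! ### Deterministic calculus of gradient steps and exact meta gradients. -/

section Deterministic

variable {d : ℕ}

/-- Quadratic upper bound for a differentiable function whose gradient is Lipschitz at one point. -/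
theorem le_quadratic_of_gradient_lipschitz_at {f : Param d → ℝ} (hf : Differentiable ℝ f)
    {w : Param d} {Λ : ℝ} (hL : ∀ u, ‖gradient f u - gradient f w‖ ≤ Λ * ‖u - w‖) (u : Param d) :
    f u ≤ f w + inner ℝ (gradient f w) (u - w) + Λ / 2 * ‖u - w‖ ^ 2 := by
  set v := u - w with hv
  let φ : ℝ → ℝ := fun t => f (w + t • v) - t * inner ℝ (gradient f w) v - Λ / 2 * t ^ 2 * ‖v‖ ^ 2
  have hder : ∀ t, HasDerivAt φ
      (inner ℝ (gradient f (w + t • v)) v - inner ℝ (gradient f w) v - Λ * t * ‖v‖ ^ 2) t := by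
    intro t
    have h1 : HasDerivAt (fun t : ℝ => w + t • v) v t := by
      simpa using ((hasDerivAt_id t).smul_const v).const_add w
    have h2 : HasDerivAt (fun t : ℝ => f (w + t • v)) (inner ℝ (gradient f (w + t • v)) v) t := by
      have := (hf (w + t • v)).hasFDerivAt.comp_hasDerivAt t h1
      rwa [← inner_gradient_left] at this
    have h3 : HasDerivAt (fun t : ℝ => t * inner ℝ (gradient f w) v)
        (inner ℝ (gradient f w) v) t := by
      simpa using (hasDerivAt_id t).mul_const (inner ℝ (gradient f w) v)
    have h4 : HasDerivAt (fun t : ℝ => Λ / 2 * t ^ 2 * ‖v‖ ^ 2) (Λ * t * ‖v‖ ^ 2) t := by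
      have := ((hasDerivAt_pow 2 t).const_mul (Λ / 2)).mul_const (‖v‖ ^ 2)
      refine this.congr_deriv ?_
      push_cast
      ring
    exact (h2.sub h3).sub h4
  -- The derivative is ⟪∇f(w+tv) − ∇f(w), v⟫ − Λt‖v‖², nonpositive for t > 0 by Cauchy–Schwarz. Only
  -- gradient differences from the base point w occur.
  have hanti : AntitoneOn φ (Set.Icc 0 1) := by
    refine antitoneOn_of_deriv_nonpos (convex_Icc 0 1)
      (fun t _ => (hder t).continuousAt.continuousWithinAt)
      (fun t _ => (hder t).differentiableAt.differentiableWithinAt) ?_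
    intro t ht
    rw [interior_Icc] at ht
    rw [(hder t).deriv, ← inner_sub_left]
    have h1 := real_inner_le_norm (gradient f (w + t • v) - gradient f w) v
    have h2 := hL (w + t • v)
    rw [add_sub_cancel_left, norm_smul, Real.norm_eq_abs, abs_of_pos ht.1] at h2
    have h3 := mul_le_mul_of_nonneg_right h2 (norm_nonneg v)
    nlinarith
  have := hanti (Set.left_mem_Icc.2 zero_le_one) (Set.right_mem_Icc.2 zero_le_one) zero_le_one
  simp only [φ, one_smul, zero_smul, add_zero] at this
  rw [hv, add_sub_cancel] at this
  rw [hv]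
  linarith

/-- The quadratic upper bound applied to `f` and to `-f`. It serves to prove integrability of the
task loss after the inner steps. -/
theorem abs_sub_le_of_gradient_lipschitz {f : Param d → ℝ} (hf : Differentiable ℝ f) {Λ : ℝ}
    (hΛ : 0 ≤ Λ) (hL : ∀ w u, ‖gradient f w - gradient f u‖ ≤ Λ * ‖w - u‖) (w u : Param d) :
    |f u - f w| ≤ ‖gradient f w‖ * ‖u - w‖ + Λ * ‖u - w‖ ^ 2 := by
  have h1 := le_quadratic_of_gradient_lipschitz_at hf (w := w) (fun v => hL v w) u
  have h2 := le_quadratic_of_gradient_lipschitz_at hf (w := u) (fun v => hL v u) w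
  have h3 := real_inner_le_norm (gradient f w) (u - w)
  have h4 := real_inner_le_norm (gradient f u) (w - u)
  have h5 : ‖gradient f u‖ ≤ ‖gradient f w‖ + Λ * ‖u - w‖ := by
    have := norm_sub_norm_le (gradient f u) (gradient f w)
    linarith [hL u w]
  -- the lower bound is obtained at `w` from the concave counterpart
  have h6 := le_quadratic_of_gradient_lipschitz_at (f := fun v => -f v) hf.neg (w := w) (Λ := Λ)
    (fun v => by
      have hg : ∀ v, gradient (fun v => -f v) v = -gradient f v := fun v => by
        simp [gradient, fderiv_fun_neg]
      rw [hg, hg, neg_sub_neg, norm_sub_rev]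
      exact hL v w) u
  have hg : gradient (fun v => -f v) w = -gradient f w := by
    simp [gradient, fderiv_fun_neg]
  rw [hg, inner_neg_left] at h6
  have h7 := abs_le.1 (abs_real_inner_le_norm (gradient f w) (u - w))
  have h8 : 0 ≤ Λ * ‖u - w‖ ^ 2 := by positivity
  rw [abs_le]
  constructor <;> nlinarith [h7.1, h7.2]

/-- A twice differentiable function with Lipschitz gradient and Hessian. -/
structure SmoothLoss (f : Param d → ℝ) (L ρ : ℝ) : Prop where
  differentiable : Differentiable ℝ f
  differentiable_grad : Differentiable ℝ fun w => gradient f w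
  lipschitz_grad : ∀ w u, ‖gradient f w - gradient f u‖ ≤ L * ‖w - u‖
  lipschitz_hessian : ∀ w u, ‖hessian f w - hessian f u‖ ≤ ρ * ‖w - u‖

/-- Schwarz's theorem for a differentiable gradient. It lets the chain rule produce I − α∇²f itself
where the adjoint would appear, which matches the untransposed factors of the estimator. -/
theorem inner_hessian_comm {f : Param d → ℝ} (hf : Differentiable ℝ f)
    (hg : Differentiable ℝ fun w => gradient f w) (w u v : Param d) :
    inner ℝ (hessian f w u) v = inner ℝ u (hessian f w v) := by
  let J : Param d →L[ℝ] StrongDual ℝ (Param d) :=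
    (InnerProductSpace.toDual ℝ (Param d)).toContinuousLinearEquiv.toContinuousLinearMap
  have h1 : ∀ᶠ y in nhds w, HasFDerivAt f (J (gradient f y)) y :=
    Filter.Eventually.of_forall fun y => (hf y).hasGradientAt.hasFDerivAt
  have h2 : HasFDerivAt (fun y => J (gradient f y)) (J.comp (hessian f w)) w :=
    J.hasFDerivAt.comp w (hg w).hasFDerivAt
  have := second_derivative_symmetric_of_eventually_of_real h1 h2 u v
  simp only [ContinuousLinearMap.comp_apply] at this
  change inner ℝ (hessian f w u) v = inner ℝ (hessian f w v) u at this
  rw [this, real_inner_comm]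

/-- `N` exact gradient steps. -/
def gdIter (f : Param d → ℝ) (α : ℝ) (N : ℕ) (w : Param d) : Param d :=
  (fun u => u - α • gradient f u)^[N] w

theorem gdIter_zero (f : Param d → ℝ) (α : ℝ) (w : Param d) : gdIter f α 0 w = w := rfl

theorem gdIter_succ (f : Param d → ℝ) (α : ℝ) (N : ℕ) (w : Param d) :
    gdIter f α (N + 1) w = gdIter f α N (w - α • gradient f w) := rfl

theorem gdIter_succ' (f : Param d → ℝ) (α : ℝ) (N : ℕ) (w : Param d) :
    gdIter f α (N + 1) w = gdIter f α N w - α • gradient f (gdIter f α N w) :=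
  Function.iterate_succ_apply' _ _ _

/-- The gradient of `f ∘ gdIter f α N`. -/
def exactMetaGrad (f : Param d → ℝ) (α : ℝ) (N : ℕ) (w : Param d) : Param d :=
  (List.ofFn fun j : Fin N =>
      (1 : Param d →L[ℝ] Param d) - α • hessian f (gdIter f α j w)).prod
    (gradient f (gdIter f α N w))

theorem exactMetaGrad_zero (f : Param d → ℝ) (α : ℝ) (w : Param d) :
    exactMetaGrad f α 0 w = gradient f w := by
  simp [exactMetaGrad, gdIter_zero]

/-- The leftmost factor belongs to the first gradient step. Peeling it off leaves the meta gradient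
with one step fewer at the moved point, which drives the inductions on `N`. -/
theorem exactMetaGrad_succ (f : Param d → ℝ) (α : ℝ) (N : ℕ) (w : Param d) :
    exactMetaGrad f α (N + 1) w =
      ((1 : Param d →L[ℝ] Param d) - α • hessian f w)
        (exactMetaGrad f α N (w - α • gradient f w)) := by
  simp only [exactMetaGrad, List.ofFn_succ, List.prod_cons, mul_apply_eq_comp,
    Fin.val_succ, gdIter_succ, Fin.val_zero, gdIter_zero]

variable {f : Param d → ℝ} {L ρ α : ℝ}

/-- Chain rule through the first step; the gradient is the adjoint derivative of that step applied
to the remaining gradient, and the derivative is self-adjoint. -/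
theorem SmoothLoss.hasGradientAt_comp_gdIter (hf : SmoothLoss f L ρ) (α : ℝ) (N : ℕ)
    (w : Param d) :
    HasGradientAt (fun u => f (gdIter f α N u)) (exactMetaGrad f α N w) w := by
  induction N generalizing w with
  | zero =>
    rw [exactMetaGrad_zero]
    exact (hf.differentiable w).hasGradientAt
  | succ N ih =>
    rw [exactMetaGrad_succ, hasGradientAt_iff_hasFDerivAt]
    have h1 : HasFDerivAt (fun u => u - α • gradient f u)
        ((1 : Param d →L[ℝ] Param d) - α • hessian f w) w :=
      (hasFDerivAt_id w).sub ((hf.differentiable_grad w).hasFDerivAt.const_smul α)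
    have h2 := (ih (w - α • gradient f w)).hasFDerivAt.comp w h1
    refine h2.congr_fderiv ?_
    ext v
    simp only [ContinuousLinearMap.comp_apply, InnerProductSpace.toDual_apply_apply,
      sub_apply, smul_apply, inner_sub_left,
      inner_sub_right, inner_smul_left, inner_smul_right, one_apply_eq_self,
      inner_hessian_comm hf.differentiable hf.differentiable_grad]
    simp

theorem SmoothLoss.norm_hessian_le (hf : SmoothLoss f L ρ) (hL : 0 ≤ L) (w : Param d) :
    ‖hessian f w‖ ≤ L := by
  have : LipschitzWith ⟨L, hL⟩ fun w => gradient f w :=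
    LipschitzWith.of_dist_le_mul fun x y => by
      rw [dist_eq_norm, dist_eq_norm]
      exact hf.lipschitz_grad x y
  exact norm_fderiv_le_of_lipschitz ℝ this

theorem SmoothLoss.norm_one_sub_hessian_le (hf : SmoothLoss f L ρ) (hL : 0 ≤ L) (hα : 0 ≤ α)
    (w : Param d) : ‖(1 : Param d →L[ℝ] Param d) - α • hessian f w‖ ≤ 1 + α * L := by
  refine (norm_sub_le _ _).trans (add_le_add ?_ ?_)
  · exact ContinuousLinearMap.norm_id_le
  · rw [norm_smul, Real.norm_eq_abs, abs_of_nonneg hα]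
    exact mul_le_mul_of_nonneg_left (hf.norm_hessian_le hL w) hα

theorem SmoothLoss.norm_gradStep_sub_le (hf : SmoothLoss f L ρ) (hα : 0 ≤ α) (w u : Param d) :
    ‖(w - α • gradient f w) - (u - α • gradient f u)‖ ≤ (1 + α * L) * ‖w - u‖ := by
  have h1 : (w - α • gradient f w) - (u - α • gradient f u)
      = (w - u) - α • (gradient f w - gradient f u) := by
    rw [smul_sub]; abel
  rw [h1]
  refine (norm_sub_le _ _).trans ?_
  rw [norm_smul, Real.norm_eq_abs, abs_of_nonneg hα]
  nlinarith [mul_le_mul_of_nonneg_left (hf.lipschitz_grad w u) hα]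

theorem SmoothLoss.norm_gdIter_sub_le (hf : SmoothLoss f L ρ) (hL : 0 ≤ L) (hα : 0 ≤ α) (j : ℕ)
    (w u : Param d) :
    ‖gdIter f α j w - gdIter f α j u‖ ≤ (1 + α * L) ^ j * ‖w - u‖ := by
  induction j generalizing w u with
  | zero => simp [gdIter_zero]
  | succ j ih =>
    rw [gdIter_succ, gdIter_succ, pow_succ, mul_assoc]
    exact (ih _ _).trans (by gcongr; exact hf.norm_gradStep_sub_le hα w u)

theorem SmoothLoss.norm_gradient_gdIter_le (hf : SmoothLoss f L ρ) (hL : 0 ≤ L) (hα : 0 ≤ α)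
    (j : ℕ) (w : Param d) :
    ‖gradient f (gdIter f α j w)‖ ≤ (1 + α * L) ^ j * ‖gradient f w‖ := by
  induction j with
  | zero => simp [gdIter_zero]
  | succ j ih =>
    rw [gdIter_succ']
    set u := gdIter f α j w
    have h1 := norm_sub_norm_le (gradient f (u - α • gradient f u)) (gradient f u)
    have h2 := hf.lipschitz_grad (u - α • gradient f u) u
    rw [sub_sub_cancel_left, norm_neg, norm_smul, Real.norm_eq_abs, abs_of_nonneg hα] at h2
    calc ‖gradient f (u - α • gradient f u)‖ ≤ (1 + α * L) * ‖gradient f u‖ := by nlinarith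
      _ ≤ (1 + α * L) * ((1 + α * L) ^ j * ‖gradient f w‖) := by gcongr
      _ = _ := by ring

/-- The steps have lengths at most α(1+αL)^j‖∇f(w)‖, and αL times the geometric sum is (1+αL)^j − 1.
The factor `L` on the left avoids a division. -/
theorem SmoothLoss.norm_gdIter_sub_self_le (hf : SmoothLoss f L ρ) (hL : 0 ≤ L) (hα : 0 ≤ α)
    (j : ℕ) (w : Param d) :
    L * ‖gdIter f α j w - w‖ ≤ ((1 + α * L) ^ j - 1) * ‖gradient f w‖ := by
  induction j with
  | zero => simp [gdIter_zero]
  | succ j ih =>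
    rw [gdIter_succ']
    have h1 := hf.norm_gradient_gdIter_le hL hα j w
    set u := gdIter f α j w
    have h2 : ‖u - α • gradient f u - w‖ ≤ ‖u - w‖ + α * ‖gradient f u‖ := by
      have h3 : u - α • gradient f u - w = (u - w) - α • gradient f u := by abel
      rw [h3]
      refine (norm_sub_le _ _).trans ?_
      rw [norm_smul, Real.norm_eq_abs, abs_of_nonneg hα]
    have h4 := mul_le_mul_of_nonneg_left h2 hL
    have h5 := mul_le_mul_of_nonneg_left h1 (mul_nonneg hα hL)
    rw [pow_succ]
    nlinarith

/-- The gradient of the meta objective of a task is close to the gradient of the task loss. -/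
theorem SmoothLoss.norm_exactMetaGrad_sub_gradient_le (hf : SmoothLoss f L ρ) (hL : 0 ≤ L)
    (hα : 0 ≤ α) (N : ℕ) (w : Param d) :
    ‖exactMetaGrad f α N w - gradient f w‖ ≤ ((1 + α * L) ^ (2 * N) - 1) * ‖gradient f w‖ := by
  induction N generalizing w with
  | zero => simp [exactMetaGrad_zero]
  | succ N ih =>
    rw [exactMetaGrad_succ]
    set u := w - α • gradient f w with hu
    have hug : ‖gradient f u‖ ≤ (1 + α * L) * ‖gradient f w‖ := by
      simpa [gdIter] using hf.norm_gradient_gdIter_le hL hα 1 w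
    have h1 : ((1 : Param d →L[ℝ] Param d) - α • hessian f w) (exactMetaGrad f α N u) - gradient f w
        = ((1 : Param d →L[ℝ] Param d) - α • hessian f w) (exactMetaGrad f α N u - gradient f w)
          - α • hessian f w (gradient f w) := by
      simp only [sub_apply, smul_apply, one_apply_eq_self, map_sub]
      abel
    have h2 : ‖gradient f u - gradient f w‖ ≤ α * L * ‖gradient f w‖ := by
      have := hf.lipschitz_grad u w
      rw [hu, sub_sub_cancel_left, norm_neg, norm_smul, Real.norm_eq_abs, abs_of_nonneg hα] at this
      rw [hu]
      linarith
    have h3 : ‖exactMetaGrad f α N u - gradient f w‖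
        ≤ ((1 + α * L) ^ (2 * N) - 1) * ‖gradient f u‖ + α * L * ‖gradient f w‖ := by
      rw [← sub_add_sub_cancel _ (gradient f u)]
      exact (norm_add_le _ _).trans (add_le_add (ih u) h2)
    have h4 : ‖α • hessian f w (gradient f w)‖ ≤ α * L * ‖gradient f w‖ := by
      rw [norm_smul, Real.norm_eq_abs, abs_of_nonneg hα, mul_assoc]
      exact mul_le_mul_of_nonneg_left
        ((hessian f w).le_of_opNorm_le (hf.norm_hessian_le hL w) _) hα
    have ha : 0 ≤ α * L := mul_nonneg hα hL
    have hq : 0 ≤ (1 + α * L) ^ (2 * N) - 1 := sub_nonneg.2 (one_le_pow₀ (by linarith))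
    rw [h1]
    calc _ ≤ (1 + α * L) * (((1 + α * L) ^ (2 * N) - 1) * ((1 + α * L) * ‖gradient f w‖)
            + α * L * ‖gradient f w‖) + α * L * ‖gradient f w‖ := by
          refine (norm_sub_le _ _).trans (add_le_add ?_ h4)
          refine ((ContinuousLinearMap.le_opNorm _ _).trans
            (mul_le_mul (hf.norm_one_sub_hessian_le hL hα w) (h3.trans ?_) (norm_nonneg _)
              (by linarith)))
          gcongr
      -- With a = 1+αL the identity is a((a^{2N} − 1)a + (a − 1)) + (a − 1) = a^{2N+2} − 1.
      _ = _ := by rw [show 2 * (N + 1) = 2 * N + 2 by ring, pow_add]; ring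

theorem norm_list_prod_apply_le {a : ℝ} (ha : 0 ≤ a) {n : ℕ}
    (A : Fin n → Param d →L[ℝ] Param d) (hA : ∀ j, ‖A j‖ ≤ a) (v : Param d) :
    ‖(List.ofFn A).prod v‖ ≤ a ^ n * ‖v‖ := by
  induction n with
  | zero => simp
  | succ n ih =>
    rw [List.ofFn_succ, List.prod_cons, mul_apply_eq_comp, pow_succ', mul_assoc]
    exact ((A 0).le_opNorm _).trans
      (mul_le_mul (hA 0) (ih _ fun j => hA _) (norm_nonneg _) ha)

/-- Telescoping: the factors are exchanged one at a time, through A₀u − A₀'u' = A₀(u − u') + (A₀ −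
A₀')u'. -/
theorem norm_list_prod_sub_apply_le {a : ℝ} (ha : 0 ≤ a) {n : ℕ}
    (A A' : Fin n → Param d →L[ℝ] Param d) (hA : ∀ j, ‖A j‖ ≤ a) (hA' : ∀ j, ‖A' j‖ ≤ a)
    (v v' : Param d) :
    ‖(List.ofFn A).prod v - (List.ofFn A').prod v'‖
      ≤ a ^ n * ‖v - v'‖ + a ^ (n - 1) * (∑ j, ‖A j - A' j‖) * ‖v'‖ := by
  induction n with
  | zero => simp
  | succ n ih =>
    rw [List.ofFn_succ, List.prod_cons, mul_apply_eq_comp, List.ofFn_succ,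
      List.prod_cons, mul_apply_eq_comp, Fin.sum_univ_succ]
    have h1 := ih (fun j => A j.succ) (fun j => A' j.succ) (fun j => hA _) fun j => hA' _
    have h2 := norm_list_prod_apply_le ha (fun j => A' j.succ) (fun j => hA' _) v'
    set u := (List.ofFn fun j => A j.succ).prod v
    set u' := (List.ofFn fun j => A' j.succ).prod v'
    have h3 : A 0 u - A' 0 u' = A 0 (u - u') + (A 0 - A' 0) u' := by
      simp only [map_sub, sub_apply]; abel
    rw [h3, Nat.add_sub_cancel]
    have h4 : ‖A 0 (u - u')‖ ≤ a * (a ^ n * ‖v - v'‖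
        + a ^ (n - 1) * (∑ j : Fin n, ‖A j.succ - A' j.succ‖) * ‖v'‖) :=
      ((A 0).le_opNorm _).trans (mul_le_mul (hA 0) h1 (norm_nonneg _) ha)
    have h5 : ‖(A 0 - A' 0) u'‖ ≤ ‖A 0 - A' 0‖ * (a ^ n * ‖v'‖) :=
      (ContinuousLinearMap.le_opNorm _ _).trans (mul_le_mul_of_nonneg_left h2 (norm_nonneg _))
    -- For n = 0 the truncated exponent `n - 1` is harmless, because the sum is empty.
    have h6 : a * (a ^ (n - 1) * (∑ j : Fin n, ‖A j.succ - A' j.succ‖) * ‖v'‖)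
        = a ^ n * (∑ j : Fin n, ‖A j.succ - A' j.succ‖) * ‖v'‖ := by
      rcases n with _ | n
      · simp
      · simp only [Nat.add_sub_cancel]; ring
    refine (norm_add_le _ _).trans ((add_le_add h4 h5).trans (le_of_eq ?_))
    rw [mul_add, h6]
    ring

theorem SmoothLoss.norm_one_sub_hessian_sub_le (hf : SmoothLoss f L ρ) (hα : 0 ≤ α)
    (w u : Param d) :
    ‖((1 : Param d →L[ℝ] Param d) - α • hessian f w) - (1 - α • hessian f u)‖
      ≤ α * ρ * ‖w - u‖ := by
  rw [sub_sub_sub_cancel_left, show α • hessian f u - α • hessian f w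
    = α • (hessian f u - hessian f w) from (smul_sub _ _ _).symm, norm_smul, Real.norm_eq_abs, abs_of_nonneg hα,
    norm_sub_rev, mul_assoc]
  exact mul_le_mul_of_nonneg_left (hf.lipschitz_hessian w u) hα

theorem SmoothLoss.norm_exactMetaGrad_le (hf : SmoothLoss f L ρ) (hL : 0 ≤ L) (hα : 0 ≤ α)
    (N : ℕ) (w : Param d) :
    ‖exactMetaGrad f α N w‖ ≤ (1 + α * L) ^ (2 * N) * ‖gradient f w‖ := by
  have ha : 0 ≤ 1 + α * L := by positivity
  refine (norm_list_prod_apply_le ha _ (fun j => hf.norm_one_sub_hessian_le hL hα _) _).trans ?_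
  rw [two_mul, pow_add, mul_assoc]
  gcongr
  exact hf.norm_gradient_gdIter_le hL hα N w

/-- A product with factors `I - α ∇²f(w_j)` and last vector `∇f(w_N)` compared with the exact
meta gradient at `u`. -/
theorem SmoothLoss.norm_prod_sub_exactMetaGrad_le (hf : SmoothLoss f L ρ) (hL : 0 ≤ L)
    (hα : 0 ≤ α) {N : ℕ} (W : Fin (N + 1) → Param d) (u : Param d) :
    ‖(List.ofFn fun j : Fin N =>
        (1 : Param d →L[ℝ] Param d) - α • hessian f (W j.castSucc)).prod
          (gradient f (W (Fin.last N))) - exactMetaGrad f α N u‖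
      ≤ (1 + α * L) ^ N * (L * ‖W (Fin.last N) - gdIter f α N u‖)
        + (1 + α * L) ^ (N - 1) * (∑ j : Fin N, α * ρ * ‖W j.castSucc - gdIter f α j u‖)
          * ((1 + α * L) ^ N * ‖gradient f u‖) := by
  have ha : 0 ≤ 1 + α * L := by positivity
  refine (norm_list_prod_sub_apply_le ha _ _ (fun j => hf.norm_one_sub_hessian_le hL hα _)
    (fun j => hf.norm_one_sub_hessian_le hL hα _) _ _).trans ?_
  have h1 : ∑ j : Fin N, ‖((1 : Param d →L[ℝ] Param d) - α • hessian f (W j.castSucc))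
        - (1 - α • hessian f (gdIter f α j u))‖
      ≤ ∑ j : Fin N, α * ρ * ‖W j.castSucc - gdIter f α j u‖ :=
    Finset.sum_le_sum fun j _ => hf.norm_one_sub_hessian_sub_le hα _ _
  have h0 : 0 ≤ ∑ j : Fin N, ‖((1 : Param d →L[ℝ] Param d) - α • hessian f (W j.castSucc))
        - (1 - α • hessian f (gdIter f α j u))‖ := Finset.sum_nonneg fun j _ => norm_nonneg _
  refine add_le_add ?_ (mul_le_mul ?_ (hf.norm_gradient_gdIter_le hL hα N u) (norm_nonneg _) ?_)
  · gcongr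
    exact hf.lipschitz_grad _ _
  · gcongr
  · exact mul_nonneg (pow_nonneg ha _) (h0.trans h1)

theorem sum_fin_pow_mul (a : ℝ) (N : ℕ) :
    (a - 1) * ∑ j : Fin N, a ^ (j : ℕ) = a ^ N - 1 := by
  rw [Fin.sum_univ_eq_sum_range (fun j => a ^ j), mul_comm, geom_sum_mul]

/-- The sum defining C_𝓛 factors because αL = (1+αL) − 1. The product form shows its sign and is the
form in which the constant arises from the perturbation bound. -/
theorem CL_eq {α L : ℝ} (hL : L ≠ 0) (ρ : ℝ) {N : ℕ} (hN : 1 ≤ N) :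
    CL α L ρ N = ρ / L * (1 + α * L) ^ (N - 1) * ((1 + α * L) ^ N - 1) * (1 + α * L) ^ N := by
  obtain ⟨n, rfl⟩ := Nat.exists_eq_add_of_le' hN
  simp only [CL, Nat.add_sub_cancel]
  field_simp
  ring

/-- Lipschitz continuity of the meta gradient of a task, with the constant at one endpoint. -/
theorem SmoothLoss.norm_exactMetaGrad_sub_le (hf : SmoothLoss f L ρ) (hL : 0 < L) (hρ : 0 ≤ ρ)
    (hα : 0 ≤ α) {N : ℕ} (hN : 1 ≤ N) (u w : Param d) :
    ‖exactMetaGrad f α N u - exactMetaGrad f α N w‖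
      ≤ ((1 + α * L) ^ (2 * N) * L + CL α L ρ N * ‖gradient f w‖) * ‖u - w‖ := by
  have ha : 0 ≤ 1 + α * L := by positivity
  refine (hf.norm_prod_sub_exactMetaGrad_le hL.le hα (fun j => gdIter f α j u) w).trans ?_
  -- The Hessian differences grow like (1+αL)^j‖u − w‖; the geometric series trades α for 1/L.
  have h1 : ∑ j : Fin N, α * ρ * ‖gdIter f α j u - gdIter f α j w‖
      ≤ ρ / L * ((1 + α * L) ^ N - 1) * ‖u - w‖ := by
    calc _ ≤ ∑ j : Fin N, α * ρ * ((1 + α * L) ^ (j : ℕ) * ‖u - w‖) :=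
          Finset.sum_le_sum fun j _ => by
            gcongr
            exact hf.norm_gdIter_sub_le hL.le hα _ _ _
      _ = ρ / L * ((1 + α * L - 1) * ∑ j : Fin N, (1 + α * L) ^ (j : ℕ)) * ‖u - w‖ := by
          rw [← Finset.mul_sum, ← Finset.sum_mul]
          field_simp
          ring
      _ = _ := by rw [sum_fin_pow_mul]
  have h2 := hf.norm_gdIter_sub_le hL.le hα N u w
  rw [CL_eq hL.ne' ρ hN]
  calc _ ≤ (1 + α * L) ^ N * (L * ((1 + α * L) ^ N * ‖u - w‖))
        + (1 + α * L) ^ (N - 1) * (ρ / L * ((1 + α * L) ^ N - 1) * ‖u - w‖)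
          * ((1 + α * L) ^ N * ‖gradient f w‖) := by
        simp only [Fin.val_castSucc, Fin.val_last]
        gcongr
    _ = _ := by rw [two_mul, pow_add]; ring

end Deterministic

/-! ### Conditioning in product spaces by resampling coordinates. -/

section Resampling

variable {ι : Type*} {X : ι → Type*}

open scoped Classical in
/-- Replace the coordinates of `x` in `T` by those of `y`. -/
def merge (T : Set ι) (y x : ∀ i, X i) : ∀ i, X i := fun i => if i ∈ T then y i else x i

theorem merge_of_mem {T : Set ι} (y x : ∀ i, X i) {i : ι} (h : i ∈ T) : merge T y x i = y i :=
  if_pos h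

theorem merge_of_notMem {T : Set ι} (y x : ∀ i, X i) {i : ι} (h : i ∉ T) : merge T y x i = x i :=
  if_neg h

variable [∀ i, MeasurableSpace (X i)]

theorem measurable_merge (T : Set ι) :
    Measurable fun p : (∀ i, X i) × (∀ i, X i) => merge T p.2 p.1 := by
  refine measurable_pi_iff.2 fun i => ?_
  by_cases h : i ∈ T
  · simp only [merge_of_mem _ _ h]
    fun_prop
  · simp only [merge_of_notMem _ _ h]
    fun_prop

variable [Fintype ι]

/-- Under a product measure, replacing some coordinates by an independent copy does not change the
law. It suffices to check boxes, whose preimages are products of two boxes. This takes the place of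
conditional expectations. -/
theorem measurePreserving_merge (T : Set ι) (ν : ∀ i, Measure (X i))
    [∀ i, IsProbabilityMeasure (ν i)] :
    MeasurePreserving (fun p : (∀ i, X i) × (∀ i, X i) => merge T p.2 p.1)
      ((Measure.pi ν).prod (Measure.pi ν)) (Measure.pi ν) := by
  classical
  refine ⟨measurable_merge T, (Measure.pi_eq fun s hs => ?_).symm⟩
  rw [Measure.map_apply (measurable_merge T) (MeasurableSet.univ_pi hs)]
  have h : (fun p : (∀ i, X i) × (∀ i, X i) => merge T p.2 p.1) ⁻¹' (Set.univ.pi s)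
      = (Set.univ.pi fun i => if i ∈ T then Set.univ else s i) ×ˢ
        (Set.univ.pi fun i => if i ∈ T then s i else Set.univ) := by
    ext p
    simp only [Set.mem_preimage, Set.mem_univ_pi, Set.mem_prod, merge, ← forall_and]
    refine forall_congr' fun i => ?_
    by_cases hi : i ∈ T <;> simp [hi]
  rw [h, Measure.prod_prod, Measure.pi_pi, Measure.pi_pi, ← Finset.prod_mul_distrib]
  refine Finset.prod_congr rfl fun i _ => ?_
  by_cases hi : i ∈ T <;> simp [hi]

/-- Integrating over fresh values of the coordinates in `T` first. -/
theorem integrable_and_integral_le_of_merge (T : Set ι) (ν : ∀ i, Measure (X i))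
    [∀ i, IsProbabilityMeasure (ν i)] {F G : (∀ i, X i) → ℝ} (hF : Measurable F)
    (hF0 : ∀ x, 0 ≤ F x) (hG : Integrable G (Measure.pi ν))
    (h : ∀ x, Integrable (fun y => F (merge T y x)) (Measure.pi ν) ∧
      ∫ y, F (merge T y x) ∂(Measure.pi ν) ≤ G x) :
    Integrable F (Measure.pi ν) ∧ ∫ x, F x ∂(Measure.pi ν) ≤ ∫ x, G x ∂(Measure.pi ν) := by
  have hmp := measurePreserving_merge T ν
  have hsm : StronglyMeasurable fun p : (∀ i, X i) × (∀ i, X i) => F (merge T p.2 p.1) :=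
    (hF.comp (measurable_merge T)).stronglyMeasurable
  have hint : Integrable (fun p : (∀ i, X i) × (∀ i, X i) => F (merge T p.2 p.1))
      ((Measure.pi ν).prod (Measure.pi ν)) := by
    -- Tonelli: `F` is nonnegative, so the bound of the inner integrals by the integrable `G`
    -- already yields joint integrability.
    rw [integrable_prod_iff hsm.aestronglyMeasurable]
    refine ⟨Filter.Eventually.of_forall fun x => (h x).1, ?_⟩
    refine hG.mono' hsm.norm.integral_prod_right'.aestronglyMeasurable
      (Filter.Eventually.of_forall fun x => ?_)
    simp only [Real.norm_of_nonneg (hF0 _)]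
    rw [Real.norm_of_nonneg (integral_nonneg fun y => hF0 _)]
    exact (h x).2
  refine ⟨(hmp.integrable_comp hF.aestronglyMeasurable).1 hint, ?_⟩
  rw [← hmp.map_eq, integral_map hmp.measurable.aemeasurable hF.aestronglyMeasurable,
    integral_prod _ hint, hmp.map_eq]
  exact integral_mono hint.integral_prod_left hG fun x => (h x).2

/-- The counterpart for vector-valued functions and exact conditional means. Without a sign,
integrability cannot be deduced and has to be supplied. -/
theorem integral_eq_of_merge {E : Type*} [NormedAddCommGroup E] [NormedSpace ℝ E] (T : Set ι)
    (ν : ∀ i, Measure (X i)) [∀ i, IsProbabilityMeasure (ν i)] {F G : (∀ i, X i) → E}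
    (hF : Integrable F (Measure.pi ν))
    (h : ∀ x, ∫ y, F (merge T y x) ∂(Measure.pi ν) = G x) :
    ∫ x, F x ∂(Measure.pi ν) = ∫ x, G x ∂(Measure.pi ν) := by
  have hmp := measurePreserving_merge T ν
  have hint : Integrable (fun p : (∀ i, X i) × (∀ i, X i) => F (merge T p.2 p.1))
      ((Measure.pi ν).prod (Measure.pi ν)) := hmp.integrable_comp_of_integrable hF
  have hF' : AEStronglyMeasurable F (Measure.map
      (fun p : (∀ i, X i) × (∀ i, X i) => merge T p.2 p.1)
      ((Measure.pi ν).prod (Measure.pi ν))) := by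
    rw [hmp.map_eq]; exact hF.aestronglyMeasurable
  conv_lhs => rw [← hmp.map_eq]
  rw [integral_map hmp.measurable.aemeasurable hF', integral_prod _ hint]
  exact integral_congr_ae (Filter.Eventually.of_forall h)

end Resampling

/-! ### Second moments and sums of independent vectors. -/

section Moments

variable {Ω : Type*} [MeasurableSpace Ω] {μ : Measure Ω}
  {E : Type*} [NormedAddCommGroup E]

theorem MemLp.integrable_norm_sq {f : Ω → E} (hf : MemLp f 2 μ) :
    Integrable (fun ω => ‖f ω‖ ^ 2) μ := by
  have := hf.integrable_norm_pow (p := 2) (by norm_num)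
  simpa using this

theorem memLp_two_of_integrable_sq {f : Ω → E} (hf : AEStronglyMeasurable f μ)
    (h : Integrable (fun ω => ‖f ω‖ ^ 2) μ) : MemLp f 2 μ :=
  (memLp_two_iff_integrable_sq_norm hf).2 h

/-- The variance assumptions are bounds on lower Lebesgue integrals, so they include finiteness;
this turns them into square integrability and bounds on Bochner integrals. -/
theorem memLp_two_of_lintegral_le {f : Ω → E} (hf : AEStronglyMeasurable f μ) {v : ℝ} (hv : 0 ≤ v)
    (h : ∫⁻ ω, ‖f ω‖ₑ ^ 2 ∂μ ≤ ENNReal.ofReal v) :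
    MemLp f 2 μ ∧ ∫ ω, ‖f ω‖ ^ 2 ∂μ ≤ v := by
  have he : ∀ ω, ‖f ω‖ₑ ^ 2 = ENNReal.ofReal (‖f ω‖ ^ 2) := fun ω => by
    rw [← ofReal_norm, ENNReal.ofReal_pow (norm_nonneg _)]
  simp only [he] at h
  have hint : Integrable (fun ω => ‖f ω‖ ^ 2) μ := by
    refine ⟨(hf.norm.pow 2), ?_⟩
    rw [hasFiniteIntegral_iff_ofReal (Filter.Eventually.of_forall fun ω => by positivity)]
    exact h.trans_lt ENNReal.ofReal_lt_top
  refine ⟨memLp_two_of_integrable_sq hf hint, ?_⟩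
  rw [← ofReal_integral_eq_lintegral_ofReal hint
    (Filter.Eventually.of_forall fun ω => by positivity)] at h
  exact (ENNReal.ofReal_le_ofReal_iff hv).1 h

/-- Nonnegativity of the variance. -/
theorem integral_le_sqrt_of_sq [IsProbabilityMeasure μ] {f : Ω → ℝ} (hf : MemLp f 2 μ) {v : ℝ}
    (h : ∫ ω, f ω ^ 2 ∂μ ≤ v) : ∫ ω, f ω ∂μ ≤ √v := by
  have h1 := variance_nonneg f μ
  rw [variance_eq_sub hf] at h1
  refine Real.le_sqrt_of_sq_le ?_
  simp only [Pi.pow_apply] at h1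
  linarith

variable [InnerProductSpace ℝ E] [CompleteSpace E]

theorem integral_norm_sq_eq_add [IsProbabilityMeasure μ] {Y : Ω → E} (hY : MemLp Y 2 μ) :
    ∫ ω, ‖Y ω‖ ^ 2 ∂μ = ‖∫ ω, Y ω ∂μ‖ ^ 2 + ∫ ω, ‖Y ω - ∫ ω', Y ω' ∂μ‖ ^ 2 ∂μ := by
  set m := ∫ ω, Y ω ∂μ with hm
  have hi : Integrable Y μ := hY.integrable (by norm_num)
  have h1 : Integrable (fun ω => ‖Y ω - m‖ ^ 2) μ :=
    MemLp.integrable_norm_sq (hY.sub (memLp_const m))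
  have h2 : Integrable (fun ω => 2 * inner ℝ m (Y ω)) μ := (hi.const_inner m).const_mul 2
  have h3 : ∀ ω, ‖Y ω‖ ^ 2 = 2 * inner ℝ m (Y ω) + ‖Y ω - m‖ ^ 2 - ‖m‖ ^ 2 := fun ω => by
    rw [norm_sub_sq_real, real_inner_comm]; ring
  simp only [h3]
  have h4 : Integrable (fun ω => 2 * inner ℝ m (Y ω) + ‖Y ω - m‖ ^ 2) μ := h2.add h1
  rw [integral_sub h4 (integrable_const _), integral_add h2 h1, integral_const_mul,
    integral_inner hi, ← hm, real_inner_self_eq_norm_sq]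
  simp
  ring

variable [MeasurableSpace E] [BorelSpace E]

/-- After expanding the square, the cross terms vanish because the summands are centred and pairwise
independent. -/
theorem integral_norm_sum_sq_le [IsProbabilityMeasure μ] {n : ℕ} {Y : Fin n → Ω → E}
    (hY : ∀ a, MemLp (Y a) 2 μ) (hind : ∀ a b, a ≠ b → IndepFun (Y a) (Y b) μ)
    (hmean : ∀ a, ∫ ω, Y a ω ∂μ = 0) {v : ℝ} (hv : ∀ a, ∫ ω, ‖Y a ω‖ ^ 2 ∂μ ≤ v) :
    ∫ ω, ‖∑ a, Y a ω‖ ^ 2 ∂μ ≤ n * v := by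
  have hi : ∀ a, Integrable (Y a) μ := fun a => (hY a).integrable (by norm_num)
  have hinner : ∀ a b, Integrable (fun ω => inner ℝ (Y a ω) (Y b ω)) μ := fun a b =>
    (L2.integrable_inner ((hY a).toLp _) ((hY b).toLp _)).congr <| by
      filter_upwards [(hY a).coeFn_toLp, (hY b).coeFn_toLp] with ω h1 h2
      rw [h1, h2]
  have hexp : ∀ ω, ‖∑ a, Y a ω‖ ^ 2 = ∑ a, ∑ b, inner ℝ (Y a ω) (Y b ω) := fun ω => by
    rw [← real_inner_self_eq_norm_sq, sum_inner]
    simp only [inner_sum]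
  simp only [hexp]
  rw [integral_finsetSum _ fun a _ => integrable_finsetSum _ fun b _ => hinner a b]
  have hone : ∀ a, ∫ ω, ∑ b, inner ℝ (Y a ω) (Y b ω) ∂μ ≤ v := by
    intro a
    rw [integral_finsetSum _ fun b _ => hinner a b, Finset.sum_eq_single a]
    · simpa only [real_inner_self_eq_norm_sq] using hv a
    · intro b _ hb
      have := (hind a b hb.symm).integral_bilin (hi a) (hi b) (innerSL ℝ)
      change ∫ ω, inner ℝ (Y a ω) (Y b ω) ∂μ = inner ℝ (∫ ω, Y a ω ∂μ) (∫ ω, Y b ω ∂μ) at this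
      rw [this, hmean, inner_zero_left]
    · simp
  calc _ ≤ ∑ _a : Fin n, v := Finset.sum_le_sum fun a _ => hone a
    _ = n * v := by simp

end Moments

/-! ### Averages over batches. -/

section Batch

variable {ι : Type*} [Fintype ι] {X : ι → Type*} [∀ i, MeasurableSpace (X i)]
  {E : Type*} [NormedAddCommGroup E] [InnerProductSpace ℝ E] [CompleteSpace E]
  [MeasurableSpace E] [BorelSpace E] [SecondCountableTopology E]

/-- Mean and variance of an average over independent coordinates. -/
theorem batch_mean (ν : ∀ i, Measure (X i)) [∀ i, IsProbabilityMeasure (ν i)] {n : ℕ} (hn : 1 ≤ n)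
    {e : Fin n → ι} (he : Function.Injective e) (f : ∀ a, X (e a) → E)
    (hf : ∀ a, Measurable (f a)) (hf2 : ∀ a, MemLp (f a) 2 (ν (e a))) {m : E}
    (hm : ∀ a, ∫ y, f a y ∂(ν (e a)) = m) {v : ℝ}
    (hv : ∀ a, ∫ y, ‖f a y - m‖ ^ 2 ∂(ν (e a)) ≤ v) :
    MemLp (fun x => (n : ℝ)⁻¹ • ∑ a, f a (x (e a))) 2 (Measure.pi ν) ∧
      ∫ x, (n : ℝ)⁻¹ • ∑ a, f a (x (e a)) ∂(Measure.pi ν) = m ∧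
      ∫ x, ‖(n : ℝ)⁻¹ • ∑ a, f a (x (e a)) - m‖ ^ 2 ∂(Measure.pi ν) ≤ v / n := by
  have hn0 : (n : ℝ) ≠ 0 := by exact_mod_cast (by lia : n ≠ 0)
  have hmp : ∀ a, MeasurePreserving (fun x : ∀ i, X i => x (e a)) (Measure.pi ν) (ν (e a)) :=
    fun a => measurePreserving_eval ν (e a)
  have hL2 : ∀ a, MemLp (fun x : ∀ i, X i => f a (x (e a))) 2 (Measure.pi ν) :=
    fun a => (hf2 a).comp_measurePreserving (hmp a)
  have hint : ∀ a, Integrable (fun x : ∀ i, X i => f a (x (e a))) (Measure.pi ν) :=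
    fun a => (hL2 a).integrable (by norm_num)
  have hmean : ∀ a, ∫ x : ∀ i, X i, f a (x (e a)) ∂(Measure.pi ν) = m := fun a => by
    rw [← hm a, ← (hmp a).map_eq, integral_map (hmp a).measurable.aemeasurable
      (hf a).aestronglyMeasurable]
  have hvar : ∀ a, ∫ x : ∀ i, X i, ‖f a (x (e a)) - m‖ ^ 2 ∂(Measure.pi ν) ≤ v := fun a => by
    refine le_trans (le_of_eq ?_) (hv a)
    rw [← (hmp a).map_eq, integral_map (hmp a).measurable.aemeasurable
      (((hf a).sub_const m).norm.pow_const 2).aestronglyMeasurable]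
  have hL2' : ∀ a, MemLp (fun x : ∀ i, X i => f a (x (e a)) - m) 2 (Measure.pi ν) :=
    fun a => (hL2 a).sub (memLp_const m)
  refine ⟨?_, ?_, ?_⟩
  · exact (memLp_finsetSum _ fun a _ => hL2 a).const_smul _
  · rw [integral_smul, integral_finsetSum _ fun a _ => hint a]
    simp only [hmean]
    simp [← Nat.cast_smul_eq_nsmul ℝ, smul_smul, hn0]
  -- Injectivity of `e` places the samples on distinct, hence independent, coordinates. The factors
  -- `X i` may differ, as is needed for tasks with data batches of unequal sizes.
  · have hind : iIndepFun (fun (i : ι) (x : ∀ i, X i) => x i) (Measure.pi ν) :=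
      iIndepFun_pi (X := fun i (x : X i) => x) fun i => aemeasurable_id
    have key := integral_norm_sum_sq_le (μ := Measure.pi ν)
      (Y := fun (a : Fin n) (x : ∀ i, X i) => f a (x (e a)) - m) hL2'
      (fun a b hab => by
        have := hind.indepFun (he.ne hab)
        exact this.comp (φ := fun y => f a y - m) (ψ := fun y => f b y - m)
          ((hf a).sub_const m) ((hf b).sub_const m))
      (fun a => by
        rw [integral_sub (hint a) (integrable_const _), hmean]; simp)
      hvar
    have heq : ∀ x : ∀ i, X i, ‖(n : ℝ)⁻¹ • ∑ a, f a (x (e a)) - m‖ ^ 2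
        = ((n : ℝ)⁻¹) ^ 2 * ‖∑ a, (f a (x (e a)) - m)‖ ^ 2 := fun x => by
      rw [← mul_pow, ← Real.norm_of_nonneg (show (0 : ℝ) ≤ (n : ℝ)⁻¹ by positivity), ← norm_smul,
        Real.norm_of_nonneg (show (0 : ℝ) ≤ (n : ℝ)⁻¹ by positivity), Finset.sum_sub_distrib]
      simp [smul_sub, ← Nat.cast_smul_eq_nsmul ℝ, smul_smul, hn0]
    simp only [heq]
    rw [integral_const_mul]
    calc _ ≤ ((n : ℝ)⁻¹) ^ 2 * (n * v) := by gcongr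
      _ = v / n := by field_simp

end Batch

/-! ### Joint measurability of gradients, Hessians, iterates and estimators. -/

section Measurability

variable {Y : Type*} [MeasurableSpace Y] {d : ℕ}

/-- A directional derivative is the limit of difference quotients with increments 1/(n+1), and these
are jointly measurable in parameter, point and direction. -/
theorem measurable_fderiv_apply_param {F : Type*} [NormedAddCommGroup F] [NormedSpace ℝ F]
    [MeasurableSpace F] [BorelSpace F] [SecondCountableTopology F] {G : Y → Param d → F}
    (hG : Measurable fun p : Y × Param d => G p.1 p.2) (hd : ∀ y, Differentiable ℝ (G y)) :
    Measurable fun p : Y × Param d × Param d => fderiv ℝ (G p.1) p.2.1 p.2.2 := by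
  refine measurable_of_tendsto_metrizable (f := fun (n : ℕ) (p : Y × Param d × Param d) =>
    ((n : ℝ) + 1) • (G p.1 (p.2.1 + ((n : ℝ) + 1)⁻¹ • p.2.2) - G p.1 p.2.1)) (fun n => ?_) ?_
  · have h1 : Measurable fun p : Y × Param d × Param d =>
        G p.1 (p.2.1 + ((n : ℝ) + 1)⁻¹ • p.2.2) :=
      hG.comp (f := fun p : Y × Param d × Param d => (p.1, p.2.1 + ((n : ℝ) + 1)⁻¹ • p.2.2))
        (by fun_prop)
    have h2 : Measurable fun p : Y × Param d × Param d => G p.1 p.2.1 :=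
      hG.comp (f := fun p : Y × Param d × Param d => (p.1, p.2.1)) (by fun_prop)
    exact (h1.sub h2).const_smul _
  · refine tendsto_pi_nhds.2 fun p => ?_
    refine ((hd p.1) p.2.1).hasFDerivAt.lim p.2.2 (c := fun n : ℕ => (n : ℝ) + 1) ?_
    refine Filter.tendsto_atTop_mono (fun n => ?_) tendsto_natCast_atTop_atTop
    exact (le_add_of_nonneg_right zero_le_one).trans (Real.le_norm_self _)

theorem measurable_gradient_param {G : Y → Param d → ℝ}
    (hG : Measurable fun p : Y × Param d => G p.1 p.2) (hd : ∀ y, Differentiable ℝ (G y)) :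
    Measurable fun p : Y × Param d => gradient (G p.1) p.2 := by
  let b := EuclideanSpace.basisFun (Fin d) ℝ
  have h : ∀ p : Y × Param d, gradient (G p.1) p.2 = ∑ k, (fderiv ℝ (G p.1) p.2 (b k)) • b k :=
    fun p => by
      rw [← b.sum_repr' (gradient (G p.1) p.2)]
      refine Finset.sum_congr rfl fun k _ => ?_
      rw [real_inner_comm, inner_gradient_left]
  simp only [h]
  refine Finset.measurable_sum _ fun k _ => Measurable.smul_const ?_ _
  exact (measurable_fderiv_apply_param hG hd).comp
    (f := fun p : Y × Param d => (p.1, p.2, b k)) (by fun_prop)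

/-- In finite dimension an operator is a finite sum of rank-one operators built from its values on
an orthonormal basis, and each summand depends continuously on its value. -/
theorem measurable_clm_of_apply {H : Y → Param d →L[ℝ] Param d}
    (h : ∀ v, Measurable fun y => H y v) : Measurable H := by
  let b := EuclideanSpace.basisFun (Fin d) ℝ
  have hH : ∀ y, H y = ∑ k, ContinuousLinearMap.smulRightL ℝ (Param d) (Param d)
      (innerSL ℝ (b k)) (H y (b k)) := fun y => by
    ext1 v
    conv_lhs => rw [← b.sum_repr' v, map_sum]
    rw [sum_apply]
    refine Finset.sum_congr rfl fun k _ => ?_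
    rw [map_smul]
    rfl
  have : H = fun y => ∑ k, ContinuousLinearMap.smulRightL ℝ (Param d) (Param d)
      (innerSL ℝ (b k)) (H y (b k)) := funext hH
  rw [this]
  exact Finset.measurable_sum _ fun k _ =>
    (ContinuousLinearMap.continuous _).measurable.comp (h (b k))

theorem measurable_list_prod_apply {n : ℕ} {A : Fin n → Y → Param d →L[ℝ] Param d}
    (hA : ∀ j (u : Y → Param d), Measurable u → Measurable fun y => A j y (u y))
    {v : Y → Param d} (hv : Measurable v) :
    Measurable fun y => (List.ofFn fun j => A j y).prod (v y) := by
  induction n with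
  | zero => simpa using hv
  | succ n ih =>
    simp only [List.ofFn_succ, List.prod_cons, mul_apply_eq_comp]
    exact hA 0 _ (ih fun j => hA j.succ)

variable {I 𝒟 : Type*} [MeasurableSpace I] [MeasurableSpace 𝒟] {P : TaskFamily d I 𝒟}
  {L ρ σ σg σH : ℝ}

theorem Assumptions.smoothLoss (hP : Assumptions P L ρ σ σg σH) (i : I) :
    SmoothLoss (taskLoss P i) L ρ :=
  ⟨hP.differentiable i, hP.differentiable_grad i, hP.lipschitz_grad i, hP.lipschitz_hessian i⟩

theorem Assumptions.measurable_sampleGrad (hP : Assumptions P L ρ σ σg σH) :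
    Measurable fun x : I × 𝒟 × Param d => gradient (P.loss x.1 x.2.1) x.2.2 :=
  (measurable_gradient_param (Y := I × 𝒟) (G := fun y => P.loss y.1 y.2)
    (hP.measurable_loss.comp (f := fun p : (I × 𝒟) × Param d => (p.1.1, p.1.2, p.2))
      (by fun_prop)) fun y => hP.differentiable_loss y.1 y.2).comp
    (f := fun x : I × 𝒟 × Param d => ((x.1, x.2.1), x.2.2)) (by fun_prop)

theorem Assumptions.measurable_sampleHess (hP : Assumptions P L ρ σ σg σH) :
    Measurable fun x : I × 𝒟 × Param d × Param d =>
      hessian (P.loss x.1 x.2.1) x.2.2.1 x.2.2.2 :=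
  (measurable_fderiv_apply_param (Y := I × 𝒟) (G := fun y w => gradient (P.loss y.1 y.2) w)
    (hP.measurable_sampleGrad.comp (f := fun p : (I × 𝒟) × Param d => (p.1.1, p.1.2, p.2))
      (by fun_prop)) fun y => hP.differentiable_grad_loss y.1 y.2).comp
    (f := fun x : I × 𝒟 × Param d × Param d => ((x.1, x.2.1), x.2.2)) (by fun_prop)

/-- The data law is a kernel in `i`; pulled back to pairs (i, w), it makes the task loss a
measurable parametric integral. -/
theorem Assumptions.measurable_taskLoss (hP : Assumptions P L ρ σ σg σH) :
    Measurable fun x : I × Param d => taskLoss P x.1 x.2 := by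
  have h : Measurable fun y : (I × Param d) × 𝒟 => P.loss y.1.1 y.2 y.1.2 :=
    hP.measurable_loss.comp (f := fun y : (I × Param d) × 𝒟 => (y.1.1, y.2, y.1.2)) (by fun_prop)
  have := h.stronglyMeasurable.integral_kernel_prod_right'
    (κ := P.dataLaw.comap Prod.fst measurable_fst)
  exact this.measurable

theorem Assumptions.measurable_taskGrad (hP : Assumptions P L ρ σ σg σH) :
    Measurable fun x : I × Param d => gradient (taskLoss P x.1) x.2 :=
  measurable_gradient_param hP.measurable_taskLoss hP.differentiable

theorem Assumptions.measurable_taskHess (hP : Assumptions P L ρ σ σg σH) :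
    Measurable fun x : I × Param d × Param d => hessian (taskLoss P x.1) x.2.1 x.2.2 :=
  measurable_fderiv_apply_param hP.measurable_taskGrad hP.differentiable_grad

theorem Assumptions.measurable_gdIter (hP : Assumptions P L ρ σ σg σH) (α : ℝ) (j : ℕ) :
    Measurable fun x : I × Param d => gdIter (taskLoss P x.1) α j x.2 := by
  induction j with
  | zero => exact measurable_snd
  | succ j ih =>
    simp only [gdIter_succ']
    exact ih.sub ((hP.measurable_taskGrad.comp (measurable_fst.prodMk ih)).const_smul α)

theorem Assumptions.measurable_exactMetaGrad (hP : Assumptions P L ρ σ σg σH) (α : ℝ) (N : ℕ) :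
    Measurable fun x : I × Param d => exactMetaGrad (taskLoss P x.1) α N x.2 := by
  refine measurable_list_prod_apply (fun j u hu => ?_)
    (hP.measurable_taskGrad.comp (measurable_fst.prodMk (hP.measurable_gdIter α N)))
  exact hu.sub ((hP.measurable_taskHess.comp
    (measurable_fst.prodMk ((hP.measurable_gdIter α j).prodMk hu))).const_smul α)

theorem Assumptions.measurable_batchGrad_comp (hP : Assumptions P L ρ σ σg σH) {n : ℕ}
    {i : Y → I} {x : Y → Fin n → 𝒟} {w : Y → Param d} (hi : Measurable i) (hx : Measurable x)
    (hw : Measurable w) : Measurable fun y => batchGrad P (i y) (x y) (w y) := by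
  have h : Measurable fun y => ∑ a, gradient (P.loss (i y) (x y a)) (w y) :=
    Finset.measurable_sum _ fun a _ => hP.measurable_sampleGrad.comp
      (hi.prodMk (((measurable_pi_apply a).comp hx).prodMk hw))
  exact h.const_smul (n : ℝ)⁻¹

theorem Assumptions.measurable_batchHess_comp (hP : Assumptions P L ρ σ σg σH) {n : ℕ}
    {i : Y → I} {x : Y → Fin n → 𝒟} {w v : Y → Param d} (hi : Measurable i) (hx : Measurable x)
    (hw : Measurable w) (hv : Measurable v) :
    Measurable fun y => batchHess P (i y) (x y) (w y) (v y) := by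
  simp only [batchHess, smul_apply, sum_apply]
  have h : Measurable fun y => ∑ a, hessian (P.loss (i y) (x y a)) (w y) (v y) :=
    Finset.measurable_sum _ fun a _ => hP.measurable_sampleHess.comp
      (hi.prodMk (((measurable_pi_apply a).comp hx).prodMk (hw.prodMk hv)))
  exact h.const_smul (n : ℝ)⁻¹

theorem innerSGD_zero (P : TaskFamily d I 𝒟) (α : ℝ) {N : ℕ} {z : BatchSizes} (i : I)
    (x : Slot N z → 𝒟) (w : Param d) : innerSGD P α i x w 0 = w := rfl

theorem innerSGD_succ (P : TaskFamily d I 𝒟) (α : ℝ) {N : ℕ} {z : BatchSizes} (i : I)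
    (x : Slot N z → 𝒟) (w : Param d) (j : Fin N) :
    innerSGD P α i x w j.succ = innerSGD P α i x w j.castSucc
      - α • batchGrad P i (fun s : Fin z.S => x (Sum.inl (j, s)))
        (innerSGD P α i x w j.castSucc) := rfl

variable {N : ℕ} {z : BatchSizes}

theorem Assumptions.measurable_innerSGD (hP : Assumptions P L ρ σ σg σH) (α : ℝ)
    (j : Fin (N + 1)) :
    Measurable fun y : (I × (Slot N z → 𝒟)) × Param d => innerSGD P α y.1.1 y.1.2 y.2 j := by
  induction j using Fin.induction with
  | zero => exact measurable_snd
  | succ j ih =>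
    simp only [innerSGD_succ]
    exact ih.sub ((hP.measurable_batchGrad_comp (by fun_prop) (by fun_prop) ih).const_smul α)

theorem Assumptions.measurable_metaGradEst (hP : Assumptions P L ρ σ σg σH) (α : ℝ) :
    Measurable fun y : (I × (Slot N z → 𝒟)) × Param d => metaGradEst P α y.1.1 y.1.2 y.2 := by
  refine measurable_list_prod_apply (fun j u hu => ?_)
    (hP.measurable_batchGrad_comp (by fun_prop) (by fun_prop) (hP.measurable_innerSGD α _))
  exact hu.sub ((hP.measurable_batchHess_comp (by fun_prop) (by fun_prop)
    (hP.measurable_innerSGD α _) hu).const_smul α)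

theorem Assumptions.measurable_smoothEst (hP : Assumptions P L ρ σ σg σH) (α : ℝ) (k : ℕ) :
    Measurable fun y : Seed I 𝒟 N z k × Param d => smoothEst P α L ρ y.1 y.2 := by
  refine (((Finset.measurable_sum _ fun b _ => ?_).const_mul _).div_const _).const_add _
  exact (hP.measurable_batchGrad_comp (by fun_prop) (by fun_prop) measurable_snd).norm

theorem Assumptions.measurable_metaStep (hP : Assumptions P L ρ σ σg σH) (α Cβ : ℝ) (k : ℕ) :
    Measurable fun y : Seed I 𝒟 N z k × Param d => metaStep P α L ρ Cβ y.1 y.2 := by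
  have h : Measurable fun y : Seed I 𝒟 N z k × Param d =>
      ∑ b, metaGradEst P α (y.1.1 b).1 (y.1.1 b).2 y.2 :=
    Finset.measurable_sum _ fun b _ => (hP.measurable_metaGradEst α).comp
      (f := fun y : Seed I 𝒟 N z k × Param d => (y.1.1 b, y.2)) (by fun_prop)
  exact measurable_snd.sub ((measurable_const.div
    ((hP.measurable_smoothEst α k).const_mul Cβ)).smul (h.const_smul (z.B : ℝ)⁻¹))

end Measurability

/-! ### The meta objective: differentiability, local smoothness, comparison of gradients. -/

section MetaObjective

variable {d : ℕ} {I 𝒟 : Type*} [MeasurableSpace I] [MeasurableSpace 𝒟]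

/-- Differentiation under the integral sign, with domination on the unit ball around `w`. The Riesz
isometry `J` transports gradients to derivatives and commutes with the integral. -/
theorem hasGradientAt_integral {μ : Measure I} {f : I → Param d → ℝ} {g : I → Param d → Param d}
    {w : Param d} (hfm : ∀ x, AEStronglyMeasurable (fun i => f i x) μ)
    (hfi : Integrable (fun i => f i w) μ) (hgm : AEStronglyMeasurable (fun i => g i w) μ)
    (hfg : ∀ i x, HasGradientAt (f i) (g i x) x) {b : I → ℝ} (hb : Integrable b μ)
    (hgb : ∀ i, ∀ x ∈ Metric.ball w 1, ‖g i x‖ ≤ b i) :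
    HasGradientAt (fun x => ∫ i, f i x ∂μ) (∫ i, g i w ∂μ) w := by
  let J : Param d →L[ℝ] StrongDual ℝ (Param d) :=
    (InnerProductSpace.toDual ℝ (Param d)).toContinuousLinearEquiv.toContinuousLinearMap
  have hgi : Integrable (fun i => g i w) μ :=
    hb.mono' hgm (Filter.Eventually.of_forall fun i => hgb i w (Metric.mem_ball_self one_pos))
  have h := hasFDerivAt_integral_of_dominated_of_fderiv_le (μ := μ) (F := fun x i => f i x)
    (F' := fun x i => J (g i x)) (bound := b) (Metric.ball_mem_nhds w one_pos)
    (Filter.Eventually.of_forall hfm) hfi (J.continuous.comp_aestronglyMeasurable hgm)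
    (Filter.Eventually.of_forall fun i x hx => by
      refine le_trans (le_of_eq ?_) (hgb i x hx)
      exact (InnerProductSpace.toDual ℝ (Param d)).norm_map _) hb
    (Filter.Eventually.of_forall fun i x _ => (hfg i x).hasFDerivAt)
  rw [J.integral_comp_comm hgi] at h
  exact h

variable {P : TaskFamily d I 𝒟} {L ρ σ σg σH α : ℝ}

namespace Assumptions

theorem measurable_taskGrad_left (hP : Assumptions P L ρ σ σg σH) (w : Param d) :
    Measurable fun i => gradient (taskLoss P i) w :=
  hP.measurable_taskGrad.comp measurable_prodMk_right

theorem measurable_taskGrad_right (hP : Assumptions P L ρ σ σg σH) (i : I) :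
    Measurable fun w => gradient (taskLoss P i) w :=
  hP.measurable_taskGrad.comp measurable_prodMk_left

theorem memLp_taskGrad_sub (hP : Assumptions P L ρ σ σg σH) (w : Param d) :
    MemLp (fun i => gradient (taskLoss P i) w - gradient (meanLoss P) w) 2 P.taskLaw ∧
      ∫ i, ‖gradient (taskLoss P i) w - gradient (meanLoss P) w‖ ^ 2 ∂P.taskLaw ≤ σ ^ 2 :=
  memLp_two_of_lintegral_le
    ((hP.measurable_taskGrad_left w).sub_const _).aestronglyMeasurable (sq_nonneg σ)
    (hP.variance_task w)

theorem memLp_taskGrad (hP : Assumptions P L ρ σ σg σH) (w : Param d) :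
    MemLp (fun i => gradient (taskLoss P i) w) 2 P.taskLaw := by
  have h := (hP.memLp_taskGrad_sub w).1.add (memLp_const (gradient (meanLoss P) w))
  have h' : (fun i => gradient (taskLoss P i) w) =
      (fun i => gradient (taskLoss P i) w - gradient (meanLoss P) w)
        + fun _ => gradient (meanLoss P) w := by
    ext1 i; simp
  rwa [h']

theorem integrable_taskGrad (hP : Assumptions P L ρ σ σg σH) (w : Param d) :
    Integrable (fun i => gradient (taskLoss P i) w) P.taskLaw :=
  (hP.memLp_taskGrad w).integrable (by norm_num)

theorem norm_taskGrad_le (hP : Assumptions P L ρ σ σg σH) (hL : 0 ≤ L) (w : Param d) (i : I)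
    {x : Param d} (hx : x ∈ Metric.ball w 1) :
    ‖gradient (taskLoss P i) x‖ ≤ ‖gradient (taskLoss P i) w‖ + L := by
  have h1 := hP.lipschitz_grad i x w
  rw [Metric.mem_ball, dist_eq_norm] at hx
  have h2 := norm_sub_norm_le (gradient (taskLoss P i) x) (gradient (taskLoss P i) w)
  nlinarith

theorem gradient_meanLoss (hP : Assumptions P L ρ σ σg σH) (hL : 0 ≤ L) (w : Param d) :
    gradient (meanLoss P) w = ∫ i, gradient (taskLoss P i) w ∂P.taskLaw := by
  refine HasGradientAt.gradient (hasGradientAt_integral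
    (b := fun i => ‖gradient (taskLoss P i) w‖ + L)
    (fun x => (hP.measurable_taskLoss.comp measurable_prodMk_right).aestronglyMeasurable)
    (hP.integrable_taskLoss w) (hP.measurable_taskGrad_left w).aestronglyMeasurable
    (fun i x => (hP.differentiable i x).hasGradientAt)
    ((hP.integrable_taskGrad w).norm.add (integrable_const _))
    fun i x hx => hP.norm_taskGrad_le hL w i hx)

/-- The inner steps move w by at most c‖∇l_i(w)‖, so they change the loss by at most a multiple of
‖∇l_i(w)‖², which is integrable because the task variance is finite. -/
theorem integrable_taskLoss_gdIter (hP : Assumptions P L ρ σ σg σH) (hL : 0 < L) (hα : 0 ≤ α)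
    (N : ℕ) (w : Param d) :
    Integrable (fun i => taskLoss P i (gdIter (taskLoss P i) α N w)) P.taskLaw := by
  have hm : Measurable fun i => taskLoss P i (gdIter (taskLoss P i) α N w) :=
    hP.measurable_taskLoss.comp (measurable_id.prodMk
      ((hP.measurable_gdIter α N).comp measurable_prodMk_right))
  set c := ((1 + α * L) ^ N - 1) / L with hc
  have hc0 : 0 ≤ c := div_nonneg (sub_nonneg.2 (one_le_pow₀ (by nlinarith))) hL.le
  have hb : Integrable (fun i => |taskLoss P i w|
      + (c + L * c ^ 2) * ‖gradient (taskLoss P i) w‖ ^ 2) P.taskLaw :=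
    (hP.integrable_taskLoss w).norm.add ((MemLp.integrable_norm_sq (hP.memLp_taskGrad w)).const_mul _)
  refine hb.mono' hm.aestronglyMeasurable (Filter.Eventually.of_forall fun i => ?_)
  have h1 := abs_sub_le_of_gradient_lipschitz (hP.differentiable i) hL.le (hP.lipschitz_grad i) w
    (gdIter (taskLoss P i) α N w)
  have h2 : ‖gdIter (taskLoss P i) α N w - w‖ ≤ c * ‖gradient (taskLoss P i) w‖ := by
    rw [hc, div_mul_eq_mul_div, le_div_iff₀ hL, mul_comm]
    exact (hP.smoothLoss i).norm_gdIter_sub_self_le hL.le hα N w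
  set g := ‖gradient (taskLoss P i) w‖
  have hg : 0 ≤ g := norm_nonneg _
  have h3 : ‖gdIter (taskLoss P i) α N w - w‖ ^ 2 ≤ (c * g) ^ 2 := by gcongr
  have h4 := abs_sub_abs_le_abs_sub (taskLoss P i (gdIter (taskLoss P i) α N w)) (taskLoss P i w)
  rw [Real.norm_eq_abs]
  nlinarith [mul_le_mul_of_nonneg_left h2 hg, mul_le_mul_of_nonneg_left h3 hL.le]

theorem memLp_exactMetaGrad (hP : Assumptions P L ρ σ σg σH) (hL : 0 ≤ L) (hα : 0 ≤ α)
    (N : ℕ) (w : Param d) :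
    MemLp (fun i => exactMetaGrad (taskLoss P i) α N w) 2 P.taskLaw :=
  (hP.memLp_taskGrad w).of_le_mul
    ((hP.measurable_exactMetaGrad α N).comp measurable_prodMk_right).aestronglyMeasurable
    (Filter.Eventually.of_forall fun i => (hP.smoothLoss i).norm_exactMetaGrad_le hL hα N w)

theorem integrable_exactMetaGrad (hP : Assumptions P L ρ σ σg σH) (hL : 0 ≤ L) (hα : 0 ≤ α)
    (N : ℕ) (w : Param d) :
    Integrable (fun i => exactMetaGrad (taskLoss P i) α N w) P.taskLaw :=
  (hP.memLp_exactMetaGrad hL hα N w).integrable (by norm_num)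

theorem hasGradientAt_metaLoss (hP : Assumptions P L ρ σ σg σH) (hL : 0 < L) (hα : 0 ≤ α)
    (N : ℕ) (w : Param d) :
    HasGradientAt (metaLoss P α N) (∫ i, exactMetaGrad (taskLoss P i) α N w ∂P.taskLaw) w := by
  refine hasGradientAt_integral
    (b := fun i => (1 + α * L) ^ (2 * N) * (‖gradient (taskLoss P i) w‖ + L))
    (fun x => ?_) (hP.integrable_taskLoss_gdIter hL hα N w)
    (hP.integrable_exactMetaGrad hL.le hα N w).aestronglyMeasurable
    (fun i x => (hP.smoothLoss i).hasGradientAt_comp_gdIter α N x)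
    (((hP.integrable_taskGrad w).norm.add (integrable_const _)).const_mul _)
    fun i x hx => ?_
  · exact (hP.integrable_taskLoss_gdIter hL hα N x).aestronglyMeasurable
  · refine ((hP.smoothLoss i).norm_exactMetaGrad_le hL.le hα N x).trans ?_
    gcongr
    exact hP.norm_taskGrad_le hL.le w i hx

theorem differentiable_metaLoss (hP : Assumptions P L ρ σ σg σH) (hL : 0 < L) (hα : 0 ≤ α)
    (N : ℕ) : Differentiable ℝ (metaLoss P α N) :=
  fun w => (hP.hasGradientAt_metaLoss hL hα N w).differentiableAt

theorem gradient_metaLoss (hP : Assumptions P L ρ σ σg σH) (hL : 0 < L) (hα : 0 ≤ α)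
    (N : ℕ) (w : Param d) :
    gradient (metaLoss P α N) w = ∫ i, exactMetaGrad (taskLoss P i) α N w ∂P.taskLaw :=
  (hP.hasGradientAt_metaLoss hL hα N w).gradient

end Assumptions

/-- `E_i ‖∇l_i(w)‖`. -/
def meanGradNorm (P : TaskFamily d I 𝒟) (w : Param d) : ℝ :=
  ∫ i, ‖gradient (taskLoss P i) w‖ ∂P.taskLaw

theorem meanGradNorm_nonneg (P : TaskFamily d I 𝒟) (w : Param d) : 0 ≤ meanGradNorm P w :=
  integral_nonneg fun _ => norm_nonneg _

namespace Assumptions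

/-- The average over tasks of the bound anchored at `w`. Its constant is finite at each point but is
not bounded over all points. -/
theorem norm_gradient_metaLoss_sub_le (hP : Assumptions P L ρ σ σg σH) (hL : 0 < L)
    (hρ : 0 ≤ ρ) (hα : 0 ≤ α) {N : ℕ} (hN : 1 ≤ N) (u w : Param d) :
    ‖gradient (metaLoss P α N) u - gradient (metaLoss P α N) w‖
      ≤ ((1 + α * L) ^ (2 * N) * L + CL α L ρ N * meanGradNorm P w) * ‖u - w‖ := by
  rw [hP.gradient_metaLoss hL hα, hP.gradient_metaLoss hL hα,
    ← integral_sub (hP.integrable_exactMetaGrad hL.le hα N u)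
      (hP.integrable_exactMetaGrad hL.le hα N w)]
  have hi := (hP.integrable_taskGrad w).norm
  have hi' : Integrable (fun i => ((1 + α * L) ^ (2 * N) * L
      + CL α L ρ N * ‖gradient (taskLoss P i) w‖) * ‖u - w‖) P.taskLaw :=
    ((integrable_const _).add (hi.const_mul _)).mul_const _
  refine (norm_integral_le_of_norm_le hi' (Filter.Eventually.of_forall fun i =>
    (hP.smoothLoss i).norm_exactMetaGrad_sub_le hL hρ hα hN u w)).trans (le_of_eq ?_)
  rw [integral_mul_const, integral_add (integrable_const _) (hi.const_mul _)]
  simp [meanGradNorm, integral_const_mul]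

/-- For each task the meta gradient differs from ∇l_i(w) by at most (q²−1)‖∇l_i(w)‖, where q² =
(1+αL)^{2N}. Averaging and moving the ‖∇l(w)‖ term to the left leaves the factor 2 − q², which is
why q² < 2 is required later. -/
theorem norm_gradient_meanLoss_le (hP : Assumptions P L ρ σ σg σH) (hL : 0 < L) (hσ : 0 ≤ σ)
    (hα : 0 ≤ α) (N : ℕ) (w : Param d) :
    meanGradNorm P w ≤ ‖gradient (meanLoss P) w‖ + σ ∧
    (2 - (1 + α * L) ^ (2 * N)) * ‖gradient (meanLoss P) w‖
      ≤ ‖gradient (metaLoss P α N) w‖ + ((1 + α * L) ^ (2 * N) - 1) * σ := by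
  have hi := hP.integrable_taskGrad w
  have h1 : meanGradNorm P w ≤ ‖gradient (meanLoss P) w‖ + σ := by
    have h2 := hP.memLp_taskGrad_sub w
    have h3 : ∫ i, ‖gradient (taskLoss P i) w - gradient (meanLoss P) w‖ ∂P.taskLaw ≤ σ := by
      have := integral_le_sqrt_of_sq h2.1.norm h2.2
      rwa [Real.sqrt_sq hσ] at this
    have h4 : meanGradNorm P w ≤ ∫ i, (‖gradient (taskLoss P i) w - gradient (meanLoss P) w‖
        + ‖gradient (meanLoss P) w‖) ∂P.taskLaw :=
      integral_mono hi.norm ((h2.1.integrable (by norm_num)).norm.add (integrable_const _))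
        fun i => by
          have := norm_add_le (gradient (taskLoss P i) w - gradient (meanLoss P) w)
            (gradient (meanLoss P) w)
          rwa [sub_add_cancel] at this
    rw [integral_add (h2.1.integrable (by norm_num)).norm (integrable_const _)] at h4
    simp only [integral_const, probReal_univ, smul_eq_mul, one_mul] at h4
    linarith
  refine ⟨h1, ?_⟩
  have hq : 0 ≤ (1 + α * L) ^ (2 * N) - 1 := sub_nonneg.2 (one_le_pow₀ (by nlinarith))
  have h5 : ‖gradient (metaLoss P α N) w - gradient (meanLoss P) w‖
      ≤ ((1 + α * L) ^ (2 * N) - 1) * meanGradNorm P w := by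
    rw [hP.gradient_metaLoss hL hα, hP.gradient_meanLoss hL.le,
      ← integral_sub (hP.integrable_exactMetaGrad hL.le hα N w) hi, meanGradNorm,
      ← integral_const_mul]
    exact norm_integral_le_of_norm_le (hi.norm.const_mul _) (Filter.Eventually.of_forall fun i =>
      (hP.smoothLoss i).norm_exactMetaGrad_sub_gradient_le hL.le hα N w)
  have h6 := norm_sub_norm_le (gradient (meanLoss P) w) (gradient (metaLoss P α N) w)
  rw [norm_sub_rev] at h6
  nlinarith [mul_le_mul_of_nonneg_left h1 hq]

/-- The two contributions (q²−1)σ and (2−q²)σ add up to exactly σ. -/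
theorem meanGradNorm_le (hP : Assumptions P L ρ σ σg σH) (hL : 0 < L) (hσ : 0 ≤ σ)
    (hα : 0 ≤ α) {N : ℕ} (hq : (1 + α * L) ^ (2 * N) < 2) (w : Param d) :
    (2 - (1 + α * L) ^ (2 * N)) * meanGradNorm P w ≤ ‖gradient (metaLoss P α N) w‖ + σ := by
  obtain ⟨h1, h2⟩ := hP.norm_gradient_meanLoss_le hL hσ hα N w
  have := mul_le_mul_of_nonneg_left h1 (sub_nonneg.2 hq.le)
  linarith

theorem integral_norm_taskGrad_sq_le (hP : Assumptions P L ρ σ σg σH) (hL : 0 < L) (hσ : 0 ≤ σ)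
    (hα : 0 ≤ α) {N : ℕ} (hq : (1 + α * L) ^ (2 * N) < 2) (w : Param d) :
    (2 - (1 + α * L) ^ (2 * N)) ^ 2 * ∫ i, ‖gradient (taskLoss P i) w‖ ^ 2 ∂P.taskLaw
      ≤ 2 * (‖gradient (metaLoss P α N) w‖ ^ 2 + σ ^ 2) := by
  obtain ⟨-, h2⟩ := hP.norm_gradient_meanLoss_le hL hσ hα N w
  have h3 := integral_norm_sq_eq_add (hP.memLp_taskGrad w)
  rw [← hP.gradient_meanLoss hL.le] at h3
  have h4 := (hP.memLp_taskGrad_sub w).2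
  have hq1 : 1 ≤ (1 + α * L) ^ (2 * N) := one_le_pow₀ (by nlinarith)
  set q := (1 + α * L) ^ (2 * N)
  set x := ‖gradient (metaLoss P α N) w‖
  set y := ‖gradient (meanLoss P) w‖
  have hx : 0 ≤ x := norm_nonneg _
  have hy : 0 ≤ y := norm_nonneg _
  have h5 : ((2 - q) * y) ^ 2 ≤ (x + (q - 1) * σ) ^ 2 :=
    pow_le_pow_left₀ (mul_nonneg (by linarith) hy) h2 2
  have h6 : (x + (q - 1) * σ) ^ 2 ≤ 2 * (x ^ 2 + (q - 1) ^ 2 * σ ^ 2) := by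
    nlinarith [sq_nonneg (x - (q - 1) * σ)]
  -- Here `q` stands for (1+αL)^{2N}. The difference of the two sides is (3q − 2)(q − 2),
  -- nonpositive on [1, 2].
  have h7 : (2 - q) ^ 2 + 2 * (q - 1) ^ 2 ≤ 2 := by nlinarith
  rw [h3]
  nlinarith [mul_le_mul_of_nonneg_left h4 (sq_nonneg (2 - q)),
    mul_le_mul_of_nonneg_right h7 (sq_nonneg σ)]

/-- The mean minimises the mean square deviation, so ‖∇l(w)‖ may replace the mean of the norms; the
norm is 1-Lipschitz. -/
theorem integral_norm_taskGrad_dev_le (hP : Assumptions P L ρ σ σg σH) (w : Param d) :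
    ∫ i, ‖‖gradient (taskLoss P i) w‖ - meanGradNorm P w‖ ^ 2 ∂P.taskLaw ≤ σ ^ 2 := by
  have h1 := (hP.memLp_taskGrad w).norm
  set c := ‖gradient (meanLoss P) w‖
  have h2 : MemLp (fun i => ‖gradient (taskLoss P i) w‖ - c) 2 P.taskLaw :=
    h1.sub (memLp_const c)
  have h3 := integral_norm_sq_eq_add h2
  have h4 : ∫ i, (‖gradient (taskLoss P i) w‖ - c) ∂P.taskLaw = meanGradNorm P w - c := by
    rw [integral_sub (h1.integrable (by norm_num)) (integrable_const _)]
    simp [meanGradNorm]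
  simp only [h4, sub_sub_sub_cancel_right] at h3
  have h5 : ∫ i, ‖‖gradient (taskLoss P i) w‖ - c‖ ^ 2 ∂P.taskLaw
      ≤ ∫ i, ‖gradient (taskLoss P i) w - gradient (meanLoss P) w‖ ^ 2 ∂P.taskLaw := by
    refine integral_mono (MemLp.integrable_norm_sq h2)
      (MemLp.integrable_norm_sq (hP.memLp_taskGrad_sub w).1) fun i => ?_
    have := abs_norm_sub_norm_le (gradient (taskLoss P i) w) (gradient (meanLoss P) w)
    exact pow_le_pow_left₀ (norm_nonneg _) this 2
  have h6 := (hP.memLp_taskGrad_sub w).2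
  nlinarith [sq_nonneg ‖meanGradNorm P w - c‖]

end Assumptions

end MetaObjective

/-! ### Partial products, for treating the factors of the estimator one by one. -/

section ListProducts

variable {M : Type*} [Monoid M] {n : ℕ}

/-- `A_0 ⋯ A_{j-1}`. -/
def headProd (A : Fin n → M) (j : ℕ) : M := ((List.ofFn A).take j).prod

/-- `A_j ⋯ A_{n-1}`. -/
def tailProd (A : Fin n → M) (j : ℕ) : M := ((List.ofFn A).drop j).prod

theorem headProd_zero (A : Fin n → M) : headProd A 0 = 1 := by simp [headProd]

theorem headProd_self (A : Fin n → M) : headProd A n = (List.ofFn A).prod := by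
  rw [headProd, List.take_of_length_le (by simp)]

theorem headProd_succ (A : Fin n → M) {j : ℕ} (hj : j < n) :
    headProd A (j + 1) = headProd A j * A ⟨j, hj⟩ := by
  rw [headProd, List.prod_take_succ _ _ (by simpa using hj), List.getElem_ofFn, headProd]

theorem tailProd_zero (A : Fin n → M) : tailProd A 0 = (List.ofFn A).prod := by simp [tailProd]

theorem tailProd_self (A : Fin n → M) : tailProd A n = 1 := by
  rw [tailProd, List.drop_of_length_le (by simp), List.prod_nil]

theorem tailProd_eq (A : Fin n → M) {j : ℕ} (hj : j < n) :
    tailProd A j = A ⟨j, hj⟩ * tailProd A (j + 1) := by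
  rw [tailProd, List.drop_eq_getElem_cons (by simpa using hj), List.prod_cons, List.getElem_ofFn,
    tailProd]

theorem tailProd_congr {A A' : Fin n → M} {j : ℕ} (hj : j ≤ n)
    (h : ∀ k : Fin n, j ≤ (k : ℕ) → A k = A' k) : tailProd A j = tailProd A' j := by
  induction hj using Nat.decreasingInduction with
  | self => rw [tailProd_self, tailProd_self]
  | of_succ k hk ih =>
    rw [tailProd_eq A hk, tailProd_eq A' hk, ih fun m hm => h m (Nat.le_of_succ_le hm),
      h ⟨k, hk⟩ le_rfl]

end ListProducts

theorem norm_headProd_apply_le {d n : ℕ} {a : ℝ} (ha : 0 ≤ a)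
    {A : Fin n → Param d →L[ℝ] Param d} (hA : ∀ j, ‖A j‖ ≤ a) {j : ℕ} (hj : j ≤ n)
    (v : Param d) : ‖headProd A j v‖ ≤ a ^ j * ‖v‖ := by
  induction j generalizing v with
  | zero => simp [headProd_zero]
  | succ j ih =>
    rw [headProd_succ A hj, mul_apply_eq_comp, pow_succ, mul_assoc]
    refine (ih (Nat.le_of_succ_le hj) _).trans ?_
    gcongr
    exact ((A _).le_opNorm _).trans (by gcongr; exact hA _)

/-! ### Moments of c − rB for a random vector B. -/

section AffineMoments

variable {Ω : Type*} [MeasurableSpace Ω] {μ : Measure Ω} [IsProbabilityMeasure μ] {d : ℕ}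

theorem integral_const_sub_smul {B : Ω → Param d} (hB : MemLp B 2 μ) {m : Param d}
    (hm : ∫ ω, B ω ∂μ = m) (c : Param d) (r : ℝ) :
    MemLp (fun ω => c - r • B ω) 2 μ ∧ ∫ ω, c - r • B ω ∂μ = c - r • m := by
  have hi := hB.integrable (by norm_num)
  refine ⟨(memLp_const c).sub (hB.const_smul r), ?_⟩
  rw [integral_sub (g := fun ω => r • B ω) (integrable_const _) (hi.smul r), integral_smul, hm]
  simp

/-- The mean is split off first, so the noise enters additively as r²v without a cross term. -/
theorem integral_norm_const_sub_smul_sq_le {B : Ω → Param d} (hB : MemLp B 2 μ) {m : Param d}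
    (hm : ∫ ω, B ω ∂μ = m) {v : ℝ} (hv : ∫ ω, ‖B ω - m‖ ^ 2 ∂μ ≤ v) (c : Param d) (r : ℝ) :
    ∫ ω, ‖c - r • B ω‖ ^ 2 ∂μ ≤ ‖c - r • m‖ ^ 2 + r ^ 2 * v := by
  obtain ⟨h1, h2⟩ := integral_const_sub_smul hB hm c r
  rw [integral_norm_sq_eq_add h1, h2]
  have h3 : ∀ ω, ‖c - r • B ω - (c - r • m)‖ ^ 2 = r ^ 2 * ‖B ω - m‖ ^ 2 := fun ω => by
    rw [sub_sub_sub_cancel_left, ← smul_sub, norm_smul, mul_pow, Real.norm_eq_abs, sq_abs,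
      norm_sub_rev]
  simp only [h3]
  rw [integral_const_mul]
  gcongr

/-- The first-moment version: the triangle inequality around the mean, then the noise norm is
bounded by its root mean square. -/
theorem integral_norm_const_sub_smul_le {B : Ω → Param d} (hB : MemLp B 2 μ) {m : Param d}
    {v : ℝ} (hv : ∫ ω, ‖B ω - m‖ ^ 2 ∂μ ≤ v) (c : Param d) {r : ℝ} (hr : 0 ≤ r) :
    ∫ ω, ‖c - r • B ω‖ ∂μ ≤ ‖c - r • m‖ + r * √v := by
  have hn : MemLp (fun ω => ‖B ω - m‖) 2 μ := (hB.sub (memLp_const m)).norm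
  have hn' := hn.integrable (by norm_num)
  have h1 : ∫ ω, ‖c - r • B ω‖ ∂μ ≤ ∫ ω, (‖c - r • m‖ + r * ‖B ω - m‖) ∂μ := by
    refine integral_mono (((memLp_const c).sub (hB.const_smul r)).norm.integrable (by norm_num))
      ((integrable_const _).add (hn'.const_mul r)) fun ω => ?_
    have h2 : c - r • B ω = (c - r • m) - r • (B ω - m) := by rw [smul_sub]; abel
    change ‖c - r • B ω‖ ≤ _
    rw [h2]
    refine (norm_sub_le _ _).trans ?_
    rw [norm_smul, Real.norm_of_nonneg hr]
  refine h1.trans ?_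
  rw [integral_add (integrable_const _) (hn'.const_mul r), integral_const_mul]
  simp only [integral_const, probReal_univ, smul_eq_mul, one_mul]
  gcongr
  exact integral_le_sqrt_of_sq hn hv

end AffineMoments

/-! ### Batch moments, dependence on slots, and the error of the stochastic inner iterates. -/

section Estimator

variable {d : ℕ} {I 𝒟 : Type*} [MeasurableSpace I] [MeasurableSpace 𝒟] {P : TaskFamily d I 𝒟}
  {L ρ σ σg σH α : ℝ}

namespace Assumptions

theorem sampleGrad_moments (hP : Assumptions P L ρ σ σg σH) (i : I) (w : Param d) :
    MemLp (fun τ => gradient (P.loss i τ) w) 2 (P.dataLaw i) ∧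
      ∫ τ, ‖gradient (P.loss i τ) w - gradient (taskLoss P i) w‖ ^ 2 ∂(P.dataLaw i) ≤ σg ^ 2 := by
  have hm : Measurable fun τ => gradient (P.loss i τ) w :=
    hP.measurable_sampleGrad.comp (f := fun τ => (i, τ, w)) (by fun_prop)
  obtain ⟨h1, h2⟩ := memLp_two_of_lintegral_le (hm.sub_const _).aestronglyMeasurable
    (sq_nonneg σg) (hP.variance_grad i w)
  refine ⟨?_, h2⟩
  have h' : (fun τ => gradient (P.loss i τ) w) =
      (fun τ => gradient (P.loss i τ) w - gradient (taskLoss P i) w)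
        + fun _ => gradient (taskLoss P i) w := by
    ext1 τ; simp
  rw [h']
  exact h1.add (memLp_const _)

/-- The spectral norm does not come from an inner product, so variances are computed for the Hessian
applied to a fixed vector, where the variance formulas for independent sums hold. -/
theorem sampleHess_moments (hP : Assumptions P L ρ σ σg σH) (i : I) (w v : Param d) :
    MemLp (fun τ => hessian (P.loss i τ) w v) 2 (P.dataLaw i) ∧
      ∫ τ, hessian (P.loss i τ) w v ∂(P.dataLaw i) = hessian (taskLoss P i) w v ∧
      ∫ τ, ‖hessian (P.loss i τ) w v - hessian (taskLoss P i) w v‖ ^ 2 ∂(P.dataLaw i)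
        ≤ σH ^ 2 * ‖v‖ ^ 2 := by
  have hm : Measurable fun τ => hessian (P.loss i τ) w :=
    measurable_clm_of_apply fun v =>
      hP.measurable_sampleHess.comp (f := fun τ => (i, τ, w, v)) (by fun_prop)
  obtain ⟨h1, h2⟩ := memLp_two_of_lintegral_le (hm.sub_const _).aestronglyMeasurable
    (sq_nonneg σH) (hP.variance_hessian i w)
  have h3 : MemLp (fun τ => hessian (P.loss i τ) w) 2 (P.dataLaw i) := by
    have h' : (fun τ => hessian (P.loss i τ) w) =
        (fun τ => hessian (P.loss i τ) w - hessian (taskLoss P i) w)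
          + fun _ => hessian (taskLoss P i) w := by
      ext1 τ; simp
    rw [h']
    exact h1.add (memLp_const _)
  have hb : ∀ (A : Param d →L[ℝ] Param d), ‖A v‖ ≤ ‖v‖ * ‖A‖ := fun A => by
    rw [mul_comm]; exact A.le_opNorm v
  have h4 : MemLp (fun τ => hessian (P.loss i τ) w v) 2 (P.dataLaw i) :=
    h3.of_le_mul (hP.measurable_sampleHess.comp
      (f := fun τ => (i, τ, w, v)) (by fun_prop)).aestronglyMeasurable
      (Filter.Eventually.of_forall fun τ => hb _)
  refine ⟨h4, ?_, ?_⟩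
  · rw [← hP.unbiased_hessian i w, ContinuousLinearMap.integral_apply (h3.integrable (by norm_num))]
  · rw [mul_comm]
    refine le_trans ?_ (mul_le_mul_of_nonneg_left h2 (sq_nonneg ‖v‖))
    rw [← integral_const_mul]
    refine integral_mono (MemLp.integrable_norm_sq (h4.sub (memLp_const _)))
      ((MemLp.integrable_norm_sq h1).const_mul _) fun τ => ?_
    change ‖hessian (P.loss i τ) w v - hessian (taskLoss P i) w v‖ ^ 2 ≤ _
    rw [← mul_pow, ← sub_apply]
    exact pow_le_pow_left₀ (norm_nonneg _) (hb _) 2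

variable {ι : Type*} [Fintype ι]

theorem batchGrad_moments (hP : Assumptions P L ρ σ σg σH) (i : I) (w : Param d) {n : ℕ}
    (hn : 1 ≤ n) {e : Fin n → ι} (he : Function.Injective e) :
    MemLp (fun x : ι → 𝒟 => batchGrad P i (fun a => x (e a)) w) 2
        (Measure.pi fun _ => P.dataLaw i) ∧
      ∫ x : ι → 𝒟, batchGrad P i (fun a => x (e a)) w ∂(Measure.pi fun _ => P.dataLaw i)
        = gradient (taskLoss P i) w ∧
      ∫ x : ι → 𝒟, ‖batchGrad P i (fun a => x (e a)) w - gradient (taskLoss P i) w‖ ^ 2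
        ∂(Measure.pi fun _ => P.dataLaw i) ≤ σg ^ 2 / n :=
  batch_mean (fun _ : ι => P.dataLaw i) hn he (fun _ τ => gradient (P.loss i τ) w)
    (fun _ => hP.measurable_sampleGrad.comp (f := fun τ => (i, τ, w)) (by fun_prop))
    (fun _ => (hP.sampleGrad_moments i w).1) (fun _ => hP.unbiased_grad i w)
    fun _ => (hP.sampleGrad_moments i w).2

theorem batchHess_moments (hP : Assumptions P L ρ σ σg σH) (i : I) (w v : Param d) {n : ℕ}
    (hn : 1 ≤ n) {e : Fin n → ι} (he : Function.Injective e) :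
    MemLp (fun x : ι → 𝒟 => batchHess P i (fun a => x (e a)) w v) 2
        (Measure.pi fun _ => P.dataLaw i) ∧
      ∫ x : ι → 𝒟, batchHess P i (fun a => x (e a)) w v ∂(Measure.pi fun _ => P.dataLaw i)
        = hessian (taskLoss P i) w v ∧
      ∫ x : ι → 𝒟, ‖batchHess P i (fun a => x (e a)) w v - hessian (taskLoss P i) w v‖ ^ 2
        ∂(Measure.pi fun _ => P.dataLaw i) ≤ σH ^ 2 * ‖v‖ ^ 2 / n := by
  simp only [batchHess, smul_apply, sum_apply]
  exact batch_mean (fun _ : ι => P.dataLaw i) hn he (fun _ τ => hessian (P.loss i τ) w v)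
    (fun _ => hP.measurable_sampleHess.comp (f := fun τ => (i, τ, w, v)) (by fun_prop))
    (fun _ => (hP.sampleHess_moments i w v).1) (fun _ => (hP.sampleHess_moments i w v).2.1)
    fun _ => (hP.sampleHess_moments i w v).2.2

end Assumptions

variable {N : ℕ} {z : BatchSizes}

/-- The slots of the inner batch of step `j`. -/
def innerSlots (z : BatchSizes) (j : Fin N) : Set (Slot N z) := {s | ∃ a, s = Sum.inl (j, a)}

/-- The slots of the Hessian batch of step `j`. -/
def hessSlots (z : BatchSizes) (j : Fin N) : Set (Slot N z) :=
  {s | ∃ a, s = Sum.inr (Sum.inl (j, a))}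

/-- The slots of the outer batch. -/
def outerSlots (N : ℕ) (z : BatchSizes) : Set (Slot N z) := {s | ∃ a, s = Sum.inr (Sum.inr a)}

/-- The iterate w_j depends only on the inner batches drawn before step j. Hence it does not change
when batch j, a Hessian batch or the outer batch is resampled. -/
theorem innerSGD_congr (P : TaskFamily d I 𝒟) (α : ℝ) (i : I) {x x' : Slot N z → 𝒟} (w : Param d)
    (j : Fin (N + 1))
    (h : ∀ (j' : Fin N) (s : Fin z.S), (j' : ℕ) < j → x (Sum.inl (j', s)) = x' (Sum.inl (j', s))) :
    innerSGD P α i x w j = innerSGD P α i x' w j := by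
  induction j using Fin.induction with
  | zero => rfl
  | succ j ih =>
    have h1 := ih fun j' s hj => h j' s (hj.trans (by simp))
    have h2 : (fun s : Fin z.S => x (Sum.inl (j, s))) = fun s => x' (Sum.inl (j, s)) :=
      funext fun s => h j s (by simp)
    rw [innerSGD_succ, innerSGD_succ, h1, h2]

theorem innerSGD_merge_innerSlots (P : TaskFamily d I 𝒟) (α : ℝ) (i : I) (y x : Slot N z → 𝒟)
    (w : Param d) (j : Fin N) :
    innerSGD P α i (merge (innerSlots z j) y x) w j.castSucc
      = innerSGD P α i x w j.castSucc := by
  refine innerSGD_congr P α i w _ fun j' s hj => merge_of_notMem _ _ ?_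
  rintro ⟨a, ha⟩
  simp only [Sum.inl.injEq, Prod.mk.injEq] at ha
  rw [ha.1] at hj
  simp at hj

theorem innerSGD_merge_hessSlots (P : TaskFamily d I 𝒟) (α : ℝ) (i : I) (y x : Slot N z → 𝒟)
    (w : Param d) (j : Fin N) (k : Fin (N + 1)) :
    innerSGD P α i (merge (hessSlots z j) y x) w k = innerSGD P α i x w k :=
  innerSGD_congr P α i w _ fun j' s _ => merge_of_notMem _ _ (by simp [hessSlots])

theorem innerSGD_merge_outerSlots (P : TaskFamily d I 𝒟) (α : ℝ) (i : I) (y x : Slot N z → 𝒟)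
    (w : Param d) (k : Fin (N + 1)) :
    innerSGD P α i (merge (outerSlots N z) y x) w k = innerSGD P α i x w k :=
  innerSGD_congr P α i w _ fun j' s _ => merge_of_notMem _ _ (by simp [outerSlots])

/-- The factor `I - α ∇²l_i(w_j; D_j)` of the meta gradient estimator. -/
def estFactor (P : TaskFamily d I 𝒟) (α : ℝ) (i : I) (x : Slot N z → 𝒟) (w : Param d)
    (j : Fin N) : Param d →L[ℝ] Param d :=
  1 - α • batchHess P i (fun r : Fin z.D => x (Sum.inr (Sum.inl (j, r))))
    (innerSGD P α i x w j.castSucc)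

/-- The factor `I - α ∇²l_i(w_j)`. -/
def condFactor (P : TaskFamily d I 𝒟) (α : ℝ) (i : I) (x : Slot N z → 𝒟) (w : Param d)
    (j : Fin N) : Param d →L[ℝ] Param d :=
  1 - α • hessian (taskLoss P i) (innerSGD P α i x w j.castSucc)

/-- The outer gradient `∇l_i(w_N; T)`. -/
def outerGrad (P : TaskFamily d I 𝒟) (α : ℝ) (i : I) (x : Slot N z → 𝒟) (w : Param d) : Param d :=
  batchGrad P i (fun t : Fin z.T => x (Sum.inr (Sum.inr t))) (innerSGD P α i x w (Fin.last N))

theorem metaGradEst_eq (P : TaskFamily d I 𝒟) (α : ℝ) (i : I) (x : Slot N z → 𝒟) (w : Param d) :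
    metaGradEst P α i x w = tailProd (estFactor P α i x w) 0 (outerGrad P α i x w) := by
  rw [tailProd_zero]
  rfl

theorem estFactor_merge_hessSlots (P : TaskFamily d I 𝒟) (α : ℝ) (i : I) (y x : Slot N z → 𝒟)
    (w : Param d) {j k : Fin N} (hjk : j ≠ k) :
    estFactor P α i (merge (hessSlots z j) y x) w k = estFactor P α i x w k := by
  have h : (fun r : Fin z.D => merge (hessSlots z j) y x (Sum.inr (Sum.inl (k, r))))
      = fun r => x (Sum.inr (Sum.inl (k, r))) :=
    funext fun r => merge_of_notMem _ _ (by simp [hessSlots, hjk.symm])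
  rw [estFactor, estFactor, innerSGD_merge_hessSlots, h]

theorem estFactor_merge_hessSlots_self (P : TaskFamily d I 𝒟) (α : ℝ) (i : I)
    (y x : Slot N z → 𝒟) (w : Param d) (j : Fin N) :
    estFactor P α i (merge (hessSlots z j) y x) w j
      = 1 - α • batchHess P i (fun r : Fin z.D => y (Sum.inr (Sum.inl (j, r))))
        (innerSGD P α i x w j.castSucc) := by
  have h : (fun r : Fin z.D => merge (hessSlots z j) y x (Sum.inr (Sum.inl (j, r))))
      = fun r => y (Sum.inr (Sum.inl (j, r))) :=
    funext fun r => merge_of_mem _ _ ⟨r, rfl⟩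
  rw [estFactor, innerSGD_merge_hessSlots, h]

theorem condFactor_merge_hessSlots (P : TaskFamily d I 𝒟) (α : ℝ) (i : I) (y x : Slot N z → 𝒟)
    (w : Param d) (j : Fin N) :
    condFactor P α i (merge (hessSlots z j) y x) w = condFactor P α i x w := by
  ext1 k
  rw [condFactor, condFactor, innerSGD_merge_hessSlots]

theorem condFactor_merge_outerSlots (P : TaskFamily d I 𝒟) (α : ℝ) (i : I) (y x : Slot N z → 𝒟)
    (w : Param d) :
    condFactor P α i (merge (outerSlots N z) y x) w = condFactor P α i x w := by
  ext1 k
  rw [condFactor, condFactor, innerSGD_merge_outerSlots]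

theorem outerGrad_merge_hessSlots (P : TaskFamily d I 𝒟) (α : ℝ) (i : I) (y x : Slot N z → 𝒟)
    (w : Param d) (j : Fin N) :
    outerGrad P α i (merge (hessSlots z j) y x) w = outerGrad P α i x w := by
  have h : (fun t : Fin z.T => merge (hessSlots z j) y x (Sum.inr (Sum.inr t)))
      = fun t => x (Sum.inr (Sum.inr t)) :=
    funext fun r => merge_of_notMem _ _ (by simp [hessSlots])
  rw [outerGrad, outerGrad, innerSGD_merge_hessSlots, h]

theorem outerGrad_merge_outerSlots (P : TaskFamily d I 𝒟) (α : ℝ) (i : I) (y x : Slot N z → 𝒟)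
    (w : Param d) :
    outerGrad P α i (merge (outerSlots N z) y x) w
      = batchGrad P i (fun t : Fin z.T => y (Sum.inr (Sum.inr t)))
        (innerSGD P α i x w (Fin.last N)) := by
  have h : (fun t : Fin z.T => merge (outerSlots N z) y x (Sum.inr (Sum.inr t)))
      = fun t => y (Sum.inr (Sum.inr t)) :=
    funext fun r => merge_of_mem _ _ ⟨r, rfl⟩
  rw [outerGrad, innerSGD_merge_outerSlots, h]

namespace Assumptions

theorem measurable_innerSGD_right (hP : Assumptions P L ρ σ σg σH) (α : ℝ) (i : I) (w : Param d)
    (j : Fin (N + 1)) : Measurable fun x : Slot N z → 𝒟 => innerSGD P α i x w j :=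
  (hP.measurable_innerSGD α j).comp (f := fun x : Slot N z → 𝒟 => ((i, x), w)) (by fun_prop)

theorem measurable_estFactor (hP : Assumptions P L ρ σ σg σH) (α : ℝ) (i : I) (w : Param d)
    (j : Fin N) {u : (Slot N z → 𝒟) → Param d} (hu : Measurable u) :
    Measurable fun x : Slot N z → 𝒟 => estFactor P α i x w j (u x) := by
  have h := hP.measurable_batchHess_comp (i := fun _ : Slot N z → 𝒟 => i)
    (x := fun x => fun r : Fin z.D => x (Sum.inr (Sum.inl (j, r)))) measurable_const
    (by fun_prop) (hP.measurable_innerSGD_right α i w j.castSucc) hu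
  exact hu.sub (h.const_smul α)

theorem measurable_condFactor (hP : Assumptions P L ρ σ σg σH) (α : ℝ) (i : I) (w : Param d)
    (j : Fin N) {u : (Slot N z → 𝒟) → Param d} (hu : Measurable u) :
    Measurable fun x : Slot N z → 𝒟 => condFactor P α i x w j (u x) := by
  have h : Measurable fun x : Slot N z → 𝒟 =>
      hessian (taskLoss P i) (innerSGD P α i x w j.castSucc) (u x) :=
    hP.measurable_taskHess.comp (measurable_const.prodMk
      ((hP.measurable_innerSGD_right α i w j.castSucc).prodMk hu))
  exact hu.sub (h.const_smul α)

theorem measurable_outerGrad (hP : Assumptions P L ρ σ σg σH) (α : ℝ) (i : I) (w : Param d) :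
    Measurable fun x : Slot N z → 𝒟 => outerGrad P α i x w :=
  hP.measurable_batchGrad_comp measurable_const (by fun_prop)
    (hP.measurable_innerSGD_right α i w _)

theorem measurable_headProd (hP : Assumptions P L ρ σ σg σH) (α : ℝ) (i : I) (w : Param d)
    {j : ℕ} (hj : j ≤ N) {u : (Slot N z → 𝒟) → Param d} (hu : Measurable u) :
    Measurable fun x : Slot N z → 𝒟 => headProd (condFactor P α i x w) j (u x) := by
  induction j generalizing u with
  | zero => simpa [headProd_zero] using hu
  | succ j ih =>
    simp only [headProd_succ _ hj, mul_apply_eq_comp]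
    exact ih (Nat.le_of_succ_le hj) (hP.measurable_condFactor α i w _ hu)

theorem measurable_tailProd (hP : Assumptions P L ρ σ σg σH) (α : ℝ) (i : I) (w : Param d)
    {j : ℕ} (hj : j ≤ N) :
    Measurable fun x : Slot N z → 𝒟 =>
      tailProd (estFactor P α i x w) j (outerGrad P α i x w) := by
  induction hj using Nat.decreasingInduction with
  | self => simpa [tailProd_self] using hP.measurable_outerGrad α i w
  | of_succ k hk ih =>
    simp only [tailProd_eq _ hk, mul_apply_eq_comp]
    exact hP.measurable_estFactor α i w _ ih

/-- Mean square distance of the stochastic inner iterates from the exact ones. -/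
theorem innerSGD_error_sq (hP : Assumptions P L ρ σ σg σH) (hL : 0 < L) (hα : 0 < α)
    (hS : 1 ≤ z.S) (i : I) (w : Param d) (j : Fin (N + 1)) :
    Integrable (fun x : Slot N z → 𝒟 =>
      ‖innerSGD P α i x w j - gdIter (taskLoss P i) α j w‖ ^ 2)
        (Measure.pi fun _ => P.dataLaw i) ∧
    ∫ x : Slot N z → 𝒟, ‖innerSGD P α i x w j - gdIter (taskLoss P i) α j w‖ ^ 2
        ∂(Measure.pi fun _ => P.dataLaw i)
      ≤ ((1 + 2 * α * L + 2 * α ^ 2 * L ^ 2) ^ (j : ℕ) - 1)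
        * (α * σg ^ 2 / (L * (1 + α * L) * z.S)) := by
  induction j using Fin.induction with
  | zero => simp [innerSGD_zero, gdIter_zero]
  | succ j ih =>
    obtain ⟨ih1, ih2⟩ := ih
    have hS0 : (0 : ℝ) < z.S := by exact_mod_cast hS
    have hinj : Function.Injective fun s : Fin z.S => (Sum.inl (j, s) : Slot N z) := by
      intro s t h
      simpa using h
    -- With batch j resampled, w_j is frozen. The mean step contracts or expands distances by at
    -- most 1+αL, and the noise adds α²σ_g²/S.
    have key := integrable_and_integral_le_of_merge (innerSlots z j)
      (fun _ : Slot N z => P.dataLaw i)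
      (F := fun x => ‖innerSGD P α i x w j.succ - gdIter (taskLoss P i) α j.succ w‖ ^ 2)
      (G := fun x => (1 + α * L) ^ 2 *
        ‖innerSGD P α i x w j.castSucc - gdIter (taskLoss P i) α j.castSucc w‖ ^ 2
          + α ^ 2 * (σg ^ 2 / z.S))
      (((hP.measurable_innerSGD_right α i w _).sub_const _).norm.pow_const 2)
      (fun x => by positivity) ((ih1.const_mul _).add (integrable_const _)) (fun x => by
        have hmerge : ∀ y, innerSGD P α i (merge (innerSlots z j) y x) w j.succ
            - gdIter (taskLoss P i) α j.succ w
          = (innerSGD P α i x w j.castSucc - gdIter (taskLoss P i) α j.succ w)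
            - α • batchGrad P i (fun s : Fin z.S => y (Sum.inl (j, s)))
              (innerSGD P α i x w j.castSucc) := fun y => by
          have h : (fun s : Fin z.S => merge (innerSlots z j) y x (Sum.inl (j, s)))
              = fun s => y (Sum.inl (j, s)) := funext fun s => merge_of_mem _ _ ⟨s, rfl⟩
          rw [innerSGD_succ, innerSGD_merge_innerSlots, h, sub_right_comm]
        simp only [hmerge]
        obtain ⟨hb1, hb2, hb3⟩ := hP.batchGrad_moments i (innerSGD P α i x w j.castSucc) hS hinj
        refine ⟨MemLp.integrable_norm_sq (integral_const_sub_smul hb1 hb2 _ _).1, ?_⟩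
        refine (integral_norm_const_sub_smul_sq_le hb1 hb2 hb3 _ _).trans
          (add_le_add ?_ le_rfl)
        rw [← mul_pow, Fin.val_succ, gdIter_succ', sub_right_comm, Fin.val_castSucc]
        exact pow_le_pow_left₀ (norm_nonneg _)
          ((hP.smoothLoss i).norm_gradStep_sub_le hα.le _ _) 2)
    refine ⟨key.1, key.2.trans ?_⟩
    rw [integral_add (ih1.const_mul _) (integrable_const _), integral_const_mul]
    simp only [integral_const, probReal_univ, smul_eq_mul, one_mul]
    rw [Fin.val_castSucc] at ih2
    rw [Fin.val_succ, Fin.val_castSucc]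
    set e := ∫ x : Slot N z → 𝒟, ‖innerSGD P α i x w j.castSucc - gdIter (taskLoss P i) α j w‖ ^ 2
        ∂(Measure.pi fun _ => P.dataLaw i)
    have he : 0 ≤ e := integral_nonneg fun x => by positivity
    set b := 1 + 2 * α * L + 2 * α ^ 2 * L ^ 2 with hb
    set c := α * σg ^ 2 / (L * (1 + α * L) * z.S) with hc
    have hc0 : 0 ≤ c := by positivity
    have h1 : (1 + α * L) ^ 2 ≤ b := by nlinarith [mul_pos hα hL]
    -- Since b − 1 = 2αL(1+αL), the product (b−1)c is twice the noise of one step. With (1+αL)² ≤ b,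
    -- the bound (b^j − 1)c is then stable under the recursion.
    have h2 : α ^ 2 * (σg ^ 2 / z.S) ≤ (b - 1) * c := by
      have : (b - 1) * c = 2 * (α ^ 2 * (σg ^ 2 / z.S)) := by
        rw [hb, hc]
        field_simp
        ring
      rw [this]
      have : 0 ≤ α ^ 2 * (σg ^ 2 / z.S) := by positivity
      linarith
    have hb0 : 0 ≤ b := (sq_nonneg _).trans h1
    rw [pow_succ b]
    nlinarith [mul_le_mul_of_nonneg_right h1 he, mul_le_mul_of_nonneg_left ih2 hb0]

theorem integrable_innerSGD_error (hP : Assumptions P L ρ σ σg σH) (hL : 0 < L) (hα : 0 < α)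
    (hS : 1 ≤ z.S) (i : I) (w : Param d) (j : Fin (N + 1)) :
    Integrable (fun x : Slot N z → 𝒟 =>
      ‖innerSGD P α i x w j - gdIter (taskLoss P i) α j w‖) (Measure.pi fun _ => P.dataLaw i) :=
  ((memLp_two_of_integrable_sq
    ((hP.measurable_innerSGD_right α i w j).sub_const _).aestronglyMeasurable
    (hP.innerSGD_error_sq hL hα hS i w j).1).integrable (by norm_num)).norm

/-- Mean distance of the stochastic inner iterates from the exact ones. -/
theorem innerSGD_error (hP : Assumptions P L ρ σ σg σH) (hL : 0 < L) (hα : 0 < α) (hσg : 0 ≤ σg)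
    (hS : 1 ≤ z.S) (i : I) (w : Param d) (j : Fin (N + 1)) :
    L * ∫ x : Slot N z → 𝒟, ‖innerSGD P α i x w j - gdIter (taskLoss P i) α j w‖
        ∂(Measure.pi fun _ => P.dataLaw i)
      ≤ ((1 + α * L) ^ (j : ℕ) - 1) * (σg / √z.S) := by
  induction j using Fin.induction with
  | zero => simp [innerSGD_zero, gdIter_zero]
  | succ j ih =>
    have hint := hP.integrable_innerSGD_error hL hα hS i w j.castSucc
    have hinj : Function.Injective fun s : Fin z.S => (Sum.inl (j, s) : Slot N z) := by
      intro s t h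
      simpa using h
    have hsqrt : √(σg ^ 2 / z.S) = σg / √z.S := by
      rw [Real.sqrt_div (sq_nonneg _), Real.sqrt_sq hσg]
    have key := integrable_and_integral_le_of_merge (innerSlots z j)
      (fun _ : Slot N z => P.dataLaw i)
      (F := fun x => ‖innerSGD P α i x w j.succ - gdIter (taskLoss P i) α j.succ w‖)
      (G := fun x => (1 + α * L) *
        ‖innerSGD P α i x w j.castSucc - gdIter (taskLoss P i) α j.castSucc w‖
          + α * (σg / √z.S))
      (((hP.measurable_innerSGD_right α i w _).sub_const _).norm)
      (fun x => by positivity) ((hint.const_mul _).add (integrable_const _)) (fun x => by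
        have hmerge : ∀ y, innerSGD P α i (merge (innerSlots z j) y x) w j.succ
            - gdIter (taskLoss P i) α j.succ w
          = (innerSGD P α i x w j.castSucc - gdIter (taskLoss P i) α j.succ w)
            - α • batchGrad P i (fun s : Fin z.S => y (Sum.inl (j, s)))
              (innerSGD P α i x w j.castSucc) := fun y => by
          have h : (fun s : Fin z.S => merge (innerSlots z j) y x (Sum.inl (j, s)))
              = fun s => y (Sum.inl (j, s)) := funext fun s => merge_of_mem _ _ ⟨s, rfl⟩
          rw [innerSGD_succ, innerSGD_merge_innerSlots, h, sub_right_comm]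
        simp only [hmerge]
        obtain ⟨hb1, hb2, hb3⟩ := hP.batchGrad_moments i (innerSGD P α i x w j.castSucc) hS hinj
        refine ⟨((integral_const_sub_smul hb1 hb2 _ _).1.integrable (by norm_num)).norm, ?_⟩
        refine (integral_norm_const_sub_smul_le hb1 hb3 _ hα.le).trans
          (add_le_add ?_ (by rw [hsqrt]))
        rw [Fin.val_succ, gdIter_succ', sub_right_comm, Fin.val_castSucc]
        exact (hP.smoothLoss i).norm_gradStep_sub_le hα.le _ _)
    refine (mul_le_mul_of_nonneg_left key.2 hL.le).trans ?_
    rw [integral_add (hint.const_mul _) (integrable_const _), integral_const_mul]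
    simp only [integral_const, probReal_univ, smul_eq_mul, one_mul]
    rw [Fin.val_castSucc] at ih
    rw [Fin.val_succ, pow_succ, Fin.val_castSucc]
    -- With a = 1+αL and s = σ_g/√S the recursion closes by a(a^j − 1)s + (a − 1)s = (a^{j+1} − 1)s.
    nlinarith [mul_le_mul_of_nonneg_left ih (show 0 ≤ 1 + α * L by positivity)]

end Assumptions

end Estimator

/-! ### Bias and second moment of the meta gradient estimator for a fixed task. -/

section EstimatorMoments

variable {d : ℕ} {I 𝒟 : Type*} [MeasurableSpace I] [MeasurableSpace 𝒟] {P : TaskFamily d I 𝒟}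
  {L ρ σ σg σH α : ℝ} {N : ℕ} {z : BatchSizes}

namespace Assumptions

/-- Second moment of the outer gradient. -/
theorem outerGrad_sq (hP : Assumptions P L ρ σ σg σH) (hL : 0 < L) (hα : 0 < α)
    (hz : z.Pos) (i : I) (w : Param d) :
    Integrable (fun x : Slot N z → 𝒟 => ‖outerGrad P α i x w‖ ^ 2)
        (Measure.pi fun _ => P.dataLaw i) ∧
    ∫ x : Slot N z → 𝒟, ‖outerGrad P α i x w‖ ^ 2 ∂(Measure.pi fun _ => P.dataLaw i)
      ≤ 3 * (σg ^ 2 / z.T + ((1 + 2 * α * L + 2 * α ^ 2 * L ^ 2) ^ N - 1) * (α * L)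
          * (1 + α * L)⁻¹ * σg ^ 2 / z.S
        + (1 + α * L) ^ (2 * N) * ‖gradient (taskLoss P i) w‖ ^ 2) := by
  obtain ⟨hS, -, hT, -⟩ := hz
  obtain ⟨he1, he2⟩ := hP.innerSGD_error_sq hL hα hS i w (Fin.last N)
  rw [Fin.val_last] at he1 he2
  have hS0 : (0 : ℝ) < z.S := by exact_mod_cast hS
  set g := ‖gradient (taskLoss P i) w‖
  have hinj : Function.Injective fun t : Fin z.T => (Sum.inr (Sum.inr t) : Slot N z) := by
    intro s t h
    simpa using h
  have hTv : 0 ≤ σg ^ 2 / (z.T : ℝ) := by positivity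
  have key := integrable_and_integral_le_of_merge (outerSlots N z)
    (fun _ : Slot N z => P.dataLaw i)
    (F := fun x => ‖outerGrad P α i x w‖ ^ 2)
    (G := fun x => 3 * (L ^ 2 *
      ‖innerSGD P α i x w (Fin.last N) - gdIter (taskLoss P i) α N w‖ ^ 2)
        + 3 * (σg ^ 2 / z.T + (1 + α * L) ^ (2 * N) * g ^ 2))
    ((hP.measurable_outerGrad α i w).norm.pow_const 2) (fun x => by positivity)
    (((he1.const_mul _).const_mul _).add (integrable_const _)) (fun x => by
      simp only [outerGrad_merge_outerSlots]
      set W := innerSGD P α i x w (Fin.last N)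
      obtain ⟨hb1, hb2, hb3⟩ := hP.batchGrad_moments i W hT hinj
      refine ⟨MemLp.integrable_norm_sq hb1, ?_⟩
      rw [integral_norm_sq_eq_add hb1, hb2]
      have h1 := (hP.lipschitz_grad i W (gdIter (taskLoss P i) α N w))
      have h2 := (hP.smoothLoss i).norm_gradient_gdIter_le hL.le hα.le N w
      have h3 : ‖gradient (taskLoss P i) W‖
          ≤ L * ‖W - gdIter (taskLoss P i) α N w‖ + (1 + α * L) ^ N * g := by
        have := norm_sub_norm_le (gradient (taskLoss P i) W)
          (gradient (taskLoss P i) (gdIter (taskLoss P i) α N w))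
        linarith
      have h4 := pow_le_pow_left₀ (norm_nonneg _) h3 2
      set p := L * ‖W - gdIter (taskLoss P i) α N w‖ with hp
      set r := (1 + α * L) ^ N * g with hr
      have h5 : L ^ 2 * ‖W - gdIter (taskLoss P i) α N w‖ ^ 2 = p ^ 2 := by rw [hp]; ring
      have h6 : (1 + α * L) ^ (2 * N) * g ^ 2 = r ^ 2 := by rw [hr]; ring
      rw [h5, h6]
      -- (p + r)² ≤ 2p² + 2r²; the constant 3 is the one in `Csqu1` and leaves room.
      nlinarith [sq_nonneg (p - r), sq_nonneg p, sq_nonneg r])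
  refine ⟨key.1, key.2.trans ?_⟩
  rw [integral_add ((he1.const_mul _).const_mul _) (integrable_const _), integral_const_mul,
    integral_const_mul]
  simp only [integral_const, probReal_univ, smul_eq_mul, one_mul]
  have h7 := mul_le_mul_of_nonneg_left he2 (sq_nonneg L)
  have h8 : L ^ 2 * (((1 + 2 * α * L + 2 * α ^ 2 * L ^ 2) ^ N - 1)
        * (α * σg ^ 2 / (L * (1 + α * L) * z.S)))
      = ((1 + 2 * α * L + 2 * α ^ 2 * L ^ 2) ^ N - 1) * (α * L)
          * (1 + α * L)⁻¹ * σg ^ 2 / z.S := by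
    have : 0 < 1 + α * L := by positivity
    field_simp
  linarith

theorem norm_condFactor_le (hP : Assumptions P L ρ σ σg σH) (hL : 0 ≤ L) (hα : 0 ≤ α) (i : I)
    (x : Slot N z → 𝒟) (w : Param d) (j : Fin N) : ‖condFactor P α i x w j‖ ≤ 1 + α * L :=
  (hP.smoothLoss i).norm_one_sub_hessian_le hL hα _

/-- Only the Hessian batch of step j is random here, and the iterate it is evaluated at is frozen.
The vector `v` will be the product of the later factors, which does not involve this batch. -/
theorem estFactor_moments (hP : Assumptions P L ρ σ σg σH) (hL : 0 ≤ L) (hα : 0 ≤ α)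
    (hD : 1 ≤ z.D) (i : I) (x : Slot N z → 𝒟) (w v : Param d) (j : Fin N) :
    MemLp (fun y => estFactor P α i (merge (hessSlots z j) y x) w j v) 2
        (Measure.pi fun _ => P.dataLaw i) ∧
      ∫ y, estFactor P α i (merge (hessSlots z j) y x) w j v ∂(Measure.pi fun _ => P.dataLaw i)
        = condFactor P α i x w j v ∧
      ∫ y, ‖estFactor P α i (merge (hessSlots z j) y x) w j v‖ ^ 2
          ∂(Measure.pi fun _ => P.dataLaw i)
        ≤ (α ^ 2 * σH ^ 2 / z.D + (1 + α * L) ^ 2) * ‖v‖ ^ 2 := by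
  have hinj : Function.Injective fun r : Fin z.D => (Sum.inr (Sum.inl (j, r)) : Slot N z) := by
    intro s t h
    simpa using h
  obtain ⟨hb1, hb2, hb3⟩ := hP.batchHess_moments i (innerSGD P α i x w j.castSucc) v hD hinj
  simp only [estFactor_merge_hessSlots_self, sub_apply, one_apply_eq_self, smul_apply]
  obtain ⟨h1, h2⟩ := integral_const_sub_smul hb1 hb2 v α
  refine ⟨h1, h2, (integral_norm_const_sub_smul_sq_le hb1 hb2 hb3 v α).trans ?_⟩
  have h3 : ‖v - α • hessian (taskLoss P i) (innerSGD P α i x w j.castSucc) v‖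
      ≤ (1 + α * L) * ‖v‖ :=
    (condFactor P α i x w j).le_of_opNorm_le (hP.norm_condFactor_le hL hα i x w j) v
  have h4 := pow_le_pow_left₀ (norm_nonneg _) h3 2
  calc _ ≤ ((1 + α * L) * ‖v‖) ^ 2 + α ^ 2 * (σH ^ 2 * ‖v‖ ^ 2 / z.D) := by gcongr
    _ = _ := by ring

theorem tailProd_merge_hessSlots (P : TaskFamily d I 𝒟) (α : ℝ) (i : I) (y x : Slot N z → 𝒟)
    (w : Param d) {k : ℕ} (hk : k < N) :
    tailProd (estFactor P α i (merge (hessSlots z ⟨k, hk⟩) y x) w) (k + 1)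
      = tailProd (estFactor P α i x w) (k + 1) :=
  tailProd_congr hk fun m hm => estFactor_merge_hessSlots P α i y x w fun h => by
    rw [← h] at hm; exact absurd hm (by simp)

/-- Second moment of the partial products of the meta gradient estimator. -/
theorem tailProd_sq (hP : Assumptions P L ρ σ σg σH) (hL : 0 < L) (hα : 0 < α)
    (hz : z.Pos) (i : I) (w : Param d) {j : ℕ} (hj : j ≤ N) :
    Integrable (fun x : Slot N z → 𝒟 =>
        ‖tailProd (estFactor P α i x w) j (outerGrad P α i x w)‖ ^ 2)
        (Measure.pi fun _ => P.dataLaw i) ∧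
    ∫ x : Slot N z → 𝒟, ‖tailProd (estFactor P α i x w) j (outerGrad P α i x w)‖ ^ 2
        ∂(Measure.pi fun _ => P.dataLaw i)
      ≤ (α ^ 2 * σH ^ 2 / z.D + (1 + α * L) ^ 2) ^ (N - j)
        * ∫ x : Slot N z → 𝒟, ‖outerGrad P α i x w‖ ^ 2 ∂(Measure.pi fun _ => P.dataLaw i) := by
  induction hj using Nat.decreasingInduction with
  | self => simpa [tailProd_self] using (hP.outerGrad_sq hL hα hz i w).1
  | of_succ k hk ih =>
    obtain ⟨ih1, ih2⟩ := ih
    -- Resampling the Hessian batch of the leftmost factor freezes all that stands to its right, so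
    -- each factor costs one power of the constant.
    have key := integrable_and_integral_le_of_merge (hessSlots z ⟨k, hk⟩)
      (fun _ : Slot N z => P.dataLaw i)
      (F := fun x => ‖tailProd (estFactor P α i x w) k (outerGrad P α i x w)‖ ^ 2)
      (G := fun x => (α ^ 2 * σH ^ 2 / z.D + (1 + α * L) ^ 2)
        * ‖tailProd (estFactor P α i x w) (k + 1) (outerGrad P α i x w)‖ ^ 2)
      ((hP.measurable_tailProd α i w hk.le).norm.pow_const 2) (fun x => by positivity)
      (ih1.const_mul _) (fun x => by
        simp only [tailProd_eq _ hk, mul_apply_eq_comp, tailProd_merge_hessSlots,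
          outerGrad_merge_hessSlots]
        obtain ⟨h1, -, h3⟩ := hP.estFactor_moments hL.le hα.le hz.2.1 i x w
          (tailProd (estFactor P α i x w) (k + 1) (outerGrad P α i x w)) ⟨k, hk⟩
        exact ⟨MemLp.integrable_norm_sq h1, h3⟩)
    refine ⟨key.1, key.2.trans ?_⟩
    rw [integral_const_mul, show N - k = (N - (k + 1)) + 1 by lia,
      pow_succ' (α ^ 2 * σH ^ 2 / z.D + (1 + α * L) ^ 2), mul_assoc]
    gcongr

theorem memLp_tailProd (hP : Assumptions P L ρ σ σg σH) (hL : 0 < L) (hα : 0 < α)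
    (hz : z.Pos) (i : I) (w : Param d) {j : ℕ} (hj : j ≤ N) :
    MemLp (fun x : Slot N z → 𝒟 => tailProd (estFactor P α i x w) j (outerGrad P α i x w)) 2
      (Measure.pi fun _ => P.dataLaw i) :=
  memLp_two_of_integrable_sq (hP.measurable_tailProd α i w hj).aestronglyMeasurable
    (hP.tailProd_sq hL hα hz i w hj).1

/-- Second moment of the meta gradient estimator of a fixed task. -/
theorem metaGradEst_sq (hP : Assumptions P L ρ σ σg σH) (hL : 0 < L) (hα : 0 < α)
    (hz : z.Pos) (i : I) (w : Param d) :
    MemLp (fun x : Slot N z → 𝒟 => metaGradEst P α i x w) 2 (Measure.pi fun _ => P.dataLaw i) ∧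
    ∫ x : Slot N z → 𝒟, ‖metaGradEst P α i x w‖ ^ 2 ∂(Measure.pi fun _ => P.dataLaw i)
      ≤ (α ^ 2 * σH ^ 2 / z.D + (1 + α * L) ^ 2) ^ N
        * (3 * (σg ^ 2 / z.T + ((1 + 2 * α * L + 2 * α ^ 2 * L ^ 2) ^ N - 1) * (α * L)
          * (1 + α * L)⁻¹ * σg ^ 2 / z.S
        + (1 + α * L) ^ (2 * N) * ‖gradient (taskLoss P i) w‖ ^ 2)) := by
  simp only [metaGradEst_eq]
  refine ⟨hP.memLp_tailProd hL hα hz i w (Nat.zero_le N), ?_⟩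
  refine (hP.tailProd_sq hL hα hz i w (Nat.zero_le N)).2.trans ?_
  rw [Nat.sub_zero]
  gcongr
  exact (hP.outerGrad_sq hL hα hz i w).2

/-- Hybrid argument: from left to right, one Hessian batch at a time is averaged out and its sampled
factor becomes the conditional mean. The factors already replaced depend on inner batches only and
stay fixed; they are bounded operators, so integrability passes from the tail. -/
theorem integral_headProd_tailProd (hP : Assumptions P L ρ σ σg σH) (hL : 0 < L) (hα : 0 < α)
    (hz : z.Pos) (i : I) (w : Param d) {j : ℕ} (hj : j ≤ N) :
    ∫ x : Slot N z → 𝒟, metaGradEst P α i x w ∂(Measure.pi fun _ => P.dataLaw i)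
      = ∫ x : Slot N z → 𝒟, headProd (condFactor P α i x w) j
          (tailProd (estFactor P α i x w) j (outerGrad P α i x w))
        ∂(Measure.pi fun _ => P.dataLaw i) := by
  induction j with
  | zero => simp only [headProd_zero, one_apply_eq_self, metaGradEst_eq]
  | succ k ih =>
    rw [ih (Nat.le_of_succ_le hj)]
    have hmem := hP.memLp_tailProd hL hα hz i w (Nat.le_of_succ_le hj)
    refine integral_eq_of_merge (hessSlots z ⟨k, hj⟩) (fun _ : Slot N z => P.dataLaw i) ?_
      fun x => ?_
    · exact (hmem.of_le_mul (hP.measurable_headProd α i w (Nat.le_of_succ_le hj)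
        (hP.measurable_tailProd α i w (Nat.le_of_succ_le hj))).aestronglyMeasurable
        (Filter.Eventually.of_forall fun x => norm_headProd_apply_le (by positivity)
          (fun m => hP.norm_condFactor_le hL.le hα.le i x w m) (Nat.le_of_succ_le hj) _)).integrable
        (by norm_num)
    · simp only [tailProd_eq _ (show k < N from hj), mul_apply_eq_comp, tailProd_merge_hessSlots,
        outerGrad_merge_hessSlots, condFactor_merge_hessSlots, headProd_succ _ hj]
      obtain ⟨h1, h2, -⟩ := hP.estFactor_moments hL.le hα.le hz.2.1 i x w
          (tailProd (estFactor P α i x w) (k + 1) (outerGrad P α i x w)) ⟨k, hj⟩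
      rw [ContinuousLinearMap.integral_comp_comm _ (h1.integrable (by norm_num)), h2]

/-- Once all Hessian factors are replaced, averaging the outer batch turns the last vector into the
exact gradient at w_N. The inner iterates are then the only randomness left. -/
theorem integral_metaGradEst_eq (hP : Assumptions P L ρ σ σg σH) (hL : 0 < L) (hα : 0 < α)
    (hz : z.Pos) (i : I) (w : Param d) :
    ∫ x : Slot N z → 𝒟, metaGradEst P α i x w ∂(Measure.pi fun _ => P.dataLaw i)
      = ∫ x : Slot N z → 𝒟, (List.ofFn (condFactor P α i x w)).prod
          (gradient (taskLoss P i) (innerSGD P α i x w (Fin.last N)))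
        ∂(Measure.pi fun _ => P.dataLaw i) := by
  rw [hP.integral_headProd_tailProd hL hα hz i w le_rfl]
  simp only [tailProd_self, one_apply_eq_self]
  have hmem : MemLp (fun x : Slot N z → 𝒟 => outerGrad P α i x w) 2
      (Measure.pi fun _ => P.dataLaw i) :=
    memLp_two_of_integrable_sq (hP.measurable_outerGrad α i w).aestronglyMeasurable
      (hP.outerGrad_sq hL hα hz i w).1
  refine integral_eq_of_merge (outerSlots N z) (fun _ : Slot N z => P.dataLaw i) ?_ fun x => ?_
  · exact (hmem.of_le_mul (hP.measurable_headProd α i w le_rfl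
      (hP.measurable_outerGrad α i w)).aestronglyMeasurable
      (Filter.Eventually.of_forall fun x => norm_headProd_apply_le (by positivity)
        (fun m => hP.norm_condFactor_le hL.le hα.le i x w m) le_rfl _)).integrable (by norm_num)
  · have hinj : Function.Injective fun t : Fin z.T => (Sum.inr (Sum.inr t) : Slot N z) := by
      intro s t h
      simpa using h
    obtain ⟨h1, h2, -⟩ := hP.batchGrad_moments i (innerSGD P α i x w (Fin.last N)) hz.2.2.1 hinj
    simp only [outerGrad_merge_outerSlots, condFactor_merge_outerSlots]
    rw [ContinuousLinearMap.integral_comp_comm _ (h1.integrable (by norm_num)), h2, headProd_self]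

/-- The perturbation bound evaluated with inner errors (a^j − 1)s/L, a = 1+αL. Bounding a^j − 1 by
a^j gives a geometric sum, and a^{N−1} is rounded up to a^N. -/
theorem bias_bound_aux {N : ℕ} {L ρ α n s eN : ℝ} {e : Fin N → ℝ} (hL : 0 < L) (hρ : 0 ≤ ρ)
    (hα : 0 ≤ α) (hn : 0 ≤ n) (hs : 0 ≤ s) (hN : L * eN ≤ ((1 + α * L) ^ N - 1) * s)
    (he : ∀ j : Fin N, L * e j ≤ ((1 + α * L) ^ (j : ℕ) - 1) * s) :
    (1 + α * L) ^ N * (L * eN)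
        + (1 + α * L) ^ (N - 1) * (∑ j : Fin N, α * ρ * e j) * ((1 + α * L) ^ N * n)
      ≤ (1 + α * L) ^ N * ((1 + α * L) ^ N - 1) * s
        + (1 + α * L) ^ (2 * N) * ((1 + α * L) ^ N - 1) * (ρ / L ^ 2) * n * s := by
  have h2 : ∑ j : Fin N, α * ρ * e j ≤ ρ / L ^ 2 * ((1 + α * L) ^ N - 1) * s := by
    have h3 : ∀ j : Fin N, α * ρ * e j ≤ α * ρ / L * ((1 + α * L) ^ (j : ℕ) * s) := fun j => by
      have h5 : L * e j ≤ (1 + α * L) ^ (j : ℕ) * s := by nlinarith [he j]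
      have h6 := mul_le_mul_of_nonneg_left h5 (show 0 ≤ α * ρ / L by positivity)
      refine le_trans (le_of_eq ?_) h6
      field_simp
    refine (Finset.sum_le_sum fun j _ => h3 j).trans (le_of_eq ?_)
    rw [← Finset.mul_sum, ← Finset.sum_mul, ← sum_fin_pow_mul (1 + α * L) N]
    field_simp
    ring
  have ha1 : 1 ≤ 1 + α * L := by nlinarith
  have hq1 : 1 ≤ (1 + α * L) ^ N := one_le_pow₀ ha1
  have hpow : (1 + α * L) ^ (N - 1) ≤ (1 + α * L) ^ N := pow_le_pow_right₀ ha1 (Nat.sub_le N 1)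
  have h8 : 0 ≤ ρ / L ^ 2 * ((1 + α * L) ^ N - 1) * s :=
    mul_nonneg (mul_nonneg (by positivity) (by linarith)) hs
  calc _ ≤ (1 + α * L) ^ N * (((1 + α * L) ^ N - 1) * s)
        + (1 + α * L) ^ N * (ρ / L ^ 2 * ((1 + α * L) ^ N - 1) * s) * ((1 + α * L) ^ N * n) := by
        refine add_le_add (mul_le_mul_of_nonneg_left hN (by linarith)) ?_
        refine mul_le_mul_of_nonneg_right ?_ (mul_nonneg (by linarith) hn)
        exact (mul_le_mul_of_nonneg_left h2 (pow_nonneg (by linarith) _)).trans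
          (mul_le_mul_of_nonneg_right hpow h8)
    _ = _ := by rw [two_mul, pow_add]; ring

/-- Bias of the meta gradient estimator of a fixed task. -/
theorem norm_integral_metaGradEst_sub_le (hP : Assumptions P L ρ σ σg σH) (hL : 0 < L)
    (hρ : 0 ≤ ρ) (hσg : 0 ≤ σg) (hα : 0 < α) (hz : z.Pos) (i : I) (w : Param d) :
    ‖∫ x : Slot N z → 𝒟, metaGradEst P α i x w ∂(Measure.pi fun _ => P.dataLaw i)
        - exactMetaGrad (taskLoss P i) α N w‖
      ≤ ((1 + α * L) ^ N * ((1 + α * L) ^ N - 1) * σg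
        + (1 + α * L) ^ (2 * N) * ((1 + α * L) ^ N - 1) * (ρ * σg / L ^ 2)
          * ‖gradient (taskLoss P i) w‖) / √z.S := by
  rw [hP.integral_metaGradEst_eq hL hα hz]
  set g := exactMetaGrad (taskLoss P i) α N w with hg
  set a := 1 + α * L with ha
  have ha1 : 1 ≤ a := by nlinarith
  set n := ‖gradient (taskLoss P i) w‖ with hn
  set s := σg / √z.S with hs
  have hs0 : 0 ≤ s := by positivity
  let E : Fin (N + 1) → (Slot N z → 𝒟) → ℝ := fun j x =>
    ‖innerSGD P α i x w j - gdIter (taskLoss P i) α j w‖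
  have hE : ∀ j, Integrable (E j) (Measure.pi fun _ => P.dataLaw i) := fun j =>
    hP.integrable_innerSGD_error hL hα hz.1 i w j
  have hEb : ∀ j, L * ∫ x, E j x ∂(Measure.pi fun _ => P.dataLaw i) ≤ (a ^ (j : ℕ) - 1) * s :=
    fun j => hP.innerSGD_error hL hα hσg hz.1 i w j
  have hb : Integrable (fun x => a ^ N * (L * E (Fin.last N) x)
      + a ^ (N - 1) * (∑ j : Fin N, α * ρ * E j.castSucc x) * (a ^ N * n))
      (Measure.pi fun _ : Slot N z => P.dataLaw i) :=
    (((hE _).const_mul L).const_mul _).add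
      (((integrable_finsetSum _ fun j _ => (hE _).const_mul _).const_mul _).mul_const _)
  have hle : ∀ x : Slot N z → 𝒟, ‖(List.ofFn (condFactor P α i x w)).prod
      (gradient (taskLoss P i) (innerSGD P α i x w (Fin.last N))) - g‖
      ≤ a ^ N * (L * E (Fin.last N) x)
        + a ^ (N - 1) * (∑ j : Fin N, α * ρ * E j.castSucc x) * (a ^ N * n) := fun x =>
    (hP.smoothLoss i).norm_prod_sub_exactMetaGrad_le hL.le hα.le
      (fun j => innerSGD P α i x w j) w
  have hF : Integrable (fun x : Slot N z → 𝒟 => (List.ofFn (condFactor P α i x w)).prod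
      (gradient (taskLoss P i) (innerSGD P α i x w (Fin.last N))) - g)
      (Measure.pi fun _ => P.dataLaw i) := by
    refine hb.mono' (Measurable.aestronglyMeasurable ?_) (Filter.Eventually.of_forall hle)
    exact (measurable_list_prod_apply (fun j u hu => hP.measurable_condFactor α i w j hu)
      ((hP.measurable_taskGrad_right i).comp (hP.measurable_innerSGD_right α i w _))).sub_const _
  have hF' : Integrable (fun x : Slot N z → 𝒟 => (List.ofFn (condFactor P α i x w)).prod
      (gradient (taskLoss P i) (innerSGD P α i x w (Fin.last N))))
      (Measure.pi fun _ => P.dataLaw i) := by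
    exact (hF.add (integrable_const g)).congr (Filter.Eventually.of_forall fun x => by simp)
  have h1 : ∫ x : Slot N z → 𝒟, (List.ofFn (condFactor P α i x w)).prod
      (gradient (taskLoss P i) (innerSGD P α i x w (Fin.last N)))
        ∂(Measure.pi fun _ => P.dataLaw i) - g
      = ∫ x : Slot N z → 𝒟, ((List.ofFn (condFactor P α i x w)).prod
      (gradient (taskLoss P i) (innerSGD P α i x w (Fin.last N))) - g)
        ∂(Measure.pi fun _ => P.dataLaw i) := by
    rw [integral_sub hF' (integrable_const _)]
    simp
  rw [h1]
  refine (norm_integral_le_of_norm_le hb (Filter.Eventually.of_forall hle)).trans ?_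
  rw [integral_add (((hE _).const_mul L).const_mul _)
      (((integrable_finsetSum _ fun j _ => (hE _).const_mul _).const_mul _).mul_const _),
    integral_const_mul, integral_const_mul, integral_mul_const, integral_const_mul,
    integral_finsetSum _ fun j _ => (hE _).const_mul _]
  simp only [integral_const_mul]
  have h7 := hEb (Fin.last N)
  rw [Fin.val_last] at h7
  refine (bias_bound_aux hL hρ hα.le (norm_nonneg _) hs0 h7 fun j => ?_).trans (le_of_eq ?_)
  · simpa using hEb j.castSucc
  · rw [hs]; ring

end Assumptions

end EstimatorMoments

/-! ### Integration over a two-stage draw. -/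

section CompProd

variable {A B : Type*} [MeasurableSpace A] [MeasurableSpace B] {μ : Measure A}
  [IsProbabilityMeasure μ] {κ : Kernel A B} [IsMarkovKernel κ]

theorem integrable_integral_compProd {E : Type*} [NormedAddCommGroup E] [NormedSpace ℝ E]
    {F : A × B → E} (hF : Integrable F (μ ⊗ₘ κ)) :
    Integrable (fun a => ∫ b, F (a, b) ∂(κ a)) μ :=
  Integrable.integral_compProd (κ := Kernel.const Unit μ) (η := Kernel.prodMkLeft Unit κ)
    (a := ()) hF

/-- Tonelli for a kernel. It is used for a task followed by its data, and for an iterate followed by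
a fresh seed. -/
theorem integrable_and_integral_le_of_compProd {F : A × B → ℝ} {G : A → ℝ} (hF : Measurable F)
    (hF0 : ∀ x, 0 ≤ F x) (hG : Integrable G μ)
    (h : ∀ a, Integrable (fun b => F (a, b)) (κ a) ∧ ∫ b, F (a, b) ∂(κ a) ≤ G a) :
    Integrable F (μ ⊗ₘ κ) ∧ ∫ x, F x ∂(μ ⊗ₘ κ) ≤ ∫ a, G a ∂μ := by
  have hsm : StronglyMeasurable F := hF.stronglyMeasurable
  have hint : Integrable F (μ ⊗ₘ κ) := by
    rw [Measure.integrable_compProd_iff hsm.aestronglyMeasurable]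
    refine ⟨Filter.Eventually.of_forall fun a => (h a).1, ?_⟩
    refine hG.mono' hsm.norm.integral_kernel_prod_right'.aestronglyMeasurable
      (Filter.Eventually.of_forall fun a => ?_)
    simp only [Real.norm_of_nonneg (hF0 _)]
    rw [Real.norm_of_nonneg (integral_nonneg fun y => hF0 _)]
    exact (h a).2
  refine ⟨hint, ?_⟩
  rw [Measure.integral_compProd hint]
  exact integral_mono (integrable_integral_compProd hint) hG fun a => (h a).2

end CompProd

/-! ### Moments of the estimator for random tasks. -/

section Draws

variable {d : ℕ} {I 𝒟 : Type*} [MeasurableSpace I] [MeasurableSpace 𝒟] {P : TaskFamily d I 𝒟}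
  {L ρ σ σg σH α : ℝ} {N : ℕ} {z : BatchSizes}

instance (κ : Kernel I 𝒟) [IsMarkovKernel κ] (ι : Type*) [Fintype ι] :
    IsMarkovKernel (iidKernel κ ι) :=
  ⟨fun i => inferInstanceAs (IsProbabilityMeasure (Measure.pi fun _ : ι => κ i))⟩

instance (P : TaskFamily d I 𝒟) (ι : Type*) [Fintype ι] : IsProbabilityMeasure (drawLaw P ι) :=
  inferInstanceAs (IsProbabilityMeasure (P.taskLaw ⊗ₘ iidKernel P.dataLaw ι))

instance (P : TaskFamily d I 𝒟) (N : ℕ) (z : BatchSizes) (k : ℕ) :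
    IsProbabilityMeasure (seedLaw P N z k) :=
  inferInstanceAs (IsProbabilityMeasure
    ((Measure.pi fun _ : Fin z.B => drawLaw P (Slot N z)).prod
      (Measure.pi fun b : Fin (z.B' k) => drawLaw P (Fin (z.DL k b)))))

/-- Bound for the bias of the meta gradient estimator, in terms of `x = ‖∇𝓛(w)‖`. -/
def biasBound (α L ρ σ σg : ℝ) (N : ℕ) (z : BatchSizes) (x : ℝ) : ℝ :=
  ((1 + α * L) ^ N * ((1 + α * L) ^ N - 1) * σg
    + (1 + α * L) ^ (2 * N) * ((1 + α * L) ^ N - 1) * (ρ * σg / L ^ 2)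
      * ((x + σ) / (2 - (1 + α * L) ^ (2 * N)))) / √z.S

/-- Bound for the second moment of the meta gradient estimator, in terms of `x = ‖∇𝓛(w)‖`. -/
def secondMomentBound (α L σ σg σH : ℝ) (N : ℕ) (z : BatchSizes) (x : ℝ) : ℝ :=
  Csqu1 α L σg σH N z / z.T + Csqu2 α L σg σH N z / z.S + Csqu3 α L σg σH N z * (x ^ 2 + σ ^ 2)

namespace Assumptions

theorem measurable_metaGradEst_left (hP : Assumptions P L ρ σ σg σH) (α : ℝ) (w : Param d) :
    Measurable fun y : I × (Slot N z → 𝒟) => metaGradEst P α y.1 y.2 w :=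
  (hP.measurable_metaGradEst (N := N) (z := z) α).comp
    (f := fun y : I × (Slot N z → 𝒟) => (y, w)) (by fun_prop)

/-- Second moment of the meta gradient estimator of a random task. -/
theorem drawLaw_metaGradEst_sq (hP : Assumptions P L ρ σ σg σH) (hL : 0 < L) (hσ : 0 ≤ σ)
    (hσg : 0 < σg) (hα : 0 < α) (hq : (1 + α * L) ^ (2 * N) < 2) (hz : z.Pos) (w : Param d) :
    MemLp (fun y : I × (Slot N z → 𝒟) => metaGradEst P α y.1 y.2 w) 2 (drawLaw P (Slot N z)) ∧
    ∫ y, ‖metaGradEst P α y.1 y.2 w‖ ^ 2 ∂(drawLaw P (Slot N z))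
      ≤ secondMomentBound α L σ σg σH N z ‖gradient (metaLoss P α N) w‖ := by
  have hgi := MemLp.integrable_norm_sq (hP.memLp_taskGrad w)
  have hm := hP.measurable_metaGradEst_left (N := N) (z := z) α w
  have key := integrable_and_integral_le_of_compProd (μ := P.taskLaw)
    (κ := iidKernel P.dataLaw (Slot N z))
    (F := fun y => ‖metaGradEst P α y.1 y.2 w‖ ^ 2)
    (hm.norm.pow_const 2) (fun y => by positivity)
    (((integrable_const _).add (hgi.const_mul ((1 + α * L) ^ (2 * N)))).const_mul 3 |>.const_mul
      ((α ^ 2 * σH ^ 2 / z.D + (1 + α * L) ^ 2) ^ N))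
    (fun i => ⟨MemLp.integrable_norm_sq (hP.metaGradEst_sq hL hα hz i w).1,
      (hP.metaGradEst_sq hL hα hz i w).2⟩)
  refine ⟨memLp_two_of_integrable_sq hm.aestronglyMeasurable key.1, key.2.trans ?_⟩
  simp only [Pi.add_apply]
  rw [integral_const_mul, integral_const_mul, integral_add (integrable_const _) (hgi.const_mul _),
    integral_const_mul]
  simp only [integral_const, probReal_univ, smul_eq_mul, one_mul]
  have h1 := hP.integral_norm_taskGrad_sq_le hL hσ hα.le hq w
  set y := ∫ i, ‖gradient (taskLoss P i) w‖ ^ 2 ∂P.taskLaw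
  set x := ‖gradient (metaLoss P α N) w‖
  have h2 : 0 < 2 - (1 + α * L) ^ (2 * N) := by linarith
  have h3 : y ≤ 2 * (x ^ 2 + σ ^ 2) / (2 - (1 + α * L) ^ (2 * N)) ^ 2 := by
    rw [le_div_iff₀ (by positivity)]
    linarith
  calc _ ≤ (α ^ 2 * σH ^ 2 / z.D + (1 + α * L) ^ 2) ^ N
        * (3 * (σg ^ 2 / z.T + ((1 + 2 * α * L + 2 * α ^ 2 * L ^ 2) ^ N - 1) * (α * L)
          * (1 + α * L)⁻¹ * σg ^ 2 / z.S
        + (1 + α * L) ^ (2 * N) * (2 * (x ^ 2 + σ ^ 2) / (2 - (1 + α * L) ^ (2 * N)) ^ 2))) := by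
        gcongr
    _ = _ := by
        -- `Csqu3` divides by the σ_g² contained in `Csqu1`; the cancellation needs σ_g ≠ 0.
        simp only [secondMomentBound, Csqu1, Csqu2, Csqu3]
        field_simp

/-- Bias of the meta gradient estimator of a random task. -/
theorem drawLaw_metaGradEst_bias (hP : Assumptions P L ρ σ σg σH) (hL : 0 < L) (hρ : 0 ≤ ρ)
    (hσ : 0 ≤ σ) (hσg : 0 < σg) (hα : 0 < α) (hq : (1 + α * L) ^ (2 * N) < 2) (hz : z.Pos)
    (w : Param d) :
    ‖∫ y, metaGradEst P α y.1 y.2 w ∂(drawLaw P (Slot N z)) - gradient (metaLoss P α N) w‖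
      ≤ biasBound α L ρ σ σg N z ‖gradient (metaLoss P α N) w‖ := by
  have hi := (hP.drawLaw_metaGradEst_sq hL hσ hσg hα hq hz w).1.integrable (by norm_num)
  have hgi := (hP.integrable_taskGrad w).norm
  have hei := hP.integrable_exactMetaGrad hL.le hα.le N w
  have hi' : Integrable (fun i => ∫ x, metaGradEst P α i x w
      ∂(Measure.pi fun _ : Slot N z => P.dataLaw i)) P.taskLaw := integrable_integral_compProd hi
  have h0 : ∫ y, metaGradEst P α y.1 y.2 w ∂(drawLaw P (Slot N z))
      = ∫ i, ∫ x, metaGradEst P α i x w ∂(Measure.pi fun _ : Slot N z => P.dataLaw i)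
        ∂P.taskLaw := Measure.integral_compProd hi
  rw [h0, hP.gradient_metaLoss hL hα.le, ← integral_sub hi' hei,
    ← hP.gradient_metaLoss hL hα.le]
  have hb : Integrable (fun i => ((1 + α * L) ^ N * ((1 + α * L) ^ N - 1) * σg
        + (1 + α * L) ^ (2 * N) * ((1 + α * L) ^ N - 1) * (ρ * σg / L ^ 2)
          * ‖gradient (taskLoss P i) w‖) / √z.S) P.taskLaw :=
    ((integrable_const _).add (hgi.const_mul _)).div_const _
  refine (norm_integral_le_of_norm_le hb (Filter.Eventually.of_forall fun i =>
    hP.norm_integral_metaGradEst_sub_le hL hρ hσg.le hα hz i w)).trans ?_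
  rw [integral_div, integral_add (integrable_const _) (hgi.const_mul _)]
  simp only [integral_const_mul, integral_const, probReal_univ, smul_eq_mul, one_mul]
  have h1 : meanGradNorm P w ≤ (‖gradient (metaLoss P α N) w‖ + σ)
      / (2 - (1 + α * L) ^ (2 * N)) := by
    rw [le_div_iff₀ (by linarith), mul_comm]
    exact hP.meanGradNorm_le hL hσ hα.le hq w
  have hq1 : 0 ≤ (1 + α * L) ^ N - 1 := sub_nonneg.2 (one_le_pow₀ (by nlinarith))
  rw [biasBound]
  gcongr
  exact h1

/-- Mean and variance of the average of the meta gradient estimators over `B` tasks. -/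
theorem meanMetaGrad_moments (hP : Assumptions P L ρ σ σg σH) (hL : 0 < L) (hρ : 0 ≤ ρ)
    (hσ : 0 ≤ σ) (hσg : 0 < σg) (hα : 0 < α) (hq : (1 + α * L) ^ (2 * N) < 2) (hz : z.Pos)
    (w : Param d) :
    MemLp (fun s : Fin z.B → I × (Slot N z → 𝒟) =>
        (z.B : ℝ)⁻¹ • ∑ b, metaGradEst P α (s b).1 (s b).2 w) 2
        (Measure.pi fun _ => drawLaw P (Slot N z)) ∧
    ‖∫ s : Fin z.B → I × (Slot N z → 𝒟), (z.B : ℝ)⁻¹ • ∑ b, metaGradEst P α (s b).1 (s b).2 w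
        ∂(Measure.pi fun _ => drawLaw P (Slot N z)) - gradient (metaLoss P α N) w‖
      ≤ biasBound α L ρ σ σg N z ‖gradient (metaLoss P α N) w‖ ∧
    ∫ s : Fin z.B → I × (Slot N z → 𝒟),
        ‖(z.B : ℝ)⁻¹ • ∑ b, metaGradEst P α (s b).1 (s b).2 w‖ ^ 2
        ∂(Measure.pi fun _ => drawLaw P (Slot N z))
      ≤ 2 * ‖gradient (metaLoss P α N) w‖ ^ 2
        + 2 * biasBound α L ρ σ σg N z ‖gradient (metaLoss P α N) w‖ ^ 2
        + secondMomentBound α L σ σg σH N z ‖gradient (metaLoss P α N) w‖ / z.B := by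
  obtain ⟨h1, h2⟩ := hP.drawLaw_metaGradEst_sq hL hσ hσg hα hq hz w
  have h3 := hP.drawLaw_metaGradEst_bias hL hρ hσ hσg hα hq hz w
  set m := ∫ y, metaGradEst P α y.1 y.2 w ∂(drawLaw P (Slot N z)) with hm
  have h4 := integral_norm_sq_eq_add h1
  have h5 : ∫ y, ‖metaGradEst P α y.1 y.2 w - m‖ ^ 2 ∂(drawLaw P (Slot N z))
      ≤ secondMomentBound α L σ σg σH N z ‖gradient (metaLoss P α N) w‖ := by
    rw [← hm] at h4
    nlinarith [sq_nonneg ‖m‖]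
  obtain ⟨k1, k2, k3⟩ := batch_mean (fun _ : Fin z.B => drawLaw P (Slot N z)) hz.2.2.2
    Function.injective_id (fun _ y => metaGradEst P α y.1 y.2 w)
    (fun _ => hP.measurable_metaGradEst_left α w) (fun _ => h1) (fun _ => hm.symm) (fun _ => h5)
  simp only [id] at k1 k2 k3
  refine ⟨k1, by rw [k2]; exact h3, ?_⟩
  -- The squared mean is at most (x + bias)² ≤ 2x² + 2 bias², and the variance of the average is at
  -- most the second moment of one draw divided by B.
  rw [integral_norm_sq_eq_add k1, k2]
  have h6 : ‖m‖ ≤ ‖gradient (metaLoss P α N) w‖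
      + biasBound α L ρ σ σg N z ‖gradient (metaLoss P α N) w‖ := by
    have := norm_sub_norm_le m (gradient (metaLoss P α N) w)
    linarith
  have h7 := pow_le_pow_left₀ (norm_nonneg _) h6 2
  nlinarith [sq_nonneg (‖gradient (metaLoss P α N) w‖
      - biasBound α L ρ σ σg N z ‖gradient (metaLoss P α N) w‖)]

end Assumptions

end Draws

/-! ### Moments of the inverse of a concentrated variable. -/

section InverseMoments

variable {Ω : Type*} [MeasurableSpace Ω] {μ : Measure Ω} [IsProbabilityMeasure μ]

/-- First and second moments of the inverse of a random variable concentrated around `ℓ`. -/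
theorem inv_moments {X : Ω → ℝ} {c ℓ : ℝ} (hX : MemLp X 2 μ) (hXm : Measurable X) (hc : 0 < c)
    (hXc : ∀ ω, c ≤ X ω) (hℓ : c ≤ ℓ) (h1 : ∫ ω, X ω ∂μ ≤ 9 / 8 * ℓ)
    (h2 : ∫ ω, (X ω - ℓ) ^ 2 ∂μ ≤ c ^ 2) :
    Integrable (fun ω => (X ω)⁻¹) μ ∧ Integrable (fun ω => ((X ω)⁻¹) ^ 2) μ ∧
      8 / 9 ≤ ℓ * ∫ ω, (X ω)⁻¹ ∂μ ∧ ℓ * ∫ ω, (X ω)⁻¹ ∂μ ≤ 5 / 2 ∧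
      ℓ ^ 2 * ∫ ω, ((X ω)⁻¹) ^ 2 ∂μ ≤ 4 := by
  have hℓ0 : 0 < ℓ := hc.trans_le hℓ
  have hX0 : ∀ ω, 0 < X ω := fun ω => hc.trans_le (hXc ω)
  have hb : ∀ ω, ‖(X ω)⁻¹‖ ≤ c⁻¹ := fun ω => by
    rw [norm_inv, Real.norm_of_nonneg (hX0 ω).le]
    exact inv_anti₀ hc (hXc ω)
  have hi1 : Integrable (fun ω => (X ω)⁻¹) μ :=
    Integrable.of_bound hXm.inv.aestronglyMeasurable c⁻¹ (Filter.Eventually.of_forall hb)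
  have hi2 : Integrable (fun ω => ((X ω)⁻¹) ^ 2) μ :=
    Integrable.of_bound (hXm.inv.pow_const 2).aestronglyMeasurable (c⁻¹ ^ 2)
      (Filter.Eventually.of_forall fun ω => by
        rw [norm_pow]
        exact pow_le_pow_left₀ (norm_nonneg _) (hb ω) 2)
  have hXi : Integrable X μ := hX.integrable (by norm_num)
  have hdi : Integrable (fun ω => (X ω - ℓ) ^ 2) μ := by
    simpa using MemLp.integrable_norm_sq (hX.sub (memLp_const ℓ))
  have hsq : ℓ ^ 2 * ∫ ω, ((X ω)⁻¹) ^ 2 ∂μ ≤ 4 := by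
    rw [← integral_const_mul]
    have : ∫ ω, ℓ ^ 2 * ((X ω)⁻¹) ^ 2 ∂μ ≤ ∫ ω, (2 + 2 / c ^ 2 * (X ω - ℓ) ^ 2) ∂μ := by
      refine integral_mono (hi2.const_mul _) ((integrable_const _).add (hdi.const_mul _))
        fun ω => ?_
      -- Since X ≥ c, this gives (ℓ/X)² ≤ 2 + 2(X−ℓ)²/c², whose mean is at most 4.
      have h3 : ℓ * (X ω)⁻¹ = 1 + (ℓ - X ω) * (X ω)⁻¹ := by
        have := (hX0 ω).ne'
        field_simp
        ring
      have h4 : ((ℓ - X ω) * (X ω)⁻¹) ^ 2 ≤ (X ω - ℓ) ^ 2 / c ^ 2 := by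
        rw [mul_pow, inv_pow, ← div_eq_mul_inv, ← neg_sub (X ω) ℓ, neg_sq]
        gcongr
        exact hXc ω
      calc ℓ ^ 2 * ((X ω)⁻¹) ^ 2 = (1 + (ℓ - X ω) * (X ω)⁻¹) ^ 2 := by rw [← h3]; ring
        _ ≤ 2 + 2 * ((ℓ - X ω) * (X ω)⁻¹) ^ 2 := by
          nlinarith [sq_nonneg (1 - (ℓ - X ω) * (X ω)⁻¹)]
        _ ≤ 2 + 2 * ((X ω - ℓ) ^ 2 / c ^ 2) := by linarith
        _ = _ := by ring
    rw [integral_add (integrable_const _) (hdi.const_mul _)] at this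
    simp only [integral_const_mul, integral_const, probReal_univ, smul_eq_mul, one_mul] at this
    have h5 : 2 / c ^ 2 * ∫ ω, (X ω - ℓ) ^ 2 ∂μ ≤ 2 / c ^ 2 * c ^ 2 := by gcongr
    rw [div_mul_cancel₀ _ (by positivity)] at h5
    rw [integral_const_mul]
    linarith
  refine ⟨hi1, hi2, ?_, ?_, hsq⟩
  -- The convex function 1/X lies above its tangent 2/t − X/t² at t. As E X ≤ t, it follows that
  -- E[1/X] ≥ 1/t.
  · set t := 9 / 8 * ℓ with ht
    have ht0 : 0 < t := by positivity
    have h3 : ∫ ω, (2 / t - X ω / t ^ 2) ∂μ ≤ ∫ ω, (X ω)⁻¹ ∂μ := by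
      refine integral_mono ((integrable_const _).sub (hXi.div_const _)) hi1 fun ω => ?_
      have h0 := hX0 ω
      have h4 : (X ω)⁻¹ - (2 / t - X ω / t ^ 2) = (X ω)⁻¹ * ((X ω / t - 1) ^ 2) := by
        field_simp
        ring
      have h5 : 0 ≤ (X ω)⁻¹ * ((X ω / t - 1) ^ 2) := by positivity
      change 2 / t - X ω / t ^ 2 ≤ (X ω)⁻¹
      linarith
    rw [integral_sub (integrable_const _) (hXi.div_const _)] at h3
    simp only [integral_div, integral_const, probReal_univ, smul_eq_mul, one_mul] at h3
    have h6 : (∫ ω, X ω ∂μ) / t ^ 2 ≤ t / t ^ 2 := by gcongr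
    have h7 : 2 / t - t / t ^ 2 = t⁻¹ := by field_simp; ring
    have h8 : t⁻¹ ≤ ∫ ω, (X ω)⁻¹ ∂μ := by linarith
    have h9 := mul_le_mul_of_nonneg_left h8 hℓ0.le
    have h10 : ℓ * t⁻¹ = 8 / 9 := by rw [ht]; field_simp
    linarith
  -- ℓ/X ≤ 1/2 + (ℓ/X)²/2, so the second-moment bound 4 gives 1/2 + 2.
  · have h3 : ∫ ω, ℓ * (X ω)⁻¹ ∂μ ≤ ∫ ω, (1 / 2 + ℓ ^ 2 / 2 * ((X ω)⁻¹) ^ 2) ∂μ :=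
      integral_mono (hi1.const_mul _) ((integrable_const _).add (hi2.const_mul _)) fun ω => by
        nlinarith [sq_nonneg (ℓ * (X ω)⁻¹ - 1)]
    rw [integral_add (integrable_const _) (hi2.const_mul _), integral_const_mul,
      integral_const_mul] at h3
    simp only [integral_const, probReal_univ, smul_eq_mul, one_mul] at h3
    linarith

end InverseMoments

theorem CL_pos {α L ρ : ℝ} (hα : 0 < α) (hL : 0 < L) (hρ : 0 < ρ) {N : ℕ} (hN : 1 ≤ N) :
    0 < CL α L ρ N := by
  rw [CL_eq hL.ne' ρ hN]
  have h : 1 < (1 + α * L) ^ N := one_lt_pow₀ (by nlinarith [mul_pos hα hL]) (by lia)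
  have h' : 0 < (1 + α * L) ^ N - 1 := by linarith
  positivity

/-! ### Concentration of the sampled smoothness estimate. -/

section SmoothnessEstimate

variable {d : ℕ} {I 𝒟 : Type*} [MeasurableSpace I] [MeasurableSpace 𝒟] {P : TaskFamily d I 𝒟}
  {L ρ σ σg σH α : ℝ} {N : ℕ} {z : BatchSizes}

theorem measurePreserving_fst_drawLaw (P : TaskFamily d I 𝒟) (ι : Type*) [Fintype ι] :
    MeasurePreserving Prod.fst (drawLaw P ι) P.taskLaw :=
  ⟨measurable_fst, Measure.fst_compProd _ _⟩

namespace Assumptions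

theorem drawLaw_taskGrad_norm (hP : Assumptions P L ρ σ σg σH) (ι : Type*) [Fintype ι]
    (w : Param d) :
    MemLp (fun y : I × (ι → 𝒟) => ‖gradient (taskLoss P y.1) w‖) 2 (drawLaw P ι) ∧
      ∫ y : I × (ι → 𝒟), ‖gradient (taskLoss P y.1) w‖ ∂(drawLaw P ι) = meanGradNorm P w ∧
      ∫ y : I × (ι → 𝒟), ‖‖gradient (taskLoss P y.1) w‖ - meanGradNorm P w‖ ^ 2 ∂(drawLaw P ι)
        ≤ σ ^ 2 := by
  have hmp := measurePreserving_fst_drawLaw P ι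
  have hm := (hP.measurable_taskGrad_left w).norm
  refine ⟨(hP.memLp_taskGrad w).norm.comp_measurePreserving hmp, ?_, ?_⟩
  · rw [meanGradNorm, ← hmp.map_eq, integral_map hmp.measurable.aemeasurable
      hm.aestronglyMeasurable]
  · refine le_trans (le_of_eq ?_) (hP.integral_norm_taskGrad_dev_le w)
    conv_rhs => rw [← hmp.map_eq]
    rw [integral_map hmp.measurable.aemeasurable
      ((hm.sub_const _).norm.pow_const 2).aestronglyMeasurable]

theorem drawLaw_batchGrad_noise (hP : Assumptions P L ρ σ σg σH) {n : ℕ} (hn : 1 ≤ n)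
    (w : Param d) :
    Integrable (fun y : I × (Fin n → 𝒟) =>
        ‖batchGrad P y.1 y.2 w - gradient (taskLoss P y.1) w‖ ^ 2) (drawLaw P (Fin n)) ∧
      ∫ y : I × (Fin n → 𝒟), ‖batchGrad P y.1 y.2 w - gradient (taskLoss P y.1) w‖ ^ 2
        ∂(drawLaw P (Fin n)) ≤ σg ^ 2 / n := by
  have key := integrable_and_integral_le_of_compProd (μ := P.taskLaw)
    (κ := iidKernel P.dataLaw (Fin n))
    (F := fun y => ‖batchGrad P y.1 y.2 w - gradient (taskLoss P y.1) w‖ ^ 2)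
    (G := fun _ => σg ^ 2 / n)
    (((hP.measurable_batchGrad_comp measurable_fst measurable_snd measurable_const).sub
      ((hP.measurable_taskGrad_left w).comp measurable_fst)).norm.pow_const 2)
    (fun y => by positivity) (integrable_const _) (fun i => by
      obtain ⟨h1, -, h3⟩ := hP.batchGrad_moments i w hn Function.injective_id
      exact ⟨MemLp.integrable_norm_sq (h1.sub (memLp_const (gradient (taskLoss P i) w))), h3⟩)
  refine ⟨key.1, key.2.trans ?_⟩
  simp

end Assumptions

/-- The smoothness constant of the meta objective at `w`. -/
def smoothConst (P : TaskFamily d I 𝒟) (α L ρ : ℝ) (N : ℕ) (w : Param d) : ℝ :=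
  (1 + α * L) ^ (2 * N) * L + CL α L ρ N * meanGradNorm P w

/-- The smoothness estimate as a function of the second half of a seed. -/
def smoothEstAux (P : TaskFamily d I 𝒟) (α L ρ : ℝ) (N : ℕ) {m : ℕ} {n : Fin m → ℕ} (w : Param d)
    (s : ∀ b : Fin m, I × (Fin (n b) → 𝒟)) : ℝ :=
  (1 + α * L) ^ (2 * N) * L
    + CL α L ρ N * (∑ b, ‖batchGrad P (s b).1 (s b).2 w‖) / (m : ℝ)

theorem sq_average_le {m : ℕ} (hm : 1 ≤ m) (f : Fin m → ℝ) :
    ((m : ℝ)⁻¹ * ∑ b, f b) ^ 2 ≤ (m : ℝ)⁻¹ * ∑ b, f b ^ 2 := by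
  have hm0 : (0 : ℝ) < m := by exact_mod_cast hm
  have := sq_sum_le_card_mul_sum_sq (s := Finset.univ) (f := f)
  simp only [Finset.card_univ, Fintype.card_fin] at this
  rw [mul_pow]
  calc _ ≤ ((m : ℝ)⁻¹) ^ 2 * (m * ∑ b, f b ^ 2) := by gcongr
    _ = _ := by field_simp

namespace Assumptions

/-- The estimate has two sources of error: sampling tasks, measured by the average `A` of exact
gradient norms, and sampling data, measured by the average noise `Q`, with |Z − A| ≤ Q. The first
part of (1) bounds the variance of `A`, the second the mean square of `Q`; the outcome is what
`inv_moments` requires. -/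
theorem smoothEstAux_moments (hP : Assumptions P L ρ σ σg σH) (hL : 0 < L) (hρ : 0 < ρ)
    (hσg : 0 < σg) (hα : 0 < α) (hN : 1 ≤ N) {m : ℕ} {n : Fin m → ℕ}
    (hm : 4 * CL α L ρ N ^ 2 * σ ^ 2 / (3 * (1 + α * L) ^ (4 * N) * L ^ 2) < (m : ℝ))
    (hn : ∀ b, 64 * σg ^ 2 * CL α L ρ N ^ 2 / ((1 + α * L) ^ (4 * N) * L ^ 2) < (n b : ℝ))
    (w : Param d) :
    MemLp (smoothEstAux P α L ρ N (n := n) w) 2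
        (Measure.pi fun b : Fin m => drawLaw P (Fin (n b))) ∧
      Measurable (smoothEstAux P α L ρ N (n := n) w) ∧
      ∫ s, smoothEstAux P α L ρ N (n := n) w s
        ∂(Measure.pi fun b : Fin m => drawLaw P (Fin (n b))) ≤ 9 / 8 * smoothConst P α L ρ N w ∧
      ∫ s, (smoothEstAux P α L ρ N (n := n) w s - smoothConst P α L ρ N w) ^ 2
        ∂(Measure.pi fun b : Fin m => drawLaw P (Fin (n b)))
        ≤ ((1 + α * L) ^ (2 * N) * L) ^ 2 := by
  set c := (1 + α * L) ^ (2 * N) * L with hc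
  have hc2 : (1 + α * L) ^ (4 * N) * L ^ 2 = c ^ 2 := by
    rw [hc, mul_pow, ← pow_mul]; congr 2; ring
  have hc0 : 0 < c := by positivity
  have hC := CL_pos hα hL hρ hN
  set C := CL α L ρ N with hCdef
  set π := Measure.pi fun b : Fin m => drawLaw P (Fin (n b)) with hπ
  rw [mul_assoc 3, hc2] at hm
  simp only [hc2] at hn
  have hm0 : (0 : ℝ) < m := lt_of_le_of_lt (by positivity) hm
  have hm1 : 1 ≤ m := by exact_mod_cast hm0
  have hn0 : ∀ b, (0 : ℝ) < n b := fun b => lt_of_le_of_lt (by positivity) (hn b)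
  have hn1 : ∀ b, 1 ≤ n b := fun b => by exact_mod_cast hn0 b
  set μ0 := meanGradNorm P w with hμ0
  -- The bound on |D_L| in (1) says exactly that σ_g²/|D_L| < v0. Hence C·E Q ≤ c/8, which accounts
  -- for the factor 9/8.
  set v0 := (c / (8 * C)) ^ 2 with hv0
  obtain ⟨a1, a2, a3⟩ := batch_mean (fun b : Fin m => drawLaw P (Fin (n b))) hm1
    Function.injective_id (fun b y => ‖gradient (taskLoss P y.1) w‖)
    (fun b => ((hP.measurable_taskGrad_left w).comp measurable_fst).norm)
    (fun b => (hP.drawLaw_taskGrad_norm _ w).1) (fun b => (hP.drawLaw_taskGrad_norm _ w).2.1)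
    (fun b => (hP.drawLaw_taskGrad_norm _ w).2.2)
  simp only [id, smul_eq_mul] at a1 a2 a3
  rw [← hπ] at a1 a2 a3
  rw [← hμ0] at a2 a3
  let A : (∀ b : Fin m, I × (Fin (n b) → 𝒟)) → ℝ := fun s =>
    (m : ℝ)⁻¹ * ∑ b, ‖gradient (taskLoss P (s b).1) w‖
  let nz : ∀ b : Fin m, I × (Fin (n b) → 𝒟) → ℝ := fun b y =>
    ‖batchGrad P y.1 y.2 w - gradient (taskLoss P y.1) w‖
  let Q : (∀ b : Fin m, I × (Fin (n b) → 𝒟)) → ℝ := fun s => (m : ℝ)⁻¹ * ∑ b, nz b (s b)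
  let Z : (∀ b : Fin m, I × (Fin (n b) → 𝒟)) → ℝ := fun s =>
    (m : ℝ)⁻¹ * ∑ b, ‖batchGrad P (s b).1 (s b).2 w‖
  have hnzm : ∀ b, Measurable (nz b) := fun b =>
    ((hP.measurable_batchGrad_comp measurable_fst measurable_snd measurable_const).sub
      ((hP.measurable_taskGrad_left w).comp measurable_fst)).norm
  have hQm : Measurable Q :=
    (Finset.measurable_sum _ fun b _ => (hnzm b).comp (measurable_pi_apply b)).const_mul _
  have hZm : Measurable Z :=
    (Finset.measurable_sum _ fun b _ => (hP.measurable_batchGrad_comp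
      (i := fun s : ∀ b : Fin m, I × (Fin (n b) → 𝒟) => (s b).1)
      (x := fun s => (s b).2) (by fun_prop) (by fun_prop) measurable_const).norm).const_mul _
  have hmp : ∀ b, MeasurePreserving (fun s : ∀ b : Fin m, I × (Fin (n b) → 𝒟) => s b) π
      (drawLaw P (Fin (n b))) := fun b => measurePreserving_eval _ b
  have hnzi : ∀ b, Integrable (fun s : ∀ b : Fin m, I × (Fin (n b) → 𝒟) => nz b (s b) ^ 2) π :=
    fun b => (hmp b).integrable_comp_of_integrable (hP.drawLaw_batchGrad_noise (hn1 b) w).1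
  have hnzb : ∀ b, ∫ s : ∀ b : Fin m, I × (Fin (n b) → 𝒟), nz b (s b) ^ 2 ∂π ≤ v0 := fun b => by
    have h1 : ∫ s : ∀ b : Fin m, I × (Fin (n b) → 𝒟), nz b (s b) ^ 2 ∂π
        = ∫ y, nz b y ^ 2 ∂(drawLaw P (Fin (n b))) := by
      rw [← (hmp b).map_eq, integral_map (hmp b).measurable.aemeasurable
        ((hnzm b).pow_const 2).aestronglyMeasurable]
    rw [h1]
    refine (hP.drawLaw_batchGrad_noise (hn1 b) w).2.trans ?_
    have h2 := hn b
    rw [div_lt_iff₀ (by positivity)] at h2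
    rw [hv0, div_pow, div_le_div_iff₀ (hn0 b) (by positivity)]
    nlinarith
  have hQ2 : Integrable (fun s => Q s ^ 2) π ∧ ∫ s, Q s ^ 2 ∂π ≤ v0 := by
    have hi : Integrable (fun s : ∀ b : Fin m, I × (Fin (n b) → 𝒟) =>
        (m : ℝ)⁻¹ * ∑ b, nz b (s b) ^ 2) π :=
      (integrable_finsetSum _ fun b _ => hnzi b).const_mul _
    have hQi : Integrable (fun s => Q s ^ 2) π :=
      hi.mono' (hQm.pow_const 2).aestronglyMeasurable (Filter.Eventually.of_forall fun s => by
        rw [Real.norm_of_nonneg (sq_nonneg _)]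
        exact sq_average_le hm1 _)
    refine ⟨hQi, (integral_mono hQi hi fun s => sq_average_le hm1 _).trans ?_⟩
    rw [integral_const_mul, integral_finsetSum _ fun b _ => hnzi b]
    calc _ ≤ (m : ℝ)⁻¹ * ∑ _b : Fin m, v0 := by
          gcongr with b
          exact hnzb b
      _ = v0 := by
          rw [Finset.sum_const, Finset.card_univ, Fintype.card_fin, nsmul_eq_mul]
          field_simp
  have hQL : MemLp Q 2 π := (memLp_two_iff_integrable_sq hQm.aestronglyMeasurable).2 hQ2.1
  have hZA : ∀ s, |Z s - A s| ≤ Q s := fun s => by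
    rw [← mul_sub, ← Finset.sum_sub_distrib, abs_mul, abs_of_pos (inv_pos.2 hm0)]
    refine mul_le_mul_of_nonneg_left ?_ (inv_pos.2 hm0).le
    exact (Finset.abs_sum_le_sum_abs _ _).trans
      (Finset.sum_le_sum fun b _ => abs_norm_sub_norm_le _ _)
  have hAL : MemLp A 2 π := a1
  have hZL : MemLp Z 2 π := by
    refine (hAL.norm.add hQL).mono hZm.aestronglyMeasurable
      (Filter.Eventually.of_forall fun s => ?_)
    have h1 := hZA s
    have h2 : |Z s| ≤ |A s| + Q s := by
      have := abs_sub_abs_le_abs_sub (Z s) (A s)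
      linarith
    refine (h2.trans (le_abs_self _))
  have hest : ∀ s, smoothEstAux P α L ρ N (n := n) w s = c + C * Z s := fun s => by
    simp only [smoothEstAux, Z]
    rw [← hCdef, ← hc]
    ring
  have hsc : smoothConst P α L ρ N w = c + C * μ0 := rfl
  have hestf : smoothEstAux P α L ρ N (n := n) w = fun s => c + C * Z s := funext hest
  refine ⟨?_, ?_, ?_, ?_⟩
  · rw [hestf]
    exact (memLp_const c).add (hZL.const_mul C)
  · rw [hestf]
    exact (hZm.const_mul C).const_add c
  · rw [hsc]
    simp only [hest]
    rw [integral_add (integrable_const _) ((hZL.integrable (by norm_num)).const_mul C)]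
    simp only [integral_const_mul, integral_const, probReal_univ, smul_eq_mul, one_mul]
    have h1 : ∫ s, Z s ∂π ≤ ∫ s, (A s + Q s) ∂π :=
      integral_mono (hZL.integrable (by norm_num))
        ((hAL.integrable (by norm_num)).add (hQL.integrable (by norm_num))) fun s => by
          have := (abs_le.1 (hZA s)).2
          linarith
    rw [integral_add (hAL.integrable (by norm_num)) (hQL.integrable (by norm_num))] at h1
    have h2 : ∫ s, A s ∂π = μ0 := a2
    have h3 : ∫ s, Q s ∂π ≤ c / (8 * C) := by
      have := integral_le_sqrt_of_sq hQL hQ2.2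
      rwa [hv0, Real.sqrt_sq (by positivity)] at this
    have h4 : C * (c / (8 * C)) = c / 8 := by field_simp
    have h5 : C * ∫ s, Z s ∂π ≤ C * (μ0 + c / (8 * C)) := by
      gcongr
      linarith
    have h6 : 0 ≤ C * μ0 := mul_nonneg hC.le (meanGradNorm_nonneg P w)
    nlinarith
  · rw [hsc]
    have h1 : ∀ s, (smoothEstAux P α L ρ N (n := n) w s - (c + C * μ0)) ^ 2
        = C ^ 2 * (Z s - μ0) ^ 2 := fun s => by rw [hest]; ring
    simp only [h1]
    rw [integral_const_mul]
    have hAd : Integrable (fun s => (A s - μ0) ^ 2) π := by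
      simpa using MemLp.integrable_norm_sq (hAL.sub (memLp_const μ0))
    have hZd : Integrable (fun s => (Z s - μ0) ^ 2) π := by
      simpa using MemLp.integrable_norm_sq (hZL.sub (memLp_const μ0))
    -- Young's inequality with weights 1 + 1/6 and 1 + 6. With C²σ²/m ≤ (3/4)c² and C²v0 = c²/64 the
    -- total is (7/8 + 7/64)c² = (63/64)c².
    have h2 : ∫ s, (Z s - μ0) ^ 2 ∂π ≤ ∫ s, (7 / 6 * (A s - μ0) ^ 2 + 7 * Q s ^ 2) ∂π :=
      integral_mono hZd ((hAd.const_mul _).add (hQ2.1.const_mul _)) fun s => by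
        have h3 := hZA s
        have h4 : (Z s - A s) ^ 2 ≤ Q s ^ 2 := by
          rw [← sq_abs]
          exact pow_le_pow_left₀ (abs_nonneg _) h3 2
        nlinarith [sq_nonneg ((A s - μ0) - 6 * (Z s - A s))]
    rw [integral_add (hAd.const_mul _) (hQ2.1.const_mul _), integral_const_mul,
      integral_const_mul] at h2
    have h5 : ∫ s, (A s - μ0) ^ 2 ∂π ≤ σ ^ 2 / m := by
      simpa using a3
    have h6 : C ^ 2 * (σ ^ 2 / m) ≤ 3 / 4 * c ^ 2 := by
      rw [div_lt_iff₀ (by positivity)] at hm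
      rw [← mul_div_assoc, div_le_iff₀ hm0]
      nlinarith
    have h7 : C ^ 2 * v0 = c ^ 2 / 64 := by
      rw [hv0]; field_simp; norm_num
    have h8 := hQ2.2
    have h9 : C ^ 2 * ∫ s, (Z s - μ0) ^ 2 ∂π
        ≤ C ^ 2 * (7 / 6 * (σ ^ 2 / m) + 7 * v0) := by
      gcongr
      linarith
    nlinarith

end Assumptions

end SmoothnessEstimate

/-! ### Expected decrease in one meta iteration. -/

section OneStep

variable {d : ℕ} {I 𝒟 : Type*} [MeasurableSpace I] [MeasurableSpace 𝒟] {P : TaskFamily d I 𝒟}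
  {L ρ σ σg σH α : ℝ} {N : ℕ} {z : BatchSizes}

theorem metaStep_eq (P : TaskFamily d I 𝒟) (α L ρ Cβ : ℝ) {k : ℕ} (s : Seed I 𝒟 N z k)
    (w : Param d) :
    metaStep P α L ρ Cβ s w = w - (Cβ⁻¹ * (smoothEstAux P α L ρ N w s.2)⁻¹) •
      ((z.B : ℝ)⁻¹ • ∑ b, metaGradEst P α (s.1 b).1 (s.1 b).2 w) := by
  rw [← mul_inv, ← one_div]
  rfl

theorem smoothEstAux_ge {m : ℕ} {n : Fin m → ℕ} (hCL : 0 ≤ CL α L ρ N) (w : Param d)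
    (s : ∀ b : Fin m, I × (Fin (n b) → 𝒟)) :
    (1 + α * L) ^ (2 * N) * L ≤ smoothEstAux P α L ρ N w s :=
  le_add_of_nonneg_right (div_nonneg (mul_nonneg hCL (Finset.sum_nonneg fun _ _ => norm_nonneg _))
    (Nat.cast_nonneg _))

theorem smoothConst_ge (hCL : 0 ≤ CL α L ρ N) (w : Param d) :
    (1 + α * L) ^ (2 * N) * L ≤ smoothConst P α L ρ N w :=
  le_add_of_nonneg_right (mul_nonneg hCL (meanGradNorm_nonneg P w))

namespace Assumptions

/-- The Lipschitz bound anchored at `w` gives continuity at `w`; a uniform constant is not required.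
-/
theorem continuous_gradient_metaLoss (hP : Assumptions P L ρ σ σg σH) (hL : 0 < L)
    (hρ : 0 ≤ ρ) (hα : 0 ≤ α) (hN : 1 ≤ N) : Continuous (gradient (metaLoss P α N)) := by
  refine continuous_iff_continuousAt.2 fun w => ?_
  rw [ContinuousAt, tendsto_iff_norm_sub_tendsto_zero]
  have h : Filter.Tendsto (fun u => smoothConst P α L ρ N w * ‖u - w‖) (nhds w) (nhds 0) := by
    have : Continuous fun u : Param d => smoothConst P α L ρ N w * ‖u - w‖ := by fun_prop
    simpa using this.tendsto w
  exact squeeze_zero (fun u => norm_nonneg _)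
    (fun u => hP.norm_gradient_metaLoss_sub_le hL hρ hα hN u w) h

/-- Expected decrease of the meta objective in one meta iteration started at `w`. -/
theorem expected_descent (hP : Assumptions P L ρ σ σg σH) (hL : 0 < L) (hρ : 0 < ρ) (hσ : 0 ≤ σ)
    (hσg : 0 < σg) (hα : 0 < α) (hN : 1 ≤ N) (hq : (1 + α * L) ^ (2 * N) < 2) (hz : z.Pos)
    (hbdd : BddBelow (Set.range (metaLoss P α N))) {Cβ : ℝ} (hCβ : 0 < Cβ)
    (hOK : z.SmoothOK N α L ρ σ σg) (k : ℕ) (w : Param d) :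
    ∃ M : ℝ, 8 / 9 ≤ M ∧ M ≤ 5 / 2 ∧
      Integrable (fun s => metaLoss P α N (metaStep P α L ρ Cβ s w)) (seedLaw P N z k) ∧
      ∫ s, metaLoss P α N (metaStep P α L ρ Cβ s w) ∂(seedLaw P N z k)
        ≤ metaLoss P α N w + (Cβ * smoothConst P α L ρ N w)⁻¹ *
          (M * (-‖gradient (metaLoss P α N) w‖ ^ 2 + ‖gradient (metaLoss P α N) w‖
              * biasBound α L ρ σ σg N z ‖gradient (metaLoss P α N) w‖)
            + 2 / Cβ * (2 * ‖gradient (metaLoss P α N) w‖ ^ 2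
              + 2 * biasBound α L ρ σ σg N z ‖gradient (metaLoss P α N) w‖ ^ 2
              + secondMomentBound α L σ σg σH N z ‖gradient (metaLoss P α N) w‖ / z.B)) := by
  have hCL := CL_pos hα hL hρ hN
  have hc0 : 0 < (1 + α * L) ^ (2 * N) * L := by positivity
  have hℓc := smoothConst_ge (P := P) (α := α) (L := L) (ρ := ρ) (N := N) hCL.le w
  obtain ⟨x1, x2, x3, x4⟩ := hP.smoothEstAux_moments hL hρ hσg hα hN (hOK k).1 (hOK k).2 w
  obtain ⟨i1, i2, i3, i4, i5⟩ := inv_moments x1 x2 hc0 (smoothEstAux_ge hCL.le w) hℓc x3 x4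
  obtain ⟨g1, g2, g3⟩ := hP.meanMetaGrad_moments hL hρ.le hσ hσg hα hq hz w
  set ℓ := smoothConst P α L ρ N w with hℓ
  have hℓ0 : 0 < ℓ := hc0.trans_le hℓc
  set x := ‖gradient (metaLoss P α N) w‖ with hx
  set b := biasBound α L ρ σ σg N z x
  set V := secondMomentBound α L σ σg σH N z x
  -- The gradient estimate `G` lives on one half of the seed and the inverse estimate `Y` on the
  -- other, so expectations of products of their functions factor.
  let π₁ : Measure (Fin z.B → I × (Slot N z → 𝒟)) := Measure.pi fun _ => drawLaw P (Slot N z)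
  let π₂ : Measure (∀ c : Fin (z.B' k), I × (Fin (z.DL k c) → 𝒟)) :=
    Measure.pi fun c : Fin (z.B' k) => drawLaw P (Fin (z.DL k c))
  let G : (Fin z.B → I × (Slot N z → 𝒟)) → Param d := fun s =>
    (z.B : ℝ)⁻¹ • ∑ c, metaGradEst P α (s c).1 (s c).2 w
  let Y : (∀ c : Fin (z.B' k), I × (Fin (z.DL k c) → 𝒟)) → ℝ := fun s =>
    (smoothEstAux P α L ρ N w s)⁻¹
  let v := gradient (metaLoss P α N) w
  have hGi : Integrable G π₁ := g1.integrable (by norm_num)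
  have hG2 : Integrable (fun s => ‖G s‖ ^ 2) π₁ := MemLp.integrable_norm_sq g1
  have hvG : Integrable (fun s => inner ℝ v (G s)) π₁ := hGi.const_inner v
  -- `M` is the ratio of the mean stepsize to 1/(C_β ℓ).
  refine ⟨ℓ * ∫ s, Y s ∂π₂, i3, i4, ?_⟩
  have hpt : ∀ s : Seed I 𝒟 N z k, metaLoss P α N (metaStep P α L ρ Cβ s w)
      ≤ metaLoss P α N w - Cβ⁻¹ * (inner ℝ v (G s.1) * Y s.2)
        + ℓ / 2 * Cβ⁻¹ ^ 2 * (‖G s.1‖ ^ 2 * Y s.2 ^ 2) := fun s => by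
    have h1 := le_quadratic_of_gradient_lipschitz_at (hP.differentiable_metaLoss hL hα.le N)
      (fun u => hP.norm_gradient_metaLoss_sub_le hL hρ.le hα.le hN u w)
      (metaStep P α L ρ Cβ s w)
    refine h1.trans (le_of_eq ?_)
    have h2 : metaStep P α L ρ Cβ s w - w = -((Cβ⁻¹ * Y s.2) • G s.1) := by
      rw [metaStep_eq, sub_sub_cancel_left]
    rw [h2, inner_neg_right, inner_smul_right, norm_neg, norm_smul, mul_pow, Real.norm_eq_abs,
      sq_abs]
    change _ - _ + ℓ / 2 * _ = _
    ring
  have hint1 : Integrable (fun s : Seed I 𝒟 N z k => inner ℝ v (G s.1) * Y s.2)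
      (seedLaw P N z k) := hvG.mul_prod i1
  have hint2 : Integrable (fun s : Seed I 𝒟 N z k => ‖G s.1‖ ^ 2 * Y s.2 ^ 2)
      (seedLaw P N z k) := hG2.mul_prod i2
  have hint : Integrable (fun s : Seed I 𝒟 N z k => metaLoss P α N w
      - Cβ⁻¹ * (inner ℝ v (G s.1) * Y s.2) + ℓ / 2 * Cβ⁻¹ ^ 2 * (‖G s.1‖ ^ 2 * Y s.2 ^ 2))
      (seedLaw P N z k) :=
    ((integrable_const _).sub (hint1.const_mul _)).add (hint2.const_mul _)
  -- The descent bound controls 𝓛 after the step only from above; the lower bound `m` supplies the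
  -- other side for integrability.
  obtain ⟨m, hm⟩ := hbdd
  have hstep : Integrable (fun s => metaLoss P α N (metaStep P α L ρ Cβ s w)) (seedLaw P N z k) := by
    refine (hint.norm.add (integrable_const |m|)).mono' (Measurable.aestronglyMeasurable ?_)
      (Filter.Eventually.of_forall fun s => ?_)
    · exact (hP.differentiable_metaLoss hL hα.le N).continuous.measurable.comp
        ((hP.measurable_metaStep (N := N) (z := z) α Cβ k).comp
          (f := fun s : Seed I 𝒟 N z k => (s, w)) (by fun_prop))
    · have h1 := hpt s
      have h2 : m ≤ metaLoss P α N (metaStep P α L ρ Cβ s w) := hm ⟨_, rfl⟩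
      simp only [Pi.add_apply]
      rw [Real.norm_eq_abs, Real.norm_eq_abs, abs_le]
      constructor
      · have h3 := neg_abs_le m
        have h4 := abs_nonneg (metaLoss P α N w
          - Cβ⁻¹ * (inner ℝ v (G s.1) * Y s.2) + ℓ / 2 * Cβ⁻¹ ^ 2 * (‖G s.1‖ ^ 2 * Y s.2 ^ 2))
        linarith
      · have h3 := abs_nonneg m
        have h4 := le_abs_self (metaLoss P α N w
          - Cβ⁻¹ * (inner ℝ v (G s.1) * Y s.2) + ℓ / 2 * Cβ⁻¹ ^ 2 * (‖G s.1‖ ^ 2 * Y s.2 ^ 2))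
        linarith
  refine ⟨hstep, (integral_mono hstep hint hpt).trans ?_⟩
  have e1 : ∫ s : Seed I 𝒟 N z k, inner ℝ v (G s.1) * Y s.2 ∂(seedLaw P N z k)
      = inner ℝ v (∫ s, G s ∂π₁) * ∫ s, Y s ∂π₂ := by
    rw [← integral_inner hGi]
    exact integral_prod_mul (μ := π₁) (ν := π₂) (fun s => inner ℝ v (G s)) Y
  have e2 : ∫ s : Seed I 𝒟 N z k, ‖G s.1‖ ^ 2 * Y s.2 ^ 2 ∂(seedLaw P N z k)
      = (∫ s, ‖G s‖ ^ 2 ∂π₁) * ∫ s, Y s ^ 2 ∂π₂ :=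
    integral_prod_mul (μ := π₁) (ν := π₂) (fun s => ‖G s‖ ^ 2) (fun s => Y s ^ 2)
  have hint' : Integrable (fun s : Seed I 𝒟 N z k => metaLoss P α N w
      - Cβ⁻¹ * (inner ℝ v (G s.1) * Y s.2)) (seedLaw P N z k) :=
    (integrable_const _).sub (hint1.const_mul _)
  rw [integral_add hint' (hint2.const_mul _), integral_sub (integrable_const _) (hint1.const_mul _)]
  simp only [integral_const_mul, integral_const, probReal_univ, smul_eq_mul, one_mul]
  rw [e1, e2]
  set EG := ∫ s, G s ∂π₁ with hEG
  set y1 := ∫ s, Y s ∂π₂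
  set y2 := ∫ s, Y s ^ 2 ∂π₂
  set g := ∫ s, ‖G s‖ ^ 2 ∂π₁
  have hy1 : 0 ≤ y1 := by
    by_contra h
    have := mul_neg_of_pos_of_neg hℓ0 (not_le.1 h)
    linarith
  have hin : x ^ 2 - x * b ≤ inner ℝ v EG := by
    have h1 : inner ℝ v EG = x ^ 2 + inner ℝ v (EG - v) := by
      rw [inner_sub_right, real_inner_self_eq_norm_sq]; ring
    have h2 := (abs_le.1 (abs_real_inner_le_norm v (EG - v))).1
    have h3 : ‖v‖ * ‖EG - v‖ ≤ x * b := mul_le_mul_of_nonneg_left g2 (norm_nonneg _)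
    linarith
  have t1 : Cβ⁻¹ * ((x ^ 2 - x * b) * y1) ≤ Cβ⁻¹ * (inner ℝ v EG * y1) := by gcongr
  have hgn : 0 ≤ g := integral_nonneg fun _ => by positivity
  -- One factor ℓ comes from the quadratic term, and ℓ² E[1/L̂²] ≤ 4 reduces it to 1/ℓ, the same
  -- order as the linear term.
  have t2 : ℓ / 2 * Cβ⁻¹ ^ 2 * (g * y2)
      ≤ 2 * Cβ⁻¹ ^ 2 * ℓ⁻¹ * (2 * x ^ 2 + 2 * b ^ 2 + V / z.B) := by
    have h1 : g * (ℓ ^ 2 * y2) ≤ (2 * x ^ 2 + 2 * b ^ 2 + V / z.B) * 4 :=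
      mul_le_mul g3 i5 (mul_nonneg (sq_nonneg _) (integral_nonneg fun _ => sq_nonneg _))
        (hgn.trans g3)
    have h2 : ℓ / 2 * Cβ⁻¹ ^ 2 * (g * y2) = Cβ⁻¹ ^ 2 * ℓ⁻¹ / 2 * (g * (ℓ ^ 2 * y2)) := by
      field_simp
    rw [h2]
    calc _ ≤ Cβ⁻¹ ^ 2 * ℓ⁻¹ / 2 * ((2 * x ^ 2 + 2 * b ^ 2 + V / z.B) * 4) := by gcongr
      _ = _ := by ring
  have t3 : (Cβ * ℓ)⁻¹ * (ℓ * y1 * (-x ^ 2 + x * b)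
        + 2 / Cβ * (2 * x ^ 2 + 2 * b ^ 2 + V / z.B))
      = -(Cβ⁻¹ * ((x ^ 2 - x * b) * y1))
        + 2 * Cβ⁻¹ ^ 2 * ℓ⁻¹ * (2 * x ^ 2 + 2 * b ^ 2 + V / z.B) := by
    field_simp
    ring
  change _ ≤ metaLoss P α N w + (Cβ * ℓ)⁻¹ * (ℓ * y1 * (-x ^ 2 + x * b)
        + 2 / Cβ * (2 * x ^ 2 + 2 * b ^ 2 + V / z.B))
  rw [t3]
  linarith

end Assumptions

end OneStep

/-! ### From the mean of X²/(X+χ) to the mean of X. -/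

section Jensen

variable {Ω : Type*} [MeasurableSpace Ω] {μ : Measure Ω} [IsProbabilityMeasure μ]

/-- A bound for `E X` from a bound for `E X²/(X + χ)`. -/
theorem integral_le_of_integral_sq_div_le {X : Ω → ℝ} (hX0 : ∀ ω, 0 ≤ X ω) (hX : Integrable X μ)
    {χ r : ℝ} (hχ : 0 < χ) (hf : Integrable (fun ω => X ω ^ 2 / (X ω + χ)) μ)
    (h : ∫ ω, X ω ^ 2 / (X ω + χ) ∂μ ≤ r) : ∫ ω, X ω ∂μ ≤ r + √(χ * r) := by
  set y := ∫ ω, X ω ∂μ with hy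
  have hy0 : 0 ≤ y := integral_nonneg hX0
  -- For every l, X²/(X+χ) ≥ 2lX − l²(X+χ). This choice of l maximises the mean of the right side,
  -- which becomes y²/(y+χ); it is Jensen's inequality made explicit.
  set l := y / (y + χ) with hl
  have hXχ : Integrable (fun ω => X ω + χ) μ := hX.add (integrable_const χ)
  have h1 : ∫ ω, (2 * l * X ω - l ^ 2 * (X ω + χ)) ∂μ ≤ ∫ ω, X ω ^ 2 / (X ω + χ) ∂μ := by
    refine integral_mono ((hX.const_mul _).sub (hXχ.const_mul _)) hf
      fun ω => ?_
    have h0 : 0 < X ω + χ := add_pos_of_nonneg_of_pos (hX0 ω) hχ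
    change 2 * l * X ω - l ^ 2 * (X ω + χ) ≤ X ω ^ 2 / (X ω + χ)
    rw [le_div_iff₀ h0]
    nlinarith [sq_nonneg (X ω - l * (X ω + χ))]
  rw [integral_sub (hX.const_mul _) (hXχ.const_mul _),
    integral_const_mul, integral_const_mul, integral_add hX (integrable_const χ), ← hy] at h1
  simp only [integral_const, probReal_univ, smul_eq_mul, one_mul] at h1
  have hyχ : 0 < y + χ := by linarith
  have h2 : 2 * l * y - l ^ 2 * (y + χ) = y ^ 2 / (y + χ) := by
    rw [hl]; field_simp; ring
  have h3 : y ^ 2 ≤ r * (y + χ) := by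
    rw [← div_le_iff₀ hyχ]
    linarith
  by_cases hyr : y ≤ r
  · exact hyr.trans (le_add_of_nonneg_right (Real.sqrt_nonneg _))
  · have hr0 : 0 ≤ r := by
      by_contra hr
      nlinarith [sq_nonneg y, mul_pos_of_neg_of_neg (not_le.1 hr) (neg_lt_zero.2 hyχ)]
    -- From y² ≤ r(y+χ): (y−r)² ≤ rχ − r(y−r) ≤ rχ when y > r ≥ 0.
    have h4 : y - r ≤ √(χ * r) := Real.le_sqrt_of_sq_le (by nlinarith [not_le.1 hyr])
    linarith

end Jensen

/-! ### The random run: independence, telescoping, random output index. -/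

section Run

variable {d : ℕ} {I 𝒟 : Type*} [MeasurableSpace I] [MeasurableSpace 𝒟] {P : TaskFamily d I 𝒟}
  {L ρ σ σg σH α Cβ : ℝ} {N K : ℕ} {z : BatchSizes}
  {Ω : Type*} [MeasurableSpace Ω] {μ : Measure Ω}
  {ξ : ∀ k, Ω → Seed I 𝒟 N z k} {ζ : Ω → Fin K} {w₀ : Param d}

theorem iterates_congr (P : TaskFamily d I 𝒟) (α L ρ Cβ : ℝ) {s s' : ∀ k, Seed I 𝒟 N z k}
    (w₀ : Param d) {k : ℕ} (h : ∀ j < k, s j = s' j) :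
    iterates P α L ρ Cβ s w₀ k = iterates P α L ρ Cβ s' w₀ k := by
  induction k with
  | zero => rfl
  | succ k ih =>
    simp only [iterates]
    rw [ih fun j hj => h j (hj.trans k.lt_succ_self), h k k.lt_succ_self]

theorem Assumptions.measurable_iterates (hP : Assumptions P L ρ σ σg σH) (α Cβ : ℝ)
    (w₀ : Param d) (k : ℕ) :
    Measurable fun s : ∀ k, Seed I 𝒟 N z k => iterates P α L ρ Cβ s w₀ k := by
  induction k with
  | zero => exact measurable_const
  | succ k ih =>
    exact (hP.measurable_metaStep α Cβ k).comp ((measurable_pi_apply k).prodMk ih)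

theorem IsRun.aemeasurable_seeds (h : IsRun P μ ξ ζ) : AEMeasurable (fun ω k => ξ k ω) μ :=
  aemeasurable_pi_lambda _ fun k => (h.seed_law k).aemeasurable

theorem IsRun.aemeasurable_iterates (h : IsRun P μ ξ ζ) (hP : Assumptions P L ρ σ σg σH)
    (α Cβ : ℝ) (w₀ : Param d) (k : ℕ) :
    AEMeasurable (fun ω => iterates P α L ρ Cβ (fun k => ξ k ω) w₀ k) μ :=
  (hP.measurable_iterates α Cβ w₀ k).comp_aemeasurable h.aemeasurable_seeds

/-- The iterate w_k is a function of the seeds before k, which are jointly independent of seed k. -/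
theorem IsRun.indepFun_iterates [IsProbabilityMeasure μ] (h : IsRun P μ ξ ζ)
    (hP : Assumptions P L ρ σ σg σH) (α Cβ : ℝ) (w₀ : Param d) (k : ℕ) :
    IndepFun (fun ω => iterates P α L ρ Cβ (fun k => ξ k ω) w₀ k) (ξ k) μ := by
  classical
  obtain ⟨ω₀⟩ := (inferInstance : (ae μ).NeBot).nonempty
  have h1 := h.seed_indep.indepFun_finset₀ (Finset.range k) {k} (by simp)
    fun k => (h.seed_law k).aemeasurable
  -- `iterates` expects an infinite family of seeds. The missing ones are filled with the values at
  -- an arbitrary ω₀ and do not influence w_k.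
  let ext : (∀ i : Finset.range k, Seed I 𝒟 N z i) → ∀ j, Seed I 𝒟 N z j := fun t j =>
    if hj : j ∈ Finset.range k then t ⟨j, hj⟩ else ξ j ω₀
  have hext : Measurable ext := measurable_pi_iff.2 fun j => by
    by_cases hj : j ∈ Finset.range k
    · simp only [ext, dif_pos hj]
      exact measurable_pi_apply _
    · simp only [ext, dif_neg hj]
      exact measurable_const
  have h2 := h1.comp (φ := fun t => iterates P α L ρ Cβ (ext t) w₀ k)
    (ψ := fun t : ∀ i : ({k} : Finset ℕ), Seed I 𝒟 N z i =>
      t ⟨k, Finset.mem_singleton_self k⟩)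
    ((hP.measurable_iterates α Cβ w₀ k).comp hext)
    (measurable_pi_apply (X := fun i : ({k} : Finset ℕ) => Seed I 𝒟 N z i)
      ⟨k, Finset.mem_singleton_self k⟩)
  have h3 : (fun ω => iterates P α L ρ Cβ (fun k => ξ k ω) w₀ k)
      = (fun t => iterates P α L ρ Cβ (ext t) w₀ k) ∘
        fun ω (i : Finset.range k) => ξ i ω := by
    ext1 ω
    refine iterates_congr P α L ρ Cβ w₀ fun j hj => ?_
    simp only [ext, dif_pos (Finset.mem_range.2 hj)]
  rw [h3]
  exact h2

theorem IsRun.integral_zeta_indicator [IsProbabilityMeasure μ] (h : IsRun P μ ξ ζ) (k : Fin K) :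
    ∫ ω, Set.indicator {k} (fun _ => (1 : ℝ)) (ζ ω) ∂μ = 1 / K := by
  have h1 : ∫ ω, Set.indicator {k} (fun _ => (1 : ℝ)) (ζ ω) ∂μ
      = ∫ j, Set.indicator {k} (fun _ => (1 : ℝ)) j ∂(uniformOn Set.univ) := by
    rw [← h.zeta_law.map_eq, integral_map h.zeta_law.aemeasurable
      (Measurable.of_discrete).aestronglyMeasurable]
  rw [h1, integral_indicator_const _ (MeasurableSet.singleton k), measureReal_def,
    uniformOn_univ]
  simp

/-- The law of the next iterate. -/
theorem IsRun.expected_decrease [IsProbabilityMeasure μ] (h : IsRun P μ ξ ζ)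
    (hP : Assumptions P L ρ σ σg σH) {H f : Param d → ℝ} (hH : Measurable H) (hH0 : ∀ w, 0 ≤ H w)
    (hf : Measurable f) (hf0 : ∀ w, 0 ≤ f w) {c₀ : ℝ} {k : ℕ}
    (hdesc : ∀ w, Integrable (fun s => H (metaStep P α L ρ Cβ s w)) (seedLaw P N z k) ∧
      ∫ s, H (metaStep P α L ρ Cβ s w) ∂(seedLaw P N z k) + f w ≤ H w + c₀)
    (hint : Integrable (fun ω => H (iterates P α L ρ Cβ (fun k => ξ k ω) w₀ k)) μ) :
    Integrable (fun ω => f (iterates P α L ρ Cβ (fun k => ξ k ω) w₀ k)) μ ∧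
    Integrable (fun ω => H (iterates P α L ρ Cβ (fun k => ξ k ω) w₀ (k + 1))) μ ∧
    ∫ ω, H (iterates P α L ρ Cβ (fun k => ξ k ω) w₀ (k + 1)) ∂μ
        + ∫ ω, f (iterates P α L ρ Cβ (fun k => ξ k ω) w₀ k) ∂μ
      ≤ ∫ ω, H (iterates P α L ρ Cβ (fun k => ξ k ω) w₀ k) ∂μ + c₀ := by
  set W : Ω → Param d := fun ω => iterates P α L ρ Cβ (fun k => ξ k ω) w₀ k with hW
  have hWm : AEMeasurable W μ := h.aemeasurable_iterates hP α Cβ w₀ k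
  have hξm := (h.seed_law k).aemeasurable
  have hprob : IsProbabilityMeasure (μ.map W) := Measure.isProbabilityMeasure_map hWm
  have hHν : Integrable H (μ.map W) :=
    (integrable_map_measure hH.aestronglyMeasurable hWm).2 hint
  -- Nonnegativity of `H` after the step bounds the gain `f`, hence makes it integrable.
  have hfle : ∀ w, f w ≤ H w + c₀ := fun w => by
    have h1 := (hdesc w).2
    have h2 : 0 ≤ ∫ s, H (metaStep P α L ρ Cβ s w) ∂(seedLaw P N z k) :=
      integral_nonneg fun s => hH0 _
    linarith
  have hfν : Integrable f (μ.map W) :=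
    (hHν.add (integrable_const c₀)).mono' hf.aestronglyMeasurable
      (Filter.Eventually.of_forall fun w => by
        rw [Real.norm_of_nonneg (hf0 w)]
        exact hfle w)
  -- By independence the pair has a product law, so the decrease at a fixed point `w` can be
  -- integrated over the law of the iterate.
  have hlaw : μ.map (fun ω => (W ω, ξ k ω))
      = (μ.map W) ⊗ₘ (Kernel.const (Param d) (seedLaw P N z k)) := by
    rw [Measure.compProd_const, ← (h.seed_law k).map_eq]
    exact (indepFun_iff_map_prod_eq_prod_map_map hWm hξm).1 (h.indepFun_iterates hP α Cβ w₀ k)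
  have hmeas : Measurable fun p : Param d × Seed I 𝒟 N z k =>
      H (metaStep P α L ρ Cβ p.2 p.1) :=
    hH.comp ((hP.measurable_metaStep α Cβ k).comp measurable_swap)
  have hGi : Integrable (fun w => H w + c₀ - f w) (μ.map W) :=
    (hHν.add (integrable_const c₀)).sub hfν
  have key := integrable_and_integral_le_of_compProd (μ := μ.map W)
    (κ := Kernel.const (Param d) (seedLaw P N z k))
    (F := fun p => H (metaStep P α L ρ Cβ p.2 p.1)) (G := fun w => H w + c₀ - f w) hmeas
    (fun p => hH0 _) hGi
    (fun w => by
      rw [Kernel.const_apply]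
      refine ⟨(hdesc w).1, ?_⟩
      have := (hdesc w).2
      linarith)
  rw [← hlaw] at key
  have hpair : AEMeasurable (fun ω => (W ω, ξ k ω)) μ := hWm.prodMk hξm
  obtain ⟨k1, k2⟩ := key
  rw [integrable_map_measure hmeas.aestronglyMeasurable hpair] at k1
  rw [integral_map hpair hmeas.aestronglyMeasurable] at k2
  have hsub : ∫ w, (H w + c₀ - f w) ∂(μ.map W) = ∫ ω, H (W ω) ∂μ + c₀ - ∫ ω, f (W ω) ∂μ := by
    have h1 : Integrable (fun w => H w + c₀) (μ.map W) := hHν.add (integrable_const c₀)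
    rw [integral_sub h1 hfν, integral_add hHν (integrable_const c₀),
      integral_map hWm hH.aestronglyMeasurable, integral_map hWm hf.aestronglyMeasurable]
    simp
  rw [hsub] at k2
  refine ⟨(integrable_map_measure hf.aestronglyMeasurable hWm).1 hfν, k1, ?_⟩
  change ∫ ω, H (metaStep P α L ρ Cβ (ξ k ω) (W ω)) ∂μ + _ ≤ _
  linarith

/-- A function of the output is, in mean, the average over the iterates. -/
theorem IsRun.integral_output [IsProbabilityMeasure μ] (h : IsRun P μ ξ ζ)
    (hP : Assumptions P L ρ σ σg σH) {g : Param d → ℝ} (hg : Measurable g)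
    (hi : ∀ k < K, Integrable (fun ω => g (iterates P α L ρ Cβ (fun k => ξ k ω) w₀ k)) μ) :
    Integrable (fun ω => g (iterates P α L ρ Cβ (fun k => ξ k ω) w₀ (ζ ω))) μ ∧
    ∫ ω, g (iterates P α L ρ Cβ (fun k => ξ k ω) w₀ (ζ ω)) ∂μ
      = 1 / K * ∑ k ∈ Finset.range K,
          ∫ ω, g (iterates P α L ρ Cβ (fun k => ξ k ω) w₀ k) ∂μ := by
  -- Splitting according to the value of ζ; each indicator is independent of the run and has mean
  -- 1/K.
  have hdec : (fun ω => g (iterates P α L ρ Cβ (fun k => ξ k ω) w₀ (ζ ω)))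
      = fun ω => ∑ k : Fin K, Set.indicator {k} (fun _ => (1 : ℝ)) (ζ ω)
          * g (iterates P α L ρ Cβ (fun k => ξ k ω) w₀ k) := by
    ext1 ω
    rw [Finset.sum_eq_single (ζ ω)]
    · simp
    · intro k _ hk
      simp [Set.indicator_of_notMem (show ζ ω ∉ ({k} : Set (Fin K)) from fun h => hk h.symm)]
    · simp
  have hind : ∀ k : Fin K, IndepFun (fun ω => Set.indicator {k} (fun _ => (1 : ℝ)) (ζ ω))
      (fun ω => g (iterates P α L ρ Cβ (fun k => ξ k ω) w₀ k)) μ := fun k =>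
    h.zeta_indep.comp (φ := Set.indicator {k} (fun _ => (1 : ℝ)))
      (ψ := fun s => g (iterates P α L ρ Cβ s w₀ k)) Measurable.of_discrete
      (hg.comp (hP.measurable_iterates α Cβ w₀ k))
  have hζm : ∀ k : Fin K,
      AEStronglyMeasurable (fun ω => Set.indicator {k} (fun _ => (1 : ℝ)) (ζ ω)) μ := fun k =>
    ((Measurable.of_discrete (f := Set.indicator {k} (fun _ => (1 : ℝ)))).comp_aemeasurable
      h.zeta_law.aemeasurable).aestronglyMeasurable
  have hterm : ∀ k : Fin K, Integrable (fun ω => Set.indicator {k} (fun _ => (1 : ℝ)) (ζ ω)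
          * g (iterates P α L ρ Cβ (fun k => ξ k ω) w₀ k)) μ := fun k =>
    (hi k k.2).bdd_mul (c := 1) (hζm k) (Filter.Eventually.of_forall fun ω => by
      refine (norm_indicator_le_norm_self _ _).trans ?_
      simp)
  rw [hdec]
  refine ⟨integrable_finsetSum _ fun k _ => hterm k, ?_⟩
  rw [integral_finsetSum _ fun k _ => hterm k, Finset.mul_sum, Finset.sum_range]
  refine Finset.sum_congr rfl fun k _ => ?_
  rw [(hind k).integral_fun_mul_eq_mul_integral (hζm k) (hi k k.2).aestronglyMeasurable,
    h.integral_zeta_indicator]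

/-- Convergence from a uniform expected decrease. -/
theorem IsRun.output_bound [IsProbabilityMeasure μ] (h : IsRun P μ ξ ζ)
    (hP : Assumptions P L ρ σ σg σH) (hL : 0 < L) (hρ : 0 ≤ ρ) (hα : 0 ≤ α) (hN : 1 ≤ N)
    (hK : 1 ≤ K) (hbdd : BddBelow (Set.range (metaLoss P α N))) {c₀ A χ r : ℝ} (hA : 0 < A)
    (hχ : 0 < χ)
    (hdesc : ∀ k w, Integrable (fun s => metaLoss P α N (metaStep P α L ρ Cβ s w))
        (seedLaw P N z k) ∧
      ∫ s, metaLoss P α N (metaStep P α L ρ Cβ s w) ∂(seedLaw P N z k)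
        + A * (‖gradient (metaLoss P α N) w‖ ^ 2 / (‖gradient (metaLoss P α N) w‖ + χ))
        ≤ metaLoss P α N w + c₀)
    (hr : initialGap P α N w₀ / K + c₀ ≤ A * r) :
    Integrable (outputGradNorm P α L ρ Cβ ξ ζ w₀) μ ∧
      ∫ ω, outputGradNorm P α L ρ Cβ ξ ζ w₀ ω ∂μ ≤ r + √(χ * r) := by
  let W : ℕ → Ω → Param d := fun k ω => iterates P α L ρ Cβ (fun k => ξ k ω) w₀ k
  let x : Param d → ℝ := fun w => ‖gradient (metaLoss P α N) w‖
  let φ : Param d → ℝ := fun w => x w ^ 2 / (x w + χ)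
  -- Subtracting the infimum makes the potential nonnegative, so its final value can be dropped
  -- after telescoping.
  let H : Param d → ℝ := fun w => metaLoss P α N w - ⨅ u, metaLoss P α N u
  have hxm : Measurable x :=
    (hP.continuous_gradient_metaLoss hL hρ hα hN).measurable.norm
  have hx0 : ∀ w, 0 ≤ x w := fun w => norm_nonneg _
  have hφm : Measurable φ := (hxm.pow_const 2).div (hxm.add_const χ)
  have hφ0 : ∀ w, 0 ≤ φ w := fun w =>
    div_nonneg (sq_nonneg _) (add_nonneg (hx0 w) hχ.le)
  have hHm : Measurable H :=
    (hP.differentiable_metaLoss hL hα N).continuous.measurable.sub_const _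
  have hH0 : ∀ w, 0 ≤ H w := fun w => sub_nonneg.2 (ciInf_le hbdd w)
  have hd : ∀ k w, Integrable (fun s => H (metaStep P α L ρ Cβ s w)) (seedLaw P N z k) ∧
      ∫ s, H (metaStep P α L ρ Cβ s w) ∂(seedLaw P N z k) + A * φ w ≤ H w + c₀ := by
    intro k w
    obtain ⟨h1, h2⟩ := hdesc k w
    refine ⟨h1.sub (integrable_const _), ?_⟩
    simp only [H]
    rw [integral_sub h1 (integrable_const _)]
    simp only [integral_const, probReal_univ, smul_eq_mul, one_mul]
    simp only [φ, x]
    linarith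
  have hstep : ∀ k, Integrable (fun ω => H (W k ω)) μ →
      Integrable (fun ω => A * φ (W k ω)) μ ∧ Integrable (fun ω => H (W (k + 1) ω)) μ ∧
      ∫ ω, H (W (k + 1) ω) ∂μ + ∫ ω, A * φ (W k ω) ∂μ ≤ ∫ ω, H (W k ω) ∂μ + c₀ := fun k hk =>
    h.expected_decrease (f := fun w => A * φ w) hP hHm hH0 (hφm.const_mul A)
      (fun w => mul_nonneg hA.le (hφ0 w)) (hd k) hk
  have hHi : ∀ k, Integrable (fun ω => H (W k ω)) μ := fun k => by
    induction k with
    | zero => exact integrable_const (H w₀)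
    | succ k ih => exact (hstep k ih).2.1
  have hφi : ∀ k, Integrable (fun ω => φ (W k ω)) μ := fun k => by
    have := ((hstep k (hHi k)).1).const_mul A⁻¹
    simpa [← mul_assoc, inv_mul_cancel₀ hA.ne'] using this
  have htel : ∀ k, ∫ ω, H (W k ω) ∂μ + A * ∑ j ∈ Finset.range k, ∫ ω, φ (W j ω) ∂μ
      ≤ initialGap P α N w₀ + k * c₀ := fun k => by
    induction k with
    | zero => simp [W, iterates, H, initialGap]
    | succ k ih =>
      have h1 := (hstep k (hHi k)).2.2
      rw [integral_const_mul] at h1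
      rw [Finset.sum_range_succ]
      push_cast
      linarith
  -- Since (x−χ)(x+χ) ≤ x², x is at most x²/(x+χ) + χ, so it inherits integrability.
  have hxi : ∀ k, Integrable (fun ω => x (W k ω)) μ := fun k =>
    ((hφi k).add (integrable_const χ)).mono'
      ((hxm.comp_aemeasurable (h.aemeasurable_iterates hP α Cβ w₀ k)).aestronglyMeasurable)
      (Filter.Eventually.of_forall fun ω => by
        have h0 := hx0 (W k ω)
        change ‖x (W k ω)‖ ≤ φ (W k ω) + χ
        rw [Real.norm_of_nonneg h0, ← sub_le_iff_le_add, le_div_iff₀ (by linarith)]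
        nlinarith)
  obtain ⟨o1, -⟩ := h.integral_output (Cβ := Cβ) (α := α) (w₀ := w₀) hP hxm fun k _ => hxi k
  obtain ⟨o2, o3⟩ := h.integral_output (Cβ := Cβ) (α := α) (w₀ := w₀) hP hφm fun k _ => hφi k
  have hK0 : (0 : ℝ) < K := by exact_mod_cast hK
  refine ⟨o1, integral_le_of_integral_sq_div_le
    (X := outputGradNorm P α L ρ Cβ ξ ζ w₀) (fun ω => norm_nonneg _) o1 hχ o2 ?_⟩
  refine o3.le.trans ?_
  have h1 := htel K
  have h2 : 0 ≤ ∫ ω, H (W K ω) ∂μ := integral_nonneg fun ω => hH0 _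
  have h3 : A * (1 / K * ∑ k ∈ Finset.range K, ∫ ω, φ (W k ω) ∂μ)
      ≤ initialGap P α N w₀ / K + c₀ := by
    have h4 : A * (1 / K * ∑ k ∈ Finset.range K, ∫ ω, φ (W k ω) ∂μ)
        = (A * ∑ k ∈ Finset.range K, ∫ ω, φ (W k ω) ∂μ) / K := by ring
    rw [h4, div_add' _ _ _ hK0.ne']
    gcongr
    linarith
  exact le_of_mul_le_mul_left (h3.trans hr) hA

end Run

/-! ### Reduction to a scalar quadratic inequality. -/

section Reduction

variable {d : ℕ} {I 𝒟 : Type*} [MeasurableSpace I] [MeasurableSpace 𝒟] {P : TaskFamily d I 𝒟}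
  {L ρ σ σg σH α Cβ : ℝ} {N K : ℕ} {z : BatchSizes}
  {Ω : Type*} [MeasurableSpace Ω] {μ : Measure Ω}
  {ξ : ∀ k, Ω → Seed I 𝒟 N z k} {ζ : Ω → Fin K} {w₀ : Param d}

theorem Assumptions.smoothConst_le (hP : Assumptions P L ρ σ σg σH) (hL : 0 < L) (hρ : 0 < ρ)
    (hσ : 0 ≤ σ) (hα : 0 < α) (hN : 1 ≤ N) (hq : (1 + α * L) ^ (2 * N) < 2) (w : Param d) :
    smoothConst P α L ρ N w ≤ (1 + α * L) ^ (2 * N) * L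
      + CL α L ρ N / (2 - (1 + α * L) ^ (2 * N)) * (‖gradient (metaLoss P α N) w‖ + σ) := by
  have h := hP.meanGradNorm_le hL hσ hα.le hq w
  have h2 : 0 < 2 - (1 + α * L) ^ (2 * N) := by linarith
  have h3 : meanGradNorm P w
      ≤ (‖gradient (metaLoss P α N) w‖ + σ) / (2 - (1 + α * L) ^ (2 * N)) := by
    rw [le_div_iff₀ h2]; linarith
  have h4 := mul_le_mul_of_nonneg_left h3 (CL_pos hα hL hρ hN).le
  rw [smoothConst, div_mul_eq_mul_div, ← mul_div_assoc'] at *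
  linarith

/-- Convergence from a quadratic estimate of the expected decrease. -/
theorem IsRun.output_bound_of_quadratic [IsProbabilityMeasure μ] (h : IsRun P μ ξ ζ)
    (hP : Assumptions P L ρ σ σg σH) (hL : 0 < L) (hρ : 0 < ρ) (hσ : 0 ≤ σ) (hσg : 0 < σg)
    (hα : 0 < α) (hN : 1 ≤ N) (hK : 1 ≤ K) (hq : (1 + α * L) ^ (2 * N) < 2) (hz : z.Pos)
    (hbdd : BddBelow (Set.range (metaLoss P α N))) (hCβ : 0 < Cβ)
    (hOK : z.SmoothOK N α L ρ σ σg) {E F U χ r : ℝ} (hE : 0 < E) (hF : 0 ≤ F) (hU : 0 < U)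
    (hχ : 0 < χ)
    (hquad : ∀ M x : ℝ, 8 / 9 ≤ M → M ≤ 5 / 2 → 0 ≤ x →
      M * (-x ^ 2 + x * biasBound α L ρ σ σg N z x)
        + 2 / Cβ * (2 * x ^ 2 + 2 * biasBound α L ρ σ σg N z x ^ 2
          + secondMomentBound α L σ σg σH N z x / z.B) ≤ -(E * x ^ 2) + F)
    (hsmooth : ∀ x : ℝ, 0 ≤ x → (1 + α * L) ^ (2 * N) * L
      + CL α L ρ N / (2 - (1 + α * L) ^ (2 * N)) * (x + σ) ≤ U * (x + χ))
    (hr : initialGap P α N w₀ / K + F / (Cβ * L) ≤ E / (Cβ * U) * r) :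
    Integrable (outputGradNorm P α L ρ Cβ ξ ζ w₀) μ ∧
      ∫ ω, outputGradNorm P α L ρ Cβ ξ ζ w₀ ω ∂μ ≤ r + √(χ * r) := by
  refine h.output_bound hP hL hρ.le hα.le hN hK hbdd (A := E / (Cβ * U)) (by positivity) hχ
    (fun k w => ?_) hr
  obtain ⟨M, hM1, hM2, hi, hle⟩ :=
    hP.expected_descent hL hρ hσ hσg hα hN hq hz hbdd hCβ hOK k w
  refine ⟨hi, ?_⟩
  set x := ‖gradient (metaLoss P α N) w‖ with hx
  have hx0 : 0 ≤ x := norm_nonneg _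
  have hℓU : smoothConst P α L ρ N w ≤ U * (x + χ) :=
    (hP.smoothConst_le hL hρ hσ hα hN hq w).trans (hsmooth x hx0)
  have hℓL : L ≤ smoothConst P α L ρ N w := by
    refine le_trans ?_ (smoothConst_ge (P := P) (CL_pos hα hL hρ hN).le w)
    exact le_mul_of_one_le_left hL.le (one_le_pow₀ (by nlinarith [mul_pos hα hL]))
  set ℓ := smoothConst P α L ρ N w
  have hℓ : 0 < ℓ := hL.trans_le hℓL
  have h1 := mul_le_mul_of_nonneg_left (hquad M x hM1 hM2 hx0)
    (inv_nonneg.2 (mul_pos hCβ hℓ).le)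
  -- The error term uses the lower bound ℓ ≥ L, the gain below uses the upper bound ℓ ≤ U(x+χ).
  have h2 : (Cβ * ℓ)⁻¹ * F ≤ F / (Cβ * L) := by
    rw [inv_mul_eq_div]; gcongr
  have h3 : E / (Cβ * U) * (x ^ 2 / (x + χ)) ≤ (Cβ * ℓ)⁻¹ * (E * x ^ 2) := by
    rw [inv_mul_eq_div, div_mul_div_comm, mul_assoc]
    gcongr
  have h4 : (Cβ * ℓ)⁻¹ * (-(E * x ^ 2) + F)
      = -((Cβ * ℓ)⁻¹ * (E * x ^ 2)) + (Cβ * ℓ)⁻¹ * F := by ring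
  linarith

end Reduction

/-! ### The general convergence rate. -/

section General

theorem one_add_pow_two_mul_lt_two {α L : ℝ} (hL : 0 < L) (hα : 0 < α) {N : ℕ} (hN : 1 ≤ N)
    (h : α < ((2 : ℝ) ^ (1 / (2 * (N : ℝ))) - 1) / L) : (1 + α * L) ^ (2 * N) < 2 := by
  rw [lt_div_iff₀ hL] at h
  have h0 : 0 ≤ 1 + α * L := by positivity
  have hN0 : (N : ℝ) ≠ 0 := by positivity
  calc (1 + α * L) ^ (2 * N) < ((2 : ℝ) ^ (1 / (2 * (N : ℝ)))) ^ (2 * N) :=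
        pow_lt_pow_left₀ (by linarith) h0 (by lia)
    _ = 2 := by
        rw [← Real.rpow_natCast, ← Real.rpow_mul zero_le_two]
        push_cast
        rw [one_div_mul_cancel (by positivity), Real.rpow_one]

theorem sq_add_mul_div_sqrt_le {r s x σ S : ℝ} (hS : 0 ≤ S) :
    ((r + s * (x + σ)) / √S) ^ 2 ≤ 3 * (r ^ 2 + s ^ 2 * σ ^ 2 + s ^ 2 * x ^ 2) / S := by
  rw [div_pow, Real.sq_sqrt hS]
  gcongr
  nlinarith [sq_nonneg (r - s * x), sq_nonneg (r - s * σ), sq_nonneg (s * x - s * σ)]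

/-- Completing the square, (3/10)Mxe ≤ (2/5)e² + (9/160)M²x². The concave function M − 4/5 −
(9/160)M² is nonnegative at both ends of [8/9, 5/2], hence on the whole interval. -/
theorem quadratic_descent {M x b e : ℝ} (h1 : 8 / 9 ≤ M) (h2 : M ≤ 5 / 2) (hx : 0 ≤ x)
    (hb : b ≤ 3 / 10 * e) : M * (-x ^ 2 + x * b) ≤ -(4 / 5 * x ^ 2) + 2 / 5 * e ^ 2 := by
  have h3 : M * (x * b) ≤ M * (x * (3 / 10 * e)) := by gcongr
  have h4 : 0 ≤ (M - 4 / 5 - 9 / 160 * M ^ 2) * x ^ 2 := by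
    refine mul_nonneg ?_ (sq_nonneg x)
    nlinarith
  nlinarith [sq_nonneg (e - 3 / 8 * M * x)]

theorem biasBound_nonneg {α L ρ σ σg : ℝ} (hL : 0 < L) (hρ : 0 ≤ ρ) (hσ : 0 ≤ σ) (hσg : 0 ≤ σg)
    (hα : 0 ≤ α) {N : ℕ} (hq : (1 + α * L) ^ (2 * N) < 2) (z : BatchSizes) {x : ℝ} (hx : 0 ≤ x) :
    0 ≤ biasBound α L ρ σ σg N z x := by
  have h1 : 0 ≤ (1 + α * L) ^ N - 1 :=
    sub_nonneg.2 (one_le_pow₀ (by nlinarith [mul_nonneg hα hL.le]))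
  have h2 : 0 ≤ 2 - (1 + α * L) ^ (2 * N) := by linarith
  unfold biasBound
  positivity

theorem biasBound_le {α L ρ σ σg : ℝ} (hL : 0 < L) (hρ : 0 ≤ ρ) (hσ : 0 ≤ σ) (hσg : 0 ≤ σg)
    (hα : 0 ≤ α) {N : ℕ} (hq : (1 + α * L) ^ (2 * N) < 2) (z : BatchSizes) {x : ℝ} (hx : 0 ≤ x) :
    biasBound α L ρ σ σg N z x
      ≤ 3 / 10 * ((Cerr1 α L σg N + Cerr2 α L ρ σg N * (x + σ)) / √z.S) := by
  have hq1 : 1 ≤ (1 + α * L) ^ N := one_le_pow₀ (by nlinarith [mul_nonneg hα hL.le])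
  have h2 : (1 + α * L) ^ (2 * N) = ((1 + α * L) ^ N) ^ 2 := by rw [← pow_mul, mul_comm N]
  have h4 : (1 + α * L) ^ (4 * N) = ((1 + α * L) ^ N) ^ 4 := by rw [← pow_mul, mul_comm N]
  unfold biasBound Cerr1 Cerr2
  rw [h4]
  rw [h2] at hq ⊢
  set q := (1 + α * L) ^ N
  have hq2 : 0 < 2 - q ^ 2 := by linarith
  refine (div_le_div_of_nonneg_right ?_ (Real.sqrt_nonneg _)).trans_eq (mul_div_assoc _ _ _)
  -- q − 1 ≤ (3/10)q amounts to q ≤ 10/7, which follows from q² < 2.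
  have e1 : q * (q - 1) * σg ≤ 3 / 10 * (q ^ 2 * σg) := by
    have hq3 : q ≤ 10 / 7 := by nlinarith
    rw [← mul_assoc]
    exact mul_le_mul_of_nonneg_right (by nlinarith) hσg
  have e2 : q ^ 2 * (q - 1) * (ρ * σg / L ^ 2) * ((x + σ) / (2 - q ^ 2))
      ≤ 3 / 10 * (q ^ 4 * ρ * σg / ((2 - q ^ 2) * L ^ 2) * (x + σ)) := by
    have e3 : 3 / 10 * (q ^ 4 * ρ * σg / ((2 - q ^ 2) * L ^ 2) * (x + σ))
        = q ^ 2 * (3 / 10 * q ^ 2) * (ρ * σg / L ^ 2) * ((x + σ) / (2 - q ^ 2)) := by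
      field_simp
    rw [e3]
    gcongr
    -- q − 1 ≤ (3/10)q² holds for every real q, the discriminant being negative.
    nlinarith [sq_nonneg (q - 5 / 3)]
  linarith

/-- The algebra of one descent step. -/
theorem descent_algebra {M x b e G1 G2 V1 V3 B S Cβ σ : ℝ} (h1 : 8 / 9 ≤ M) (h2 : M ≤ 5 / 2)
    (hx : 0 ≤ x) (hb0 : 0 ≤ b) (hb : b ≤ 3 / 10 * e) (hS : 0 < S) (hB : 0 < B) (hCβ : 0 < Cβ)
    (hV3 : 0 ≤ V3) (he : e ^ 2 ≤ 3 * (G1 ^ 2 + G2 ^ 2 * σ ^ 2 + G2 ^ 2 * x ^ 2) / S) :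
    M * (-x ^ 2 + x * b) + 2 / Cβ * (2 * x ^ 2 + 2 * b ^ 2 + (V1 + V3 * (x ^ 2 + σ ^ 2)) / B)
      ≤ -(4 * (1 / 5 - (3 / 5 + 6 / Cβ) * (G2 ^ 2 / S) - V3 / (Cβ * B) - 2 / Cβ) * x ^ 2)
        + (6 * (1 / 5 + 2 / Cβ) * ((G1 ^ 2 + G2 ^ 2 * σ ^ 2) / S)
          + 2 / Cβ * (V1 + V3 * σ ^ 2) / B) := by
  have t1 := quadratic_descent h1 h2 hx hb
  have t2 : b ^ 2 ≤ 9 / 100 * e ^ 2 := by nlinarith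
  obtain ⟨c, hc⟩ : ∃ c, c = 1 / Cβ := ⟨_, rfl⟩
  have hc0 : 0 < c := by rw [hc]; positivity
  set u := (G1 ^ 2 + G2 ^ 2 * σ ^ 2) / S with hu
  set v := G2 ^ 2 / S with hv
  have hu0 : 0 ≤ u := by positivity
  have hv0 : 0 ≤ v := by positivity
  have he' : e ^ 2 ≤ 3 * u + 3 * v * x ^ 2 := by
    refine he.trans (le_of_eq ?_)
    rw [hu, hv]; field_simp
  set V := V3 / B with hV
  have hV0 : 0 ≤ V := by positivity
  have r1 : 2 / Cβ * (2 * x ^ 2 + 2 * b ^ 2 + (V1 + V3 * (x ^ 2 + σ ^ 2)) / B)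
      = 4 * c * x ^ 2 + 4 * c * b ^ 2 + 2 * c * (V1 / B + V * σ ^ 2) + 2 * c * V * x ^ 2 := by
    rw [hc, hV]; field_simp; ring
  have r2 : 4 * (1 / 5 - (3 / 5 + 6 / Cβ) * v - V3 / (Cβ * B) - 2 / Cβ) * x ^ 2
      = 4 / 5 * x ^ 2 - (12 / 5 + 24 * c) * (v * x ^ 2) - 4 * c * V * x ^ 2 - 8 * c * x ^ 2 := by
    rw [hc, hV]; field_simp; ring
  have r3 : 6 * (1 / 5 + 2 / Cβ) * u + 2 / Cβ * (V1 + V3 * σ ^ 2) / B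
      = (6 / 5 + 12 * c) * u + 2 * c * (V1 / B + V * σ ^ 2) := by
    rw [hc, hV]; field_simp; ring
  rw [r1, r2, r3]
  have t3 : c * b ^ 2 ≤ c * (9 / 100 * (3 * u + 3 * v * x ^ 2)) := by
    gcongr
    linarith
  have p1 : 0 ≤ c * u := by positivity
  have p2 : 0 ≤ c * (v * x ^ 2) := by positivity
  have p3 : 0 ≤ c * V * x ^ 2 := by positivity
  have p4 : 0 ≤ c * x ^ 2 := by positivity
  have p5 : 0 ≤ v * x ^ 2 := by positivity
  nlinarith

variable {d : ℕ} {I 𝒟 : Type*} [MeasurableSpace I] [MeasurableSpace 𝒟] {P : TaskFamily d I 𝒟}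
  {L ρ σ σg σH α Cβ : ℝ} {N K : ℕ} {z : BatchSizes}
  {Ω : Type*} [MeasurableSpace Ω] {μ : Measure Ω}
  {ξ : ∀ k, Ω → Seed I 𝒟 N z k} {ζ : Ω → Fin K} {w₀ : Param d}

theorem Csqu1_nonneg (α L σg σH : ℝ) (N : ℕ) (z : BatchSizes) : 0 ≤ Csqu1 α L σg σH N z := by
  unfold Csqu1; positivity

theorem Csqu2_nonneg (hα : 0 ≤ α) (hL : 0 ≤ L) (σg σH : ℝ) (N : ℕ) (z : BatchSizes) :
    0 ≤ Csqu2 α L σg σH N z := by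
  have h1 := Csqu1_nonneg α L σg σH N z
  have h2 : 0 ≤ (1 + 2 * α * L + 2 * α ^ 2 * L ^ 2) ^ N - 1 :=
    sub_nonneg.2 (one_le_pow₀ (by
      have : 0 ≤ 2 * α * L + 2 * α ^ 2 * L ^ 2 := by positivity
      linarith))
  unfold Csqu2; positivity

theorem Csqu3_nonneg (hα : 0 ≤ α) (hL : 0 ≤ L) (σg σH : ℝ) (N : ℕ) (z : BatchSizes) :
    0 ≤ Csqu3 α L σg σH N z := by
  have h1 := Csqu1_nonneg α L σg σH N z
  unfold Csqu3; positivity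

/-- The convergence rate of multi-step MAML. -/
theorem IsRun.output_le_mainRate [IsProbabilityMeasure μ] (h : IsRun P μ ξ ζ)
    (hP : Assumptions P L ρ σ σg σH) (hL : 0 < L) (hρ : 0 < ρ) (hσ : 0 < σ) (hσg : 0 < σg)
    (hα : 0 < α) (hN : 1 ≤ N) (hK : 1 ≤ K) (hq : (1 + α * L) ^ (2 * N) < 2) (hz : z.Pos)
    (hbdd : BddBelow (Set.range (metaLoss P α N))) (hCβ : 0 < Cβ)
    (hOK : z.SmoothOK N α L ρ σ σg) (hθ : 0 < theta α L ρ σg σH Cβ N z) :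
    Integrable (outputGradNorm P α L ρ Cβ ξ ζ w₀) μ ∧
      ∫ ω, outputGradNorm P α L ρ Cβ ξ ζ w₀ ω ∂μ
        ≤ mainRate (initialGap P α N w₀) α L ρ σ σg σH Cβ N z K
          + √(chi α L ρ σ N / 2)
            * √(mainRate (initialGap P α N w₀) α L ρ σ σg σH Cβ N z K) := by
  obtain ⟨hS, hD, hT, hB⟩ := hz
  have hS0 : (0 : ℝ) < z.S := by exact_mod_cast hS
  have hB0 : (0 : ℝ) < z.B := by exact_mod_cast hB
  have hK0 : (0 : ℝ) < K := by exact_mod_cast hK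
  have hC := CL_pos hα hL hρ hN
  have hq2 : 0 < 2 - (1 + α * L) ^ (2 * N) := by linarith
  have hχ : 0 < chi α L ρ σ N := by
    unfold chi; positivity
  have hθ' := hθ
  rw [theta, mul_pos_iff_of_pos_left (by positivity)] at hθ'
  have hV1 := Csqu1_nonneg α L σg σH N z
  have hV2 := Csqu2_nonneg hα.le hL.le σg σH N z
  have hV3 := Csqu3_nonneg hα.le hL.le σg σH N z
  have hgap : 0 ≤ initialGap P α N w₀ := sub_nonneg.2 (ciInf_le hbdd w₀)
  have hxi : 0 ≤ xi α L ρ σ σg Cβ N := by unfold xi; positivity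
  have hphi : 0 ≤ phi α L σ σg σH Cβ N z := by unfold phi; positivity
  set R := mainRate (initialGap P α N w₀) α L ρ σ σg σH Cβ N z K with hR
  have hR0 : 0 ≤ R := by rw [hR]; unfold mainRate; positivity
  set Θ := 1 / 5 - (3 / 5 + 6 / Cβ) * (Cerr2 α L ρ σg N ^ 2 / z.S)
      - Csqu3 α L σg σH N z / (Cβ * z.B) - 2 / Cβ with hΘ
  -- With U = C_𝓛/(2−q²), χ is exactly the shift that makes the smoothness bound equal to U(x+χ).
  -- The gain 4Θ/(C_β U) is 2θ, hence r = R/2; this produces √(χ/2)·√R and leaves a factor 2 in the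
  -- linear term.
  obtain ⟨h1, h2⟩ := h.output_bound_of_quadratic (w₀ := w₀) hP hL hρ hσ.le hσg hα hN hK hq
    ⟨hS, hD, hT, hB⟩ hbdd hCβ hOK (E := 4 * Θ)
    (F := 6 * (1 / 5 + 2 / Cβ) * ((Cerr1 α L σg N ^ 2 + Cerr2 α L ρ σg N ^ 2 * σ ^ 2) / z.S)
      + 2 / Cβ * ((Csqu1 α L σg σH N z / z.T + Csqu2 α L σg σH N z / z.S)
        + Csqu3 α L σg σH N z * σ ^ 2) / z.B)
    (U := CL α L ρ N / (2 - (1 + α * L) ^ (2 * N))) (χ := chi α L ρ σ N) (r := R / 2)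
    (by linarith) (by positivity) (by positivity) hχ
    (fun M x hM1 hM2 hx => descent_algebra hM1 hM2 hx
      (biasBound_nonneg hL hρ.le hσ.le hσg.le hα.le hq z hx)
      (biasBound_le hL hρ.le hσ.le hσg.le hα.le hq z hx) hS0 hB0 hCβ hV3
      (sq_add_mul_div_sqrt_le hS0.le))
    (fun x hx => le_of_eq (by rw [chi]; field_simp; ring))
    (le_of_eq (by
      have e1 : theta α L ρ σg σH Cβ N z
          = 2 * (2 - (1 + α * L) ^ (2 * N)) / (Cβ * CL α L ρ N) * Θ := rfl
      have e2 : 4 * Θ / (Cβ * (CL α L ρ N / (2 - (1 + α * L) ^ (2 * N)))) * (R / 2)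
          = theta α L ρ σg σH Cβ N z * R := by
        rw [e1]; field_simp; ring
      rw [e2, hR, mainRate]
      have e3 : theta α L ρ σg σH Cβ N z
          * (initialGap P α N w₀ / theta α L ρ σg σH Cβ N z * (1 / K)
            + xi α L ρ σ σg Cβ N / theta α L ρ σg σH Cβ N z * (1 / z.S)
            + phi α L σ σg σH Cβ N z / theta α L ρ σg σH Cβ N z * (1 / z.B))
          = initialGap P α N w₀ / K + xi α L ρ σ σg Cβ N / z.S
            + phi α L σ σg σH Cβ N z / z.B := by
        field_simp
      have e4 : ∀ u v : ℝ, (6 * (1 / 5 + 2 / Cβ) * (u / z.S) + 2 / Cβ * v / z.B) / (Cβ * L)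
          = 6 / (Cβ * L) * (1 / 5 + 2 / Cβ) * u / z.S + 2 / (Cβ ^ 2 * L) * v / z.B := by
        intro u v; field_simp
      rw [e3, e4, xi, phi]; ring))
  refine ⟨h1, h2.trans (add_le_add (by linarith) (le_of_eq ?_))⟩
  rw [← Real.sqrt_mul (by positivity)]
  congr 1
  ring

end General

/-! ### Numerical constants for α = 1/(8NL). -/

section Special

variable {L ρ σ σg σH α : ℝ} {N K : ℕ} {z : BatchSizes}

theorem exp_quarter_le : Real.exp (1 / 4) ≤ 257 / 200 := by
  have h : Real.exp (1 / 4) ^ 4 = Real.exp 1 := by rw [← Real.exp_nat_mul]; norm_num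
  refine le_of_pow_le_pow_left₀ (n := 4) (by norm_num) (by norm_num) ?_
  rw [h]
  exact Real.exp_one_lt_d9.le.trans (by norm_num)

/-- 1 + 2t + 2t² is the second Taylor polynomial of e^{2t}, and 2tN = 1/4; the bound is therefore
uniform in N. -/
theorem one_add_pow_le_of_le {t y : ℝ} (hN : 1 ≤ N) (ht : t = 1 / (8 * N)) (hy0 : 0 ≤ y)
    (hy : y ≤ 1 + 2 * t + 2 * t ^ 2) : y ^ N ≤ 257 / 200 := by
  have hN0 : (0 : ℝ) < N := by exact_mod_cast hN
  have ht0 : 0 ≤ t := by rw [ht]; positivity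
  have h1 : y ≤ Real.exp (2 * t) := by
    refine hy.trans ((le_of_eq ?_).trans (Real.quadratic_le_exp_of_nonneg (by linarith)))
    ring
  calc y ^ N ≤ Real.exp (2 * t) ^ N := pow_le_pow_left₀ hy0 h1 N
    _ = Real.exp (1 / 4) := by
        rw [← Real.exp_nat_mul]
        congr 1
        rw [ht]; field_simp; norm_num
    _ ≤ _ := exp_quarter_le

/-- Numerical bounds for `α = 1 / (8 N L)`. -/
theorem special_step_bounds (hL : 0 < L) (hN : 1 ≤ N) (hα : α = 1 / (8 * N * L)) :
    0 < α ∧ α * L = 1 / (8 * N) ∧ 1 ≤ (1 + α * L) ^ N ∧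
      ((1 + α * L) ^ N) ^ 2 ≤ 257 / 200 ∧ (1 + α * L) ^ N ≤ 567 / 500 := by
  have hN0 : (0 : ℝ) < N := by exact_mod_cast hN
  have h1 : α * L = 1 / (8 * N) := by rw [hα]; field_simp
  have h2 : 0 ≤ α * L := by rw [h1]; positivity
  have h3 : ((1 + α * L) ^ N) ^ 2 ≤ 257 / 200 := by
    rw [← pow_mul, mul_comm N, pow_mul]
    exact one_add_pow_le_of_le hN h1 (by positivity) (by nlinarith)
  have h4 : 1 ≤ (1 + α * L) ^ N := one_le_pow₀ (by linarith)
  exact ⟨by rw [hα]; positivity, h1, h4, h3, by nlinarith⟩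

theorem CL_le_special (hL : 0 < L) (hρ : 0 < ρ) (hN : 1 ≤ N) (hα : α = 1 / (8 * N * L)) :
    CL α L ρ N ≤ ρ / L * (1 / 5) := by
  obtain ⟨h0, h1, h2, h3, h4⟩ := special_step_bounds hL hN hα
  rw [CL_eq hL.ne' ρ hN]
  have h5 : (1 + α * L) ^ (N - 1) ≤ (1 + α * L) ^ N :=
    pow_le_pow_right₀ (by nlinarith [mul_pos h0 hL]) (Nat.sub_le _ _)
  have h6 : 0 < (1 + α * L) ^ (N - 1) := by positivity
  set q := (1 + α * L) ^ N
  set p := (1 + α * L) ^ (N - 1)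
  have h7 : p * (q - 1) * q ≤ 1 / 5 := by
    calc p * (q - 1) * q ≤ q * (q - 1) * q := by
          have : 0 ≤ q - 1 := by linarith
          gcongr
      _ = q ^ 2 * (q - 1) := by ring
      _ ≤ 257 / 200 * (567 / 500 - 1) := mul_le_mul h3 (by linarith) (by linarith) (by norm_num)
      _ ≤ 1 / 5 := by norm_num
  calc _ = ρ / L * (p * (q - 1) * q) := by ring
    _ ≤ _ := by gcongr

/-- The condition D ≥ σ_H²/L² makes the Hessian noise at most (αL)², so the base is at most 1 + 2αL
+ 2(αL)². -/
theorem Csqu1_le_special (hL : 0 < L) (hN : 1 ≤ N) (hα : α = 1 / (8 * N * L)) (hz : z.Pos)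
    (hD : σH ^ 2 / L ^ 2 ≤ (z.D : ℝ)) (σg : ℝ) :
    Csqu1 α L σg σH N z ≤ 771 / 200 * σg ^ 2 := by
  obtain ⟨h0, h1, -⟩ := special_step_bounds hL hN hα
  have hD0 : (0 : ℝ) < z.D := by exact_mod_cast hz.2.1
  have h2 : α ^ 2 * σH ^ 2 / z.D ≤ (α * L) ^ 2 := by
    rw [div_le_iff₀ hD0]
    rw [div_le_iff₀ (by positivity)] at hD
    calc α ^ 2 * σH ^ 2 ≤ α ^ 2 * (z.D * L ^ 2) := by gcongr
      _ = _ := by ring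
  have h3 := one_add_pow_le_of_le (y := α ^ 2 * σH ^ 2 / z.D + (1 + α * L) ^ 2) hN h1
    (by positivity) (by nlinarith)
  unfold Csqu1
  nlinarith [sq_nonneg σg]

theorem Csqu2_le_special (hL : 0 < L) (hN : 1 ≤ N) (hα : α = 1 / (8 * N * L)) (hz : z.Pos)
    (hD : σH ^ 2 / L ^ 2 ≤ (z.D : ℝ)) (σg : ℝ) :
    Csqu2 α L σg σH N z ≤ 2 * σg ^ 2 := by
  obtain ⟨h0, h1, -⟩ := special_step_bounds hL hN hα
  have hc := Csqu1_le_special hL hN hα hz hD σg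
  have hc0 := Csqu1_nonneg α L σg σH N z
  have ht : 0 < α * L := mul_pos h0 hL
  have h2 := one_add_pow_le_of_le (y := 1 + 2 * α * L + 2 * α ^ 2 * L ^ 2) hN h1
    (by positivity) (by nlinarith)
  have h3 : 1 ≤ (1 + 2 * α * L + 2 * α ^ 2 * L ^ 2) ^ N := one_le_pow₀ (by
    have : 0 ≤ 2 * α * L + 2 * α ^ 2 * L ^ 2 := by positivity
    linarith)
  have h4 : α * L * (1 + α * L)⁻¹ ≤ 1 := by
    rw [← div_eq_mul_inv, div_le_one (by linarith)]; linarith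
  unfold Csqu2
  rw [mul_assoc]
  calc _ ≤ Csqu1 α L σg σH N z * ((1 + 2 * α * L + 2 * α ^ 2 * L ^ 2) ^ N - 1) * 1 := by
        have : 0 ≤ (1 + 2 * α * L + 2 * α ^ 2 * L ^ 2) ^ N - 1 := by linarith
        gcongr
    _ ≤ (771 / 200 * σg ^ 2) * (257 / 200 - 1) * 1 := by gcongr
    _ ≤ _ := by nlinarith [sq_nonneg σg]

theorem Csqu3_le_special (hL : 0 < L) (hN : 1 ≤ N) (hα : α = 1 / (8 * N * L)) (hz : z.Pos)
    (hD : σH ^ 2 / L ^ 2 ≤ (z.D : ℝ)) (hσg : 0 < σg) : Csqu3 α L σg σH N z ≤ 20 := by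
  obtain ⟨h0, h1, h2, h3, h4⟩ := special_step_bounds hL hN hα
  have hc := Csqu1_le_special hL hN hα hz hD σg
  have e : (1 + α * L) ^ (2 * N) = ((1 + α * L) ^ N) ^ 2 := by rw [← pow_mul, mul_comm N]
  unfold Csqu3
  rw [e]
  set Q := ((1 + α * L) ^ N) ^ 2
  have h5 : 143 / 200 ≤ 2 - Q := by linarith
  rw [div_le_iff₀ (by positivity)]
  have h6 : (143 / 200 : ℝ) ^ 2 ≤ (2 - Q) ^ 2 := by gcongr
  calc 2 * Csqu1 α L σg σH N z * Q ≤ 2 * (771 / 200 * σg ^ 2) * (257 / 200) := by gcongr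
    _ ≤ 20 * ((143 / 200 : ℝ) ^ 2 * σg ^ 2) := by nlinarith [sq_nonneg σg]
    _ ≤ _ := by gcongr

/-- The lower bound on S turns the part of the squared bias that is proportional to x² into a small
fraction of x², which the descent can absorb. -/
theorem biasBound_sq_le_special (hL : 0 < L) (hρ : 0 < ρ) (hN : 1 ≤ N)
    (hα : α = 1 / (8 * N * L)) (hz : z.Pos) (hS : 15 * ρ ^ 2 * σg ^ 2 / L ^ 4 ≤ (z.S : ℝ))
    (hσg : 0 < σg) (σ x : ℝ) :
    biasBound α L ρ σ σg N z x ^ 2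
      ≤ 1 / 5 * (σg ^ 2 * (1 + ρ ^ 2 / L ^ 4 * σ ^ 2) / z.S) + 3 / 250 * x ^ 2 := by
  obtain ⟨h0, h1, h2, h3, h4⟩ := special_step_bounds hL hN hα
  have hS0 : (0 : ℝ) < z.S := by exact_mod_cast hz.1
  have e : (1 + α * L) ^ (2 * N) = ((1 + α * L) ^ N) ^ 2 := by rw [← pow_mul, mul_comm N]
  unfold biasBound
  rw [e]
  set q := (1 + α * L) ^ N with hq
  have h5 : 143 / 200 ≤ 2 - q ^ 2 := by linarith
  have h50 : 0 < 2 - q ^ 2 := by linarith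
  have hq1 : 0 ≤ q - 1 := by linarith
  set r := q * (q - 1) * σg with hr
  set m := q ^ 2 * (q - 1) / (2 - q ^ 2) with hm
  set s := m * (ρ * σg / L ^ 2) with hs
  have hm0 : 0 ≤ m := by positivity
  have hm1 : m ≤ 121 / 500 := by
    rw [hm, div_le_iff₀ h50]
    calc q ^ 2 * (q - 1) ≤ 257 / 200 * (567 / 500 - 1) := by gcongr
      _ ≤ 121 / 500 * (143 / 200) := by norm_num
      _ ≤ _ := by gcongr
  have hr1 : r ^ 2 ≤ 1 / 16 * σg ^ 2 := by
    have : q * (q - 1) ≤ 1 / 4 := by nlinarith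
    rw [hr, mul_pow]
    have h6 : (q * (q - 1)) ^ 2 ≤ (1 / 4) ^ 2 := by gcongr
    nlinarith [sq_nonneg σg]
  have hm2 : m ^ 2 ≤ (121 / 500) ^ 2 := by gcongr
  have hs1 : s ^ 2 = m ^ 2 * (ρ ^ 2 * σg ^ 2 / L ^ 4) := by rw [hs]; field_simp
  have hs2 : s ^ 2 ≤ 1 / 16 * (ρ ^ 2 / L ^ 4 * σg ^ 2) := by
    rw [hs1]
    have : ρ ^ 2 * σg ^ 2 / L ^ 4 = ρ ^ 2 / L ^ 4 * σg ^ 2 := by ring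
    rw [this]
    gcongr
    linarith
  -- 3·(121/500)²/15 is slightly below 3/250; the 15 comes from the condition on S.
  have hs3 : 3 * s ^ 2 ≤ 3 / 250 * z.S := by
    have h7 : ρ ^ 2 * σg ^ 2 / L ^ 4 ≤ z.S / 15 := by
      rw [le_div_iff₀ (by norm_num)]
      refine le_trans (le_of_eq ?_) hS
      ring
    rw [hs1]
    calc 3 * (m ^ 2 * (ρ ^ 2 * σg ^ 2 / L ^ 4)) ≤ 3 * ((121 / 500) ^ 2 * (z.S / 15)) := by gcongr
      _ ≤ _ := by nlinarith
  have e2 : q ^ 2 * (q - 1) * (ρ * σg / L ^ 2) * ((x + σ) / (2 - q ^ 2)) = s * (x + σ) := by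
    rw [hs, hm]; field_simp
  rw [e2]
  refine (sq_add_mul_div_sqrt_le hS0.le).trans ?_
  rw [div_le_iff₀ hS0]
  have e3 : (1 / 5 * (σg ^ 2 * (1 + ρ ^ 2 / L ^ 4 * σ ^ 2) / z.S) + 3 / 250 * x ^ 2) * z.S
      = 1 / 5 * (σg ^ 2 + ρ ^ 2 / L ^ 4 * σg ^ 2 * σ ^ 2) + 3 / 250 * z.S * x ^ 2 := by
    field_simp
  rw [e3]
  have t1 : s ^ 2 * σ ^ 2 ≤ 1 / 16 * (ρ ^ 2 / L ^ 4 * σg ^ 2) * σ ^ 2 := by gcongr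
  have t2 : 3 * s ^ 2 * x ^ 2 ≤ 3 / 250 * z.S * x ^ 2 := by gcongr
  have t3 : 0 ≤ ρ ^ 2 / L ^ 4 * σg ^ 2 * σ ^ 2 := by positivity
  nlinarith [sq_nonneg σg]

/-- From xb ≤ x²/10 + (5/2)b² the coefficient of x² in the gain is at least (8/9)(87/100). The
second-order term takes (1/50)(2 + 6/250 + 20) from it, and more than 1/4 is left. -/
theorem descent_algebra_special {M x b u W B : ℝ} (h1 : 8 / 9 ≤ M) (h2 : M ≤ 5 / 2)
    (hb : b ^ 2 ≤ 1 / 5 * u + 3 / 250 * x ^ 2) (hu : 0 ≤ u) (hB : 1 ≤ B) {V1 V3 : ℝ}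
    (hV3 : V3 ≤ 20) (hV1 : V1 / B + 20 * σ ^ 2 / B ≤ W) :
    M * (-x ^ 2 + x * b) + 2 / 100 * (2 * x ^ 2 + 2 * b ^ 2 + (V1 + V3 * (x ^ 2 + σ ^ 2)) / B)
      ≤ -(1 / 4 * x ^ 2) + (2 * u + 1 / 50 * W) := by
  have hB0 : 0 < B := by linarith
  have t1 : M * (-x ^ 2 + x * b) ≤ M * (-(9 / 10 * x ^ 2) + 5 / 2 * b ^ 2) := by
    refine mul_le_mul_of_nonneg_left ?_ (by linarith)
    nlinarith [sq_nonneg (x - 5 * b)]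
  have t2 : M * (-(9 / 10 * x ^ 2) + 5 / 2 * b ^ 2) ≤ M * (-(87 / 100 * x ^ 2) + 1 / 2 * u) := by
    refine mul_le_mul_of_nonneg_left ?_ (by linarith)
    nlinarith
  have t3 : M * (-(87 / 100 * x ^ 2) + 1 / 2 * u)
      ≤ -(8 / 9 * (87 / 100 * x ^ 2)) + 5 / 2 * (1 / 2 * u) := by nlinarith [sq_nonneg x]
  have t4 : (V1 + V3 * (x ^ 2 + σ ^ 2)) / B ≤ 20 * x ^ 2 + W := by
    have h3 : V3 * (x ^ 2 + σ ^ 2) ≤ 20 * (x ^ 2 + σ ^ 2) := by gcongr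
    have h4 : 20 * x ^ 2 / B ≤ 20 * x ^ 2 := div_le_self (by positivity) hB
    calc _ ≤ (V1 + 20 * (x ^ 2 + σ ^ 2)) / B := by gcongr
      _ = 20 * x ^ 2 / B + (V1 / B + 20 * σ ^ 2 / B) := by ring
      _ ≤ _ := by linarith
  nlinarith [sq_nonneg x]

end Special

/-- The factor in front of `simpleRate`, before taking roots. -/
def rateFactor (L ρ Δ : ℝ) : ℝ :=
  400 * (2 * L + ρ / L) * (Δ + (3 + 2 * (ρ ^ 2 / L ^ 4)) / (100 * L))

theorem rateFactor_pos {L ρ Δ : ℝ} (hL : 0 < L) (hρ : 0 < ρ) (hΔ : 0 < Δ) :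
    0 < rateFactor L ρ Δ := by
  unfold rateFactor; positivity

/-! ### The simplified rate. -/

section Simple

variable {d : ℕ} {I 𝒟 : Type*} [MeasurableSpace I] [MeasurableSpace 𝒟] {P : TaskFamily d I 𝒟}
  {L ρ σ σg σH α Δ : ℝ} {N K : ℕ} {z : BatchSizes}
  {Ω : Type*} [MeasurableSpace Ω] {μ : Measure Ω}
  {ξ : ∀ k, Ω → Seed I 𝒟 N z k} {ζ : Ω → Fin K} {w₀ : Param d}

theorem simpleRate_nonneg (σ σg : ℝ) (z : BatchSizes) (K : ℕ) : 0 ≤ simpleRate σ σg z K := by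
  unfold simpleRate; positivity

/-- The additive error of one descent step for `α = 1 / (8 N L)` and `C_β = 100`. -/
def specialError (L ρ σ σg : ℝ) (z : BatchSizes) : ℝ :=
  2 * (σg ^ 2 * (1 + ρ ^ 2 / L ^ 4 * σ ^ 2) / z.S)
    + 1 / 50 * (4 * σg ^ 2 / (z.T * z.B) + 2 * σg ^ 2 / z.S + 20 * σ ^ 2 / z.B)

theorem specialError_nonneg (L ρ σ σg : ℝ) (z : BatchSizes) : 0 ≤ specialError L ρ σ σg z := by
  unfold specialError; positivity

/-- Each term of the error is a term of the rate, with coefficient at most 2 + 1/25 apart from the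
one carrying ρ²/L⁴, which has coefficient 2ρ²/L⁴. -/
theorem specialError_le (L ρ σ σg : ℝ) (z : BatchSizes) (K : ℕ) :
    specialError L ρ σ σg z ≤ (3 + 2 * (ρ ^ 2 / L ^ 4)) * simpleRate σ σg z K := by
  unfold specialError
  set κ := ρ ^ 2 / L ^ 4 with hκ
  have hκ0 : 0 ≤ κ := by positivity
  have t0 : simpleRate σ σg z K = 1 / K + (σg ^ 2 / z.S + σg ^ 2 / z.S * σ ^ 2)
      + (σg ^ 2 / z.B + σ ^ 2 / z.B) + σg ^ 2 / (z.T * z.B) := by rw [simpleRate]; ring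
  have t1 : σg ^ 2 * (1 + κ * σ ^ 2) / z.S = σg ^ 2 / z.S + κ * (σg ^ 2 / z.S * σ ^ 2) := by ring
  have t2 : 4 * σg ^ 2 / (z.T * z.B) + 2 * σg ^ 2 / z.S + 20 * σ ^ 2 / z.B
      = 4 * (σg ^ 2 / (z.T * z.B)) + 2 * (σg ^ 2 / z.S) + 20 * (σ ^ 2 / z.B) := by ring
  rw [t0, t1, t2]
  have p0 : 0 ≤ 1 / (K : ℝ) := by positivity
  have p1 : 0 ≤ σg ^ 2 / z.S := by positivity
  have p2 : 0 ≤ σg ^ 2 / z.S * σ ^ 2 := by positivity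
  have p3 : 0 ≤ σg ^ 2 / z.B := by positivity
  have p4 : 0 ≤ σ ^ 2 / z.B := by positivity
  have p5 : 0 ≤ σg ^ 2 / (z.T * z.B) := by positivity
  generalize 1 / (K : ℝ) = A0 at *
  generalize σg ^ 2 / z.S * σ ^ 2 = A2 at *
  generalize σg ^ 2 / (z.S : ℝ) = A1 at *
  generalize σg ^ 2 / (z.B : ℝ) = A3 at *
  generalize σ ^ 2 / (z.B : ℝ) = A4 at *
  generalize σg ^ 2 / ((z.T : ℝ) * z.B) = A5 at *
  have m0 := mul_nonneg hκ0 p0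
  have m1 := mul_nonneg hκ0 p1
  have m3 := mul_nonneg hκ0 p3
  have m4 := mul_nonneg hκ0 p4
  have m5 := mul_nonneg hκ0 p5
  linarith

theorem descent_special (hL : 0 < L) (hρ : 0 < ρ) (hN : 1 ≤ N)
    (hα : α = 1 / (8 * N * L)) (hz : z.Pos) (hS : 15 * ρ ^ 2 * σg ^ 2 / L ^ 4 ≤ (z.S : ℝ))
    (hD : σH ^ 2 / L ^ 2 ≤ (z.D : ℝ)) (hσg : 0 < σg) {M x : ℝ} (h1 : 8 / 9 ≤ M)
    (h2 : M ≤ 5 / 2) :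
    M * (-x ^ 2 + x * biasBound α L ρ σ σg N z x)
        + 2 / 100 * (2 * x ^ 2 + 2 * biasBound α L ρ σ σg N z x ^ 2
          + secondMomentBound α L σ σg σH N z x / z.B)
      ≤ -(1 / 4 * x ^ 2) + specialError L ρ σ σg z := by
  have h0 := (special_step_bounds hL hN hα).1
  have hS0 : (0 : ℝ) < z.S := by exact_mod_cast hz.1
  have hB1 : (1 : ℝ) ≤ z.B := by exact_mod_cast hz.2.2.2
  have hV1 : (Csqu1 α L σg σH N z / z.T + Csqu2 α L σg σH N z / z.S) / z.B + 20 * σ ^ 2 / z.B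
      ≤ 4 * σg ^ 2 / (z.T * z.B) + 2 * σg ^ 2 / z.S + 20 * σ ^ 2 / z.B := by
    have t1 := Csqu1_le_special hL hN hα hz hD σg
    have t2 := Csqu2_le_special hL hN hα hz hD σg
    have t3 : Csqu1 α L σg σH N z / z.T / z.B ≤ 4 * σg ^ 2 / (z.T * z.B) := by
      rw [div_div]
      gcongr
      nlinarith [sq_nonneg σg]
    have t4 : Csqu2 α L σg σH N z / z.S / z.B ≤ 2 * σg ^ 2 / z.S :=
      (div_le_self (div_nonneg (Csqu2_nonneg h0.le hL.le σg σH N z) hS0.le) hB1).trans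
        (by gcongr)
    rw [add_div]
    linarith
  exact descent_algebra_special h1 h2 (biasBound_sq_le_special hL hρ hN hα hz hS hσg σ x)
    (by positivity) hB1 (Csqu3_le_special hL hN hα hz hD hσg) hV1

/-- C_𝓛/(2−q²) is at most ρ/L, and the constant term q²L ≤ 2L is absorbed by the extra 1 in χ = σ +
1. -/
theorem smoothness_special (hL : 0 < L) (hρ : 0 < ρ) (hσ : 0 ≤ σ) (hN : 1 ≤ N)
    (hα : α = 1 / (8 * N * L)) {x : ℝ} (hx : 0 ≤ x) :
    (1 + α * L) ^ (2 * N) * L + CL α L ρ N / (2 - (1 + α * L) ^ (2 * N)) * (x + σ)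
      ≤ (2 * L + ρ / L) * (x + (σ + 1)) := by
  obtain ⟨h0, h1, h2, h3, h4⟩ := special_step_bounds hL hN hα
  have e : (1 + α * L) ^ (2 * N) = ((1 + α * L) ^ N) ^ 2 := by rw [← pow_mul, mul_comm N]
  rw [e]
  have t1 := CL_le_special hL hρ hN hα
  have t6 : 0 < ρ / L := by positivity
  have t2 : CL α L ρ N / (2 - ((1 + α * L) ^ N) ^ 2) ≤ ρ / L := by
    rw [div_le_iff₀ (by linarith)]
    nlinarith
  have t3 : CL α L ρ N / (2 - ((1 + α * L) ^ N) ^ 2) * (x + σ) ≤ ρ / L * (x + σ) := by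
    gcongr
  have t4 : ((1 + α * L) ^ N) ^ 2 * L ≤ 2 * L :=
    mul_le_mul_of_nonneg_right (by linarith) hL.le
  have t5 : 0 ≤ L * (x + σ) := by positivity
  linarith

theorem rate_special (hL : 0 < L) (hρ : 0 < ρ) (hΔ : 0 < Δ) (hK : 1 ≤ K) {δ : ℝ} (hδ : δ ≤ Δ) :
    δ / K + specialError L ρ σ σg z / (100 * L)
      ≤ 1 / 4 / (100 * (2 * L + ρ / L)) * (rateFactor L ρ Δ * simpleRate σ σg z K) := by
  have hK0 : (0 : ℝ) < K := by exact_mod_cast hK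
  have hU : 0 < 2 * L + ρ / L := by positivity
  have hF := specialError_le L ρ σ σg z K
  have hs1 : 1 / K ≤ simpleRate σ σg z K := by
    rw [simpleRate, add_assoc, add_assoc]
    exact le_add_of_nonneg_right (by positivity)
  unfold rateFactor
  generalize simpleRate σ σg z K = s at *
  generalize 3 + 2 * (ρ ^ 2 / L ^ 4) = κ at *
  generalize 2 * L + ρ / L = U at *
  have t1 : 1 / 4 / (100 * U) * (400 * U * (Δ + κ / (100 * L)) * s)
      = Δ * s + κ * s / (100 * L) := by
    field_simp
    ring
  rw [t1]
  have t2 : δ / K ≤ Δ * s :=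
    calc _ ≤ Δ / K := by gcongr
      _ = Δ * (1 / K) := by ring
      _ ≤ _ := by gcongr
  have t3 : specialError L ρ σ σg z / (100 * L) ≤ κ * s / (100 * L) := by gcongr
  exact add_le_add t2 t3

/-- The convergence rate for `α = 1 / (8 N L)` and `C_β = 100`. -/
theorem IsRun.output_le_simpleRate [IsProbabilityMeasure μ] (h : IsRun P μ ξ ζ)
    (hP : Assumptions P L ρ σ σg σH) (hL : 0 < L) (hρ : 0 < ρ) (hσ : 0 < σ) (hσg : 0 < σg)
    (hN : 1 ≤ N) (hK : 1 ≤ K) (hz : z.Pos) (hα : α = 1 / (8 * N * L)) (hΔ : 0 < Δ)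
    (hbdd : BddBelow (Set.range (metaLoss P α N))) (hgap : initialGap P α N w₀ ≤ Δ)
    (hOK : z.SmoothOK N α L ρ σ σg) (hS : 15 * ρ ^ 2 * σg ^ 2 / L ^ 4 ≤ (z.S : ℝ))
    (hD : σH ^ 2 / L ^ 2 ≤ (z.D : ℝ)) :
    Integrable (outputGradNorm P α L ρ 100 ξ ζ w₀) μ ∧
      ∫ ω, outputGradNorm P α L ρ 100 ξ ζ w₀ ω ∂μ
        ≤ (rateFactor L ρ Δ + 1) * (simpleRate σ σg z K
          + √(σ + 1) * √(simpleRate σ σg z K)) := by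
  obtain ⟨h0, h1, h2, h3, h4⟩ := special_step_bounds hL hN hα
  have hq : (1 + α * L) ^ (2 * N) < 2 := by
    rw [mul_comm 2, pow_mul]; linarith
  obtain ⟨i1, i2⟩ := h.output_bound_of_quadratic (w₀ := w₀) (Cβ := 100) (E := 1 / 4)
    (F := specialError L ρ σ σg z) (U := 2 * L + ρ / L)
    (χ := σ + 1) (r := rateFactor L ρ Δ * simpleRate σ σg z K) hP hL hρ hσ.le hσg h0 hN
    hK hq hz hbdd (by norm_num) hOK (by norm_num) (specialError_nonneg L ρ σ σg z)
    (by positivity) (by linarith)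
    (fun M x hM1 hM2 hx => descent_special hL hρ hN hα hz hS hD hσg hM1 hM2)
    (fun x hx => smoothness_special hL hρ hσ.le hN hα hx)
    (rate_special hL hρ hΔ hK hgap)
  refine ⟨i1, i2.trans ?_⟩
  have hc0 := rateFactor_pos hL hρ hΔ
  have hs0 := simpleRate_nonneg σ σg z K
  generalize rateFactor L ρ Δ = c at *
  generalize simpleRate σ σg z K = s at *
  have t1 : √((σ + 1) * (c * s)) = √c * (√(σ + 1) * √s) := by
    rw [← Real.sqrt_mul (by linarith), ← Real.sqrt_mul hc0.le]
    congr 1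
    ring
  -- One constant c + 1 then covers both the linear term, with factor c, and the root term, with
  -- factor √c.
  have t2 : √c ≤ c + 1 := by
    rw [Real.sqrt_le_left (by linarith)]
    nlinarith
  rw [t1, mul_add]
  gcongr
  linarith

end Simple

/-! ### Batch sizes and complexity for a prescribed accuracy. -/

section Complexity

/-- Each summand is at most ε/4: the linear one because ε² ≤ ε, the root one after squaring. -/
theorem mul_add_sqrt_lt {C v y ε s : ℝ} (hC : 0 < C) (hv : 0 < v) (hs0 : 0 ≤ s) (hε : 0 < ε)
    (hε1 : ε ≤ 1) (hs : s ≤ y * ε ^ 2) (hy1 : C * y ≤ 1 / 4) (hy2 : C ^ 2 * (v * y) ≤ 1 / 16) :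
    C * (s + √v * √s) < ε := by
  have h1 : C * s ≤ 1 / 4 * ε := by
    calc C * s ≤ C * (y * ε ^ 2) := by gcongr
      _ = C * y * ε ^ 2 := by ring
      _ ≤ 1 / 4 * ε := by
        have : ε ^ 2 ≤ ε := by nlinarith
        calc _ ≤ 1 / 4 * ε ^ 2 := by gcongr
          _ ≤ _ := by gcongr
  have h2 : C * (√v * √s) ≤ 1 / 4 * ε := by
    refine abs_le_of_sq_le_sq' ?_ (by positivity) |>.2
    have e1 : (C * (√v * √s)) ^ 2 = C ^ 2 * (v * s) := by
      rw [mul_pow, mul_pow, Real.sq_sqrt hv.le, Real.sq_sqrt hs0]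
    rw [e1]
    calc C ^ 2 * (v * s) ≤ C ^ 2 * (v * (y * ε ^ 2)) := by gcongr
      _ = C ^ 2 * (v * y) * ε ^ 2 := by ring
      _ ≤ 1 / 16 * ε ^ 2 := by gcongr
      _ = _ := by ring
  linarith

theorem simpleRate_le_div {σ σg : ℝ} {z : BatchSizes} {n : ℕ} (hn : 1 ≤ n) (hS : n ≤ z.S)
    (hB : z.B = n) (hT : z.T = 1) :
    simpleRate σ σg z n ≤ (1 + σg ^ 2 * (σ ^ 2 + 1) + 2 * σg ^ 2 + σ ^ 2) / n := by
  have hn0 : (0 : ℝ) < n := by exact_mod_cast hn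
  have h1 : σg ^ 2 * (σ ^ 2 + 1) / z.S ≤ σg ^ 2 * (σ ^ 2 + 1) / n := by gcongr
  rw [simpleRate, hB, hT]
  push_cast
  have e : (1 + σg ^ 2 * (σ ^ 2 + 1) + 2 * σg ^ 2 + σ ^ 2) / n
      = 1 / n + σg ^ 2 * (σ ^ 2 + 1) / n + (σg ^ 2 + σ ^ 2) / n + σg ^ 2 / (1 * n) := by ring
  rw [e]
  linarith

/-- Since C_𝓛 ≤ ρ/L and powers of 1+αL are at least 1, the thresholds in (1) are bounded
independently of N, so fixed sizes serve for all N and ε. -/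
theorem smoothOK_of_lt {L ρ σ σg α : ℝ} {N : ℕ} {z : BatchSizes} (hL : 0 < L) (hρ : 0 < ρ)
    (hN : 1 ≤ N) (hα : α = 1 / (8 * N * L))
    (hB' : ∀ k, 4 * (ρ / L) ^ 2 * σ ^ 2 / (3 * L ^ 2) < (z.B' k : ℝ))
    (hDL : ∀ k b, 64 * σg ^ 2 * (ρ / L) ^ 2 / L ^ 2 < (z.DL k b : ℝ)) :
    z.SmoothOK N α L ρ σ σg := by
  obtain ⟨h0, h1, -⟩ := special_step_bounds hL hN hα
  have hC0 := CL_pos h0 hL hρ hN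
  have hC : CL α L ρ N ≤ ρ / L :=
    (CL_le_special hL hρ hN hα).trans (mul_le_of_le_one_right (by positivity) (by norm_num))
  have hp : 1 ≤ (1 + α * L) ^ (4 * N) := one_le_pow₀ (by nlinarith [mul_pos h0 hL])
  refine fun k => ⟨lt_of_le_of_lt ?_ (hB' k), fun b => lt_of_le_of_lt ?_ (hDL k b)⟩
  · gcongr
    linarith
  · gcongr
    exact le_mul_of_one_le_left (by positivity) hp

/-- Batch sizes for accuracy of order `1 / √n`. -/
def sizesOf (n s D b l : ℕ) : BatchSizes where
  S := n + s
  D := D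
  T := 1
  B := n
  B' _ := b
  DL _ _ := l

/-- With t = 1/ε² ≥ 1 one has n ≤ (M+1)t. The product of the number of tasks and the inner batch
size is of order t², everything else of order t. -/
theorem complexity_bounds {M ε n s D b l N : ℝ} (hM : 0 ≤ M) (hε : 0 < ε) (hε1 : ε ≤ 1)
    (hn0 : 0 ≤ n) (hn : n ≤ M / ε ^ 2 + 1) (hs : 0 ≤ s) (hD : 0 ≤ D) (hb : 0 ≤ b) (hl : 0 ≤ l)
    (hN : 1 ≤ N) {C : ℝ} (hC : C = (M + 1) * (M + 1 + s) + (M + 1) * (D + 1) + b * l) :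
    n ≤ C / ε ^ 2 ∧ n * (N * (n + s) + 1) + b * l ≤ C * (N / ε ^ 4 + 1 / ε ^ 2) ∧
      n * (N * D) ≤ C * (N / ε ^ 2) := by
  obtain ⟨t, ht⟩ : ∃ t, t = 1 / ε ^ 2 := ⟨_, rfl⟩
  have ht1 : 1 ≤ t := by
    rw [ht, le_div_iff₀ (by positivity)]
    nlinarith
  have hn' : n ≤ (M + 1) * t := by
    have : M / ε ^ 2 = M * t := by rw [ht]; ring
    rw [this] at hn
    linarith
  have e1 : C / ε ^ 2 = C * t := by rw [ht]; ring
  have e2 : N / ε ^ 4 + 1 / ε ^ 2 = N * t ^ 2 + t := by rw [ht]; field_simp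
  have e3 : N / ε ^ 2 = N * t := by rw [ht]; ring
  rw [e1, e2, e3]
  have c1 : 0 ≤ (M + 1) * (M + 1 + s) := by positivity
  have c2 : 0 ≤ (M + 1) * D := by positivity
  have c3 : 0 ≤ b * l := by positivity
  have hC1 : M + 1 + b * l ≤ C := by rw [hC]; nlinarith
  have hC2 : (M + 1) * D ≤ C := by rw [hC]; nlinarith
  have hC3 : (M + 1) * (M + 1 + s) ≤ C := by rw [hC]; nlinarith
  refine ⟨?_, ?_, ?_⟩
  · calc n ≤ (M + 1) * t := hn'
      _ ≤ C * t := by gcongr; linarith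
  · have h1 : n + s ≤ (M + 1 + s) * t := by nlinarith
    have h2 : n * (N * (n + s)) ≤ C * (N * t ^ 2) :=
      calc n * (N * (n + s)) ≤ (M + 1) * t * (N * ((M + 1 + s) * t)) := by gcongr
        _ = (M + 1) * (M + 1 + s) * (N * t ^ 2) := by ring
        _ ≤ _ := by gcongr
    have h3 : n + b * l ≤ C * t :=
      calc n + b * l ≤ (M + 1) * t + b * l * t := by
            exact add_le_add hn' (le_mul_of_one_le_right c3 ht1)
        _ = (M + 1 + b * l) * t := by ring
        _ ≤ _ := by gcongr
    linarith
  · calc n * (N * D) ≤ (M + 1) * t * (N * D) := by gcongr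
      _ = (M + 1) * D * (N * t) := by ring
      _ ≤ _ := by gcongr

/-- The number `n` of tasks and iterations is chosen as `⌈accuracyConst / ε²⌉`. -/
def accuracyConst (L ρ σ σg Δ : ℝ) : ℝ :=
  (1 + σg ^ 2 * (σ ^ 2 + 1) + 2 * σg ^ 2 + σ ^ 2)
    * (4 * (rateFactor L ρ Δ + 1) + 16 * ((rateFactor L ρ Δ + 1) ^ 2 * (σ + 1)))

theorem simpleRate_bound_lt {L ρ σ σg Δ ε : ℝ} (hL : 0 < L) (hρ : 0 < ρ) (hσ : 0 < σ)
    (hΔ : 0 < Δ) (hε : 0 < ε) (hε1 : ε ≤ 1) {z : BatchSizes} {n : ℕ} (hS : n ≤ z.S)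
    (hB : z.B = n) (hT : z.T = 1) (hn : accuracyConst L ρ σ σg Δ / ε ^ 2 ≤ n) :
    (rateFactor L ρ Δ + 1) * (simpleRate σ σg z n + √(σ + 1) * √(simpleRate σ σg z n)) < ε := by
  have hF := rateFactor_pos hL hρ hΔ
  have hC : 0 < rateFactor L ρ Δ + 1 := by linarith
  unfold accuracyConst at hn
  set C := rateFactor L ρ Δ + 1
  set c₁ := 1 + σg ^ 2 * (σ ^ 2 + 1) + 2 * σg ^ 2 + σ ^ 2 with hc₁
  have hc₁0 : 0 < c₁ := by rw [hc₁]; positivity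
  set m := 4 * C + 16 * (C ^ 2 * (σ + 1)) with hm
  have hm0 : 0 < m := by rw [hm]; positivity
  have hn0 : (0 : ℝ) < n := lt_of_lt_of_le (by positivity) hn
  -- Since m is the sum of 4C and 16C²(σ+1), its inverse satisfies both smallness conditions.
  refine mul_add_sqrt_lt (y := 1 / m) hC (by linarith) (simpleRate_nonneg _ _ _ _) hε hε1
    ((simpleRate_le_div (by exact_mod_cast hn0) hS hB hT).trans ?_) ?_ ?_
  · rw [div_le_iff₀ hn0]
    rw [div_le_iff₀ (by positivity)] at hn
    calc c₁ = 1 / m * (c₁ * m) := by field_simp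
      _ ≤ 1 / m * (n * ε ^ 2) := by gcongr
      _ = _ := by ring
  · rw [mul_one_div, div_le_iff₀ hm0, hm]
    have : 0 < C ^ 2 * (σ + 1) := by positivity
    linarith
  · rw [mul_one_div, mul_div_assoc', div_le_iff₀ hm0, hm]
    linarith

end Complexity

end MAML

end

/-! ### Assembly of the three claims. -/

theorem mainTheorem9 :
    -- the convergence rate
    (∀ (d : ℕ) (I 𝒟 Ω : Type*) [MeasurableSpace I] [MeasurableSpace 𝒟] [MeasurableSpace Ω]
        (P : MAML.TaskFamily d I 𝒟) (L ρ σ σg σH α Cβ : ℝ) (N K : ℕ) (z : MAML.BatchSizes)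
        (μ : MeasureTheory.Measure Ω) [MeasureTheory.IsProbabilityMeasure μ]
        (ξ : ∀ k, Ω → MAML.Seed I 𝒟 N z k) (ζ : Ω → Fin K) (w₀ : MAML.Param d),
      0 < L → 0 < ρ → 0 < σ → 0 < σg → 0 < σH →
      MAML.Assumptions P L ρ σ σg σH →
      1 ≤ N → 1 ≤ K → z.Pos →
      0 < α → α < ((2 : ℝ) ^ (1 / (2 * (N : ℝ))) - 1) / L →
      BddBelow (Set.range (MAML.metaLoss P α N)) →
      0 < Cβ → z.SmoothOK N α L ρ σ σg →
      0 < MAML.theta α L ρ σg σH Cβ N z →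
      MAML.IsRun P μ ξ ζ →
      Differentiable ℝ (MAML.metaLoss P α N) ∧
      MeasureTheory.Integrable (MAML.outputGradNorm P α L ρ Cβ ξ ζ w₀) μ ∧
      ∫ ω, MAML.outputGradNorm P α L ρ Cβ ξ ζ w₀ ω ∂μ
        ≤ MAML.mainRate (MAML.initialGap P α N w₀) α L ρ σ σg σH Cβ N z K
          + √(MAML.chi α L ρ σ N / 2)
            * √(MAML.mainRate (MAML.initialGap P α N w₀) α L ρ σ σg σH Cβ N z K)) ∧
    -- the simplified rate for `α = 1 / (8 N L)`, `C_β = 100`; the constant depends only on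
    -- `L`, `ρ` and the initial gap
    (∀ L ρ Δ : ℝ, 0 < L → 0 < ρ → 0 < Δ → ∃ C : ℝ, 0 < C ∧
      ∀ (d : ℕ) (I 𝒟 Ω : Type*) [MeasurableSpace I] [MeasurableSpace 𝒟] [MeasurableSpace Ω]
        (P : MAML.TaskFamily d I 𝒟) (σ σg σH α : ℝ) (N K : ℕ) (z : MAML.BatchSizes)
        (μ : MeasureTheory.Measure Ω) [MeasureTheory.IsProbabilityMeasure μ]
        (ξ : ∀ k, Ω → MAML.Seed I 𝒟 N z k) (ζ : Ω → Fin K) (w₀ : MAML.Param d),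
      0 < σ → 0 < σg → 0 < σH →
      MAML.Assumptions P L ρ σ σg σH →
      1 ≤ N → 1 ≤ K → z.Pos →
      α = 1 / (8 * N * L) →
      BddBelow (Set.range (MAML.metaLoss P α N)) →
      MAML.initialGap P α N w₀ ≤ Δ →
      z.SmoothOK N α L ρ σ σg →
      15 * ρ ^ 2 * σg ^ 2 / L ^ 4 ≤ (z.S : ℝ) →
      σH ^ 2 / L ^ 2 ≤ (z.D : ℝ) →
      MAML.IsRun P μ ξ ζ →
      Differentiable ℝ (MAML.metaLoss P α N) ∧
      MeasureTheory.Integrable (MAML.outputGradNorm P α L ρ 100 ξ ζ w₀) μ ∧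
      ∫ ω, MAML.outputGradNorm P α L ρ 100 ξ ζ w₀ ω ∂μ
        ≤ C * (MAML.simpleRate σ σg z K + √(σ + 1) * √(MAML.simpleRate σ σg z K))) ∧
    -- the complexity; the constant depends on neither `ε` nor `N`
    (∀ L ρ σ σg σH Δ : ℝ, 0 < L → 0 < ρ → 0 < σ → 0 < σg → 0 < σH → 0 < Δ →
      ∃ C : ℝ, 0 < C ∧
      ∀ (N : ℕ) (α ε : ℝ), 1 ≤ N → α = 1 / (8 * N * L) → 0 < ε → ε ≤ 1 →
      ∃ (z : MAML.BatchSizes) (K : ℕ),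
        1 ≤ K ∧ z.Pos ∧
        z.SmoothOK N α L ρ σ σg ∧
        15 * ρ ^ 2 * σg ^ 2 / L ^ 4 ≤ (z.S : ℝ) ∧
        σH ^ 2 / L ^ 2 ≤ (z.D : ℝ) ∧
        (K : ℝ) ≤ C / ε ^ 2 ∧
        (∀ k, (z.gradEvals N k : ℝ) ≤ C * (N / ε ^ 4 + 1 / ε ^ 2)) ∧
        (z.hessEvals N : ℝ) ≤ C * (N / ε ^ 2) ∧
        ∀ (d : ℕ) (I 𝒟 Ω : Type*) [MeasurableSpace I] [MeasurableSpace 𝒟] [MeasurableSpace Ω]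
          (P : MAML.TaskFamily d I 𝒟)
          (μ : MeasureTheory.Measure Ω) [MeasureTheory.IsProbabilityMeasure μ]
          (ξ : ∀ k, Ω → MAML.Seed I 𝒟 N z k) (ζ : Ω → Fin K) (w₀ : MAML.Param d),
        MAML.Assumptions P L ρ σ σg σH →
        BddBelow (Set.range (MAML.metaLoss P α N)) →
        MAML.initialGap P α N w₀ ≤ Δ →
        MAML.IsRun P μ ξ ζ →
        Differentiable ℝ (MAML.metaLoss P α N) ∧
        MeasureTheory.Integrable (MAML.outputGradNorm P α L ρ 100 ξ ζ w₀) μ ∧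
        ∫ ω, MAML.outputGradNorm P α L ρ 100 ξ ζ w₀ ω ∂μ < ε) := by

  refine ⟨?_, ?_, ?_⟩
  · intro d I 𝒟 Ω _ _ _ P L ρ σ σg σH α Cβ N K z μ _ ξ ζ w₀ hL hρ hσ hσg _ hP hN hK hz hα hα'
      hbdd hCβ hOK hθ h
    exact ⟨hP.differentiable_metaLoss hL hα.le N,
      h.output_le_mainRate hP hL hρ hσ hσg hα hN hK
        (MAML.one_add_pow_two_mul_lt_two hL hα hN hα') hz hbdd hCβ hOK hθ⟩
  · intro L ρ Δ hL hρ hΔ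
    refine ⟨MAML.rateFactor L ρ Δ + 1, by linarith [MAML.rateFactor_pos hL hρ hΔ], ?_⟩
    intro d I 𝒟 Ω _ _ _ P σ σg σH α N K z μ _ ξ ζ w₀ hσ hσg _ hP hN hK hz hα hbdd hgap hOK hS
      hD h
    exact ⟨hP.differentiable_metaLoss hL (MAML.special_step_bounds hL hN hα).1.le N,
      h.output_le_simpleRate hP hL hρ hσ hσg hN hK hz hα hΔ hbdd hgap hOK hS hD⟩
  · intro L ρ σ σg σH Δ hL hρ hσ hσg hσH hΔ
    have hM : 0 < MAML.accuracyConst L ρ σ σg Δ := by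
      have := MAML.rateFactor_pos hL hρ hΔ
      unfold MAML.accuracyConst
      positivity
    -- Ceilings serve the weak inequalities on S and D, floors plus one the strict inequalities in
    -- (1). None of these numbers depends on N or ε.
    let s : ℕ := ⌈15 * ρ ^ 2 * σg ^ 2 / L ^ 4⌉₊
    let D : ℕ := ⌈σH ^ 2 / L ^ 2⌉₊ + 1
    let b : ℕ := ⌊4 * (ρ / L) ^ 2 * σ ^ 2 / (3 * L ^ 2)⌋₊ + 1
    let l : ℕ := ⌊64 * σg ^ 2 * (ρ / L) ^ 2 / L ^ 2⌋₊ + 1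
    set M := MAML.accuracyConst L ρ σ σg Δ
    refine ⟨(M + 1) * (M + 1 + s) + (M + 1) * (D + 1) + b * l, by positivity, ?_⟩
    intro N α ε hN hα hε hε1
    let n : ℕ := ⌈M / ε ^ 2⌉₊
    have hn : M / ε ^ 2 ≤ n := Nat.le_ceil _
    have hn1 : 1 ≤ n := Nat.one_le_iff_ne_zero.2 (Nat.ceil_pos.2 (by positivity)).ne'
    obtain ⟨c1, c2, c3⟩ := MAML.complexity_bounds (M := M) (ε := ε) (n := n) (s := s) (D := D)
      (b := b) (l := l) (N := N) hM.le hε hε1 (by positivity)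
      (Nat.ceil_lt_add_one (by positivity)).le (by positivity) (by positivity) (by positivity)
      (by positivity) (by exact_mod_cast hN) rfl
    have hz : (MAML.sizesOf n s D b l).Pos :=
      ⟨hn1.trans (Nat.le_add_right _ _), Nat.le_add_left _ _, le_rfl, hn1⟩
    have hOK : (MAML.sizesOf n s D b l).SmoothOK N α L ρ σ σg :=
      MAML.smoothOK_of_lt hL hρ hN hα
        (fun _ => (Nat.lt_floor_add_one _).trans_eq (Nat.cast_succ _).symm)
        (fun _ _ => (Nat.lt_floor_add_one _).trans_eq (Nat.cast_succ _).symm)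
    have hS : 15 * ρ ^ 2 * σg ^ 2 / L ^ 4 ≤ ((MAML.sizesOf n s D b l).S : ℝ) :=
      (Nat.le_ceil _).trans (Nat.cast_le.2 (Nat.le_add_left s n))
    have hD : σH ^ 2 / L ^ 2 ≤ ((MAML.sizesOf n s D b l).D : ℝ) :=
      (Nat.le_ceil _).trans (Nat.cast_le.2 (Nat.le_succ _))
    refine ⟨MAML.sizesOf n s D b l, n, hn1, hz, hOK, hS, hD, c1, fun k => ?_, ?_, ?_⟩
    · refine le_trans (le_of_eq ?_) c2
      have e : (MAML.sizesOf n s D b l).gradEvals N k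
          = n * (N * (n + s) + 1) + ∑ _ : Fin b, l := rfl
      rw [e]
      simp
    · refine le_trans (le_of_eq ?_) c3
      simp [MAML.BatchSizes.hessEvals, MAML.sizesOf]
    · intro d I 𝒟 Ω _ _ _ P μ _ ξ ζ w₀ hP hbdd hgap h
      obtain ⟨i1, i2⟩ := h.output_le_simpleRate hP hL hρ hσ hσg hN hn1 hz hα hΔ hbdd hgap hOK hS hD
      exact ⟨hP.differentiable_metaLoss hL (MAML.special_step_bounds hL hN hα).1.le N, i1,
        i2.trans_lt (MAML.simpleRate_bound_lt hL hρ hσ hΔ hε hε1 (Nat.le_add_right n s) rfl rfl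
          hn)⟩
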